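/- **Setting.** Let $\ell\ge 1$, $T>0$, let $\Omega\subset\mathbb R^\ell$ be open, bounded and connected, $Q_T=(0,T)\times\Omega$, and let $\Gamma\subset\partial\Omega$ be a measurable part of the boundary with positive $(\ell-1)$-dimensional measure. The phases are $\alpha\in\{l,g\}$ (liquid, gas). The data satisfy: * the porosity $\phi$ is measurable with $0<\phi_0\le\phi\le\phi_1$ a.e. in $\Omega$; * the mobilities $M_\alpha:[0,1]\to[0,\infty)$ are continuous and non-decreasing, $M_\alpha(0)=0$, and $M(s):=M_l(s)+M_g(1-s)\ge m_0>0$ on $[0,1]$; they are extended by constants outside $[0,1]$; * $f_P,f_I\in L^2(Q_T)$ are a.e. non-negative; $s^I_\alpha$ is measurable on $Q_T$ with $0\le s^I_\alpha\le 1$ a.e.; ${\bf g}\in\mathbb R^\ell$ is a constant vector; * $\rho_\alpha\in C^1(\mathbb R)$ is non-decreasing with $0<\rho_m\le\rho_\alpha\le\rho_M$; * $p_c\in C^1([0,1];[0,\infty))$ is decreasing, $|p_c'|\ge\underline{p_c}>0$, $p_c(1)=0$; outside $[0,1]$ the values of $p_c$ are arbitrary; * $\gamma(s)=-\frac{M_l(s)M_g(1-s)}{M(s)}p_c'(s)$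 is $C^1$ on $[0,1]$, positive on $(0,1)$, zero at $0$ and $1$, and, with $\mathcal B(s)=\int_0^s\gamma$, the inverse $\mathcal B^{-1}:[0,\mathcal B(1)]\to[0,1]$ is Hölder continuous of some order $\theta\in(0,1]$; * $p^0_\alpha\in L^2(\Omega)$, and the $s^0_\alpha$ are measurable with $s^0_\alpha\ge0$ and $s^0_l+s^0_g=1$ a.e. in $\Omega$. **Discretization.** A discretization $\mathcal D$ consists of an integer $N\ge0$, with $\delta t=T/(N+1)$, $t^n=n\,\delta t$, and an admissible mesh: finitely many non-empty, pairwise disjoint, open convex polytopes $K\subset\Omega$ whose union has closure $\overline\Omega$, and points $x_K\in K$. For $K\ne L$ let $\sigma_{K|L}=\overline K\cap\overline L$, $d_{K|L}=|x_K-x_L|$, $\eta_{K|L}=(x_L-x_K)/d_{K|L}$, and let $N(K)$ be the set of $L\neq K$ for which $\sigma_{K|L}$ has positive $(\ell-1)$-dimensional Lebesgue measure $|\sigma_{K|L}|$. It is required that $\partial K=(\overline K\cap\partial\Omega)\cup\bigcup_{L\in N(K)}\sigma_{K|L}$, that $x_L-x_K$ is orthogonal to $\sigma_{K|L}$ for $L\in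 N(K)$, and, for a fixed $\xi>0$, that $\sum_{L\in N(K)}|\sigma_{K|L}|d_{K|L}\le\xi|K|$ for all $K$. Moreover, for every $K$, the set $\overline K\cap\Gamma$ is, up to null sets for the $(\ell-1)$-dimensional measure, the disjoint union of a finite set $\mathcal E_\Gamma(K)$ of measurable flat faces $\sigma$, each in a supporting hyperplane of $K$ with outward unit normal $\eta_\sigma$ and distance $d_{K,\sigma}$ to $x_K$. Let $\mathrm{size}(\mathcal D)=\max(\max_K\mathrm{diam}\,K,\ \delta t)$. **Scheme.** For $0\le n\le N$ let $\phi_K$, $p^0_{\alpha,K}$, $s^0_{\alpha,K}$ and $f_{P,K}^{n+1}$, $f_{I,K}^{n+1}$, $(s^I_{\alpha,K})^{n+1}$ be the mean values of $\phi,p^0_\alpha,s^0_\alpha$ over $K$ and of $f_P,f_I,s^I_\alpha$ over $(t^n,t^{n+1})\times K$. Let $c^+=\max(c,0)$, $c^-=\max(-c,0)$, and let $\rho_\alpha(a,b)$ be defined by $\frac1{\rho_\alpha(a,b)}=\frac1{b-a}\int_a^b\frac{d\zeta}{\rho_\alpha(\zeta)}$ if $a\ne b$, $\rho_\alpha(a,a)=\rho_\alpha(a)$.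 Define the flux through a face of area $A$, distance $\delta$ and unit normal $\eta$ between the states $(p,s)$ and $(p',s')$ by $$\Phi_\alpha(A,\delta,\eta;p,s,p',s')=\tfrac{A}{\delta}\rho_\alpha(p,p')\big(-M_\alpha(s')(p'-p)^++M_\alpha(s)(p'-p)^-\big)+A\,\rho_\alpha(p,p')^2\big(M_\alpha(s)({\bf g}\cdot\eta)^+-M_\alpha(s')({\bf g}\cdot\eta)^-\big).$$ A discrete solution is a family of reals $(p^n_{\alpha,K},s^n_{\alpha,K})$, $0\le n\le N+1$, with the above initial values such that for all $\alpha$, $K$ and $0\le n\le N$ $$|K|\phi_K\frac{\rho_\alpha(p^{n+1}_{\alpha,K})s^{n+1}_{\alpha,K}-\rho_\alpha(p^{n}_{\alpha,K})s^{n}_{\alpha,K}}{\delta t}+\sum_{L\in N(K)}\Phi_\alpha(|\sigma_{K|L}|,d_{K|L},\eta_{K|L};p^{n+1}_{\alpha,K},s^{n+1}_{\alpha,K},p^{n+1}_{\alpha,L},s^{n+1}_{\alpha,L})$$ $$+\sum_{\sigma\in\mathcal E_\Gamma(K)}\Phi_\alpha(|\sigma|,d_{K,\sigma},\eta_\sigma;p^{n+1}_{\alpha,K},s^{n+1}_{\alpha,K},0,s_{\alpha,\Gamma})+|K|\rho_\alpha(p^{n+1}_{\alpha,K})s^{n+1}_{\alpha,K}f^{n+1}_{P,K}=|K|\rho_\alpha(p^{n+1}_{\alpha,K})(s^I_{\alpha,K})^{n+1}f^{n+1}_{I,K},$$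 $$s^{n+1}_{l,K}+s^{n+1}_{g,K}=1,\qquad p_c(s^{n+1}_{l,K})=p^{n+1}_{g,K}-p^{n+1}_{l,K},$$ where $s_{l,\Gamma}=1$, $s_{g,\Gamma}=0$ (boundary conditions $p_l=p_g=0$ on $\Gamma$, no flux on the rest of $\partial\Omega$). Put $U^n_{\alpha,K}=\phi_K\rho_\alpha(p^n_{\alpha,K})s^n_{\alpha,K}$ and $$\bar U_{\alpha,\mathcal D}(t,x)=\frac1{\delta t}\big((t-t^n)U^{n+1}_{\alpha,K}+(t^{n+1}-t)U^n_{\alpha,K}\big)\quad\text{for }t\in(t^n,t^{n+1}),\ x\in K,\ 0\le n\le N,$$ and $\bar U_{\alpha,\mathcal D}=0$ elsewhere. For $y\in\mathbb R^\ell$ let $\Omega'=\Omega'_y=\{x\in\Omega:[x,x+y]\subset\Omega\}$ and $$I_{\alpha,\mathcal D}(y)=\int_{\Omega'\times(0,T)}|\bar U_{\alpha,\mathcal D}(t,x+y)-\bar U_{\alpha,\mathcal D}(t,x)|\,dx\,dt .$$ **Lemma.** Fix data as above and $\xi>0$. 1. There is a function $\omega:[0,\infty)\to[0,\infty)$ with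 $\omega(r)\to0$ as $r\to0$, depending only on the data and $\xi$, such that for every discretization $\mathcal D$, every discrete solution, both $\alpha$ and all $y\in\mathbb R^\ell$, $$I_{\alpha,\mathcal D}(y)\le\omega(|y|)+\omega(\mathrm{size}(\mathcal D)).$$ 2. For every sequence $(\mathcal D_m)$ of discretizations with $\mathrm{size}(\mathcal D_m)\to0$ and any choice of a discrete solution for each $m$, there is $\omega:[0,\infty)\to[0,\infty)$ with $\omega(r)\to0$ as $r\to0$ such that for all $m$, both $\alpha$ and all $y\in\mathbb R^\ell$, $$I_{\alpha,\mathcal D_m}(y)\le\omega(|y|).$$ -/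

import Mathlib

open MeasureTheory Set Filter Topology
open scoped NNReal ENNReal

noncomputable section

namespace TwoPhaseFV

/-- The two fluids: the wetting (liquid) phase and the gas phase. -/
inductive Phase where
  | liquid : Phase
  | gas : Phase

/-- `(ℓ-1)`-dimensional area of a flat subset of `ℝ^ℓ`: the Hausdorff measure normalised so as to
agree with Lebesgue measure on hyperplanes (the counting measure if `ℓ = 1`). -/
def faceMeasure (ℓ : ℕ) : Measure (EuclideanSpace ℝ (Fin ℓ)) :=
  Measure.euclideanHausdorffMeasure (ℓ - 1)

/-! ### Data of the continuous problem -/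

/-- Data of the two-phase flow problem. Time comes first in functions of time and space. The
functions of a saturation (`M`, `pc`) are only meaningful on `[0,1]`. -/
structure Data (ℓ : ℕ) where
  /-- the porous medium -/
  Ω : Set (EuclideanSpace ℝ (Fin ℓ))
  /-- the injection (Dirichlet) part of the boundary, the rest of the boundary is impervious -/
  Γ : Set (EuclideanSpace ℝ (Fin ℓ))
  /-- final time -/
  T : ℝ
  /-- porosity -/
  φ : EuclideanSpace ℝ (Fin ℓ) → ℝ
  /-- mobility of each phase, as a function of the saturation of that phase -/
  M : Phase → ℝ → ℝ
  /-- capillary pressure, as a function of the liquid saturation -/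
  pc : ℝ → ℝ
  /-- density of each phase, as a function of the pressure of that phase -/
  ρ : Phase → ℝ → ℝ
  /-- gravity vector -/
  g : EuclideanSpace ℝ (Fin ℓ)
  /-- production term -/
  fP : ℝ → EuclideanSpace ℝ (Fin ℓ) → ℝ
  /-- injection term -/
  fI : ℝ → EuclideanSpace ℝ (Fin ℓ) → ℝ
  /-- saturations of the injected fluid -/
  sI : Phase → ℝ → EuclideanSpace ℝ (Fin ℓ) → ℝ
  /-- initial pressures -/
  p0 : Phase → EuclideanSpace ℝ (Fin ℓ) → ℝ
  /-- initial saturations -/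
  s0 : Phase → EuclideanSpace ℝ (Fin ℓ) → ℝ

namespace Data

variable {ℓ : ℕ} (d : Data ℓ)

/-- Total mobility, as a function of the liquid saturation. -/
def Mtot (s : ℝ) : ℝ := d.M Phase.liquid s + d.M Phase.gas (1 - s)

/-- Capillary term `γ(s) = - (M_l(s) M_g(1-s) / M(s)) p_c'(s)`. -/
def γ (s : ℝ) : ℝ :=
  -(d.M Phase.liquid s * d.M Phase.gas (1 - s) / d.Mtot s) * derivWithin d.pc (Icc 0 1) s

/-- `𝓑(s) = ∫₀ˢ γ`. -/
def B (s : ℝ) : ℝ := ∫ z in (0 : ℝ)..s, d.γ z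

/-- The inverse of `𝓑 : [0,1] → [0, 𝓑(1)]`. -/
def Binv : ℝ → ℝ := Function.invFunOn d.B (Icc 0 1)

/-- The space-time cylinder `Q_T`. -/
def QT : Set (ℝ × EuclideanSpace ℝ (Fin ℓ)) := Ioo 0 d.T ×ˢ d.Ω

/-- Standing assumptions on the data. -/
structure Assumptions : Prop where
  T_pos : 0 < d.T
  Ω_open : IsOpen d.Ω
  Ω_bounded : Bornology.IsBounded d.Ω
  Ω_connected : IsConnected d.Ω
  Γ_meas : MeasurableSet d.Γ
  Γ_subset : d.Γ ⊆ frontier d.Ω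
  Γ_pos : 0 < faceMeasure ℓ d.Γ
  φ_meas : AEMeasurable d.φ (volume.restrict d.Ω)
  φ_bounds : ∃ φ₀ φ₁ : ℝ, 0 < φ₀ ∧ ∀ᵐ x ∂(volume.restrict d.Ω), φ₀ ≤ d.φ x ∧ d.φ x ≤ φ₁
  M_cont : ∀ α, ContinuousOn (d.M α) (Icc 0 1)
  M_nonneg : ∀ α, ∀ s ∈ Icc (0 : ℝ) 1, 0 ≤ d.M α s
  M_zero : ∀ α, d.M α 0 = 0
  M_mono : ∀ α, MonotoneOn (d.M α) (Icc 0 1)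
  Mtot_lower : ∃ m₀ : ℝ, 0 < m₀ ∧ ∀ s ∈ Icc (0 : ℝ) 1, m₀ ≤ d.Mtot s
  fP_memLp : MemLp (Function.uncurry d.fP) 2 (volume.restrict d.QT)
  fI_memLp : MemLp (Function.uncurry d.fI) 2 (volume.restrict d.QT)
  fP_nonneg : ∀ᵐ z ∂(volume.restrict d.QT), 0 ≤ d.fP z.1 z.2
  fI_nonneg : ∀ᵐ z ∂(volume.restrict d.QT), 0 ≤ d.fI z.1 z.2
  ρ_smooth : ∀ α, ContDiff ℝ 1 (d.ρ α)
  ρ_mono : ∀ α, Monotone (d.ρ α)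
  ρ_bounds : ∃ ρm ρM : ℝ, 0 < ρm ∧ ∀ α q, ρm ≤ d.ρ α q ∧ d.ρ α q ≤ ρM
  pc_smooth : ContDiffOn ℝ 1 d.pc (Icc 0 1)
  pc_nonneg : ∀ s ∈ Icc (0 : ℝ) 1, 0 ≤ d.pc s
  pc_anti : AntitoneOn d.pc (Icc 0 1)
  pc_deriv : ∃ c : ℝ, 0 < c ∧ ∀ s ∈ Icc (0 : ℝ) 1, c ≤ |derivWithin d.pc (Icc 0 1) s|
  pc_one : d.pc 1 = 0
  γ_smooth : ContDiffOn ℝ 1 d.γ (Icc 0 1)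
  γ_pos : ∀ s ∈ Ioo (0 : ℝ) 1, 0 < d.γ s
  γ_zero : d.γ 0 = 0
  γ_one : d.γ 1 = 0
  Binv_holder : ∃ c θ : ℝ≥0, 0 < θ ∧ θ ≤ 1 ∧ HolderOnWith c θ d.Binv (Icc 0 (d.B 1))
  sI_meas : ∀ α, AEMeasurable (Function.uncurry (d.sI α)) (volume.restrict d.QT)
  sI_bounds : ∀ α, ∀ᵐ z ∂(volume.restrict d.QT), 0 ≤ d.sI α z.1 z.2 ∧ d.sI α z.1 z.2 ≤ 1
  p0_memLp : ∀ α, MemLp (d.p0 α) 2 (volume.restrict d.Ω)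
  s0_meas : ∀ α, AEMeasurable (d.s0 α) (volume.restrict d.Ω)
  s0_nonneg : ∀ α, ∀ᵐ x ∂(volume.restrict d.Ω), 0 ≤ d.s0 α x
  s0_sum : ∀ᵐ x ∂(volume.restrict d.Ω), d.s0 Phase.liquid x + d.s0 Phase.gas x = 1

end Data

/-! ### Admissible meshes -/

/-- Control volumes with their centers, together with the faces of the control volumes that lie on
the Dirichlet part of the boundary (face `b` belongs to the control volume `bowner b` and lies in
the hyperplane `⟨x, bnormal b⟩ = boffset b`, `bnormal b` being the outward unit normal). -/
structure Mesh (ℓ : ℕ) where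
  card : ℕ
  cell : Fin card → Set (EuclideanSpace ℝ (Fin ℓ))
  center : Fin card → EuclideanSpace ℝ (Fin ℓ)
  bcard : ℕ
  bowner : Fin bcard → Fin card
  bface : Fin bcard → Set (EuclideanSpace ℝ (Fin ℓ))
  bnormal : Fin bcard → EuclideanSpace ℝ (Fin ℓ)
  boffset : Fin bcard → ℝ

namespace Mesh

variable {ℓ : ℕ} (m : Mesh ℓ)

/-- The interface `σ_{K|L}`. -/
def face (K L : Fin m.card) : Set (EuclideanSpace ℝ (Fin ℓ)) :=
  closure (m.cell K) ∩ closure (m.cell L)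

open Classical in
/-- The set `N(K)` of neighbours of `K`. -/
def nbrs (K : Fin m.card) : Finset (Fin m.card) :=
  Finset.univ.filter fun L => K ≠ L ∧ 0 < faceMeasure ℓ (m.face K L)

open Classical in
/-- The Dirichlet boundary faces of `K`. -/
def bfaces (K : Fin m.card) : Finset (Fin m.bcard) :=
  Finset.univ.filter fun b => m.bowner b = K

/-- `|K|` -/
def vol (K : Fin m.card) : ℝ := (volume (m.cell K)).toReal

/-- `|σ_{K|L}|` -/
def area (K L : Fin m.card) : ℝ := (faceMeasure ℓ (m.face K L)).toReal

/-- `d_{K|L}` -/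
def dst (K L : Fin m.card) : ℝ := dist (m.center K) (m.center L)

/-- The unit normal `η_{K|L}`, outward to `K`. -/
def normal (K L : Fin m.card) : EuclideanSpace ℝ (Fin ℓ) :=
  (m.dst K L)⁻¹ • (m.center L - m.center K)

/-- Area of a Dirichlet boundary face. -/
def barea (b : Fin m.bcard) : ℝ := (faceMeasure ℓ (m.bface b)).toReal

/-- Distance from the center of the owner of a Dirichlet boundary face to the hyperplane of the
face. -/
def bdst (b : Fin m.bcard) : ℝ := m.boffset b - inner ℝ (m.center (m.bowner b)) (m.bnormal b)

/-- Mesh size: the largest diameter of a control volume. -/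
def size : ℝ := ⨆ K, Metric.diam (m.cell K)

/-- `m` is an admissible mesh of `Ω`, compatible with the part `Γ` of the boundary, with
regularity constant `ξ`. -/
structure Admissible (Ω Γ : Set (EuclideanSpace ℝ (Fin ℓ))) (ξ : ℝ) : Prop where
  cell_open : ∀ K, IsOpen (m.cell K)
  cell_nonempty : ∀ K, (m.cell K).Nonempty
  cell_convex : ∀ K, Convex ℝ (m.cell K)
  cell_polytope : ∀ K, ∃ S : Finset (EuclideanSpace ℝ (Fin ℓ)),
    closure (m.cell K) = convexHull ℝ (S : Set (EuclideanSpace ℝ (Fin ℓ)))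
  cell_subset : ∀ K, m.cell K ⊆ Ω
  closure_cells : closure (⋃ K, m.cell K) = closure Ω
  cell_disjoint : ∀ K L, K ≠ L → m.cell K ∩ m.cell L = ∅
  cell_frontier : ∀ K, frontier (m.cell K) =
    (closure (m.cell K) ∩ frontier Ω) ∪ ⋃ L ∈ m.nbrs K, m.face K L
  center_mem : ∀ K, m.center K ∈ m.cell K
  center_orth : ∀ K, ∀ L ∈ m.nbrs K, ∀ x ∈ m.face K L, ∀ y ∈ m.face K L,
    inner ℝ (m.center L - m.center K) (x - y) = 0
  regular : ∀ K, ∑ L ∈ m.nbrs K, m.area K L * m.dst K L ≤ ξ * m.vol K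
  bface_meas : ∀ b, MeasurableSet (m.bface b)
  bface_subset : ∀ b, m.bface b ⊆ closure (m.cell (m.bowner b)) ∩ Γ
  bnormal_unit : ∀ b, ‖m.bnormal b‖ = 1
  bface_plane : ∀ b, ∀ x ∈ m.bface b, inner ℝ x (m.bnormal b) = m.boffset b
  bowner_side : ∀ b, ∀ x ∈ m.cell (m.bowner b), inner ℝ x (m.bnormal b) < m.boffset b
  bface_disjoint : ∀ b b', b ≠ b' → m.bowner b = m.bowner b' →
    faceMeasure ℓ (m.bface b ∩ m.bface b') = 0
  bface_cover : ∀ K, faceMeasure ℓ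
    ((closure (m.cell K) ∩ Γ) \ ⋃ b ∈ m.bfaces K, m.bface b) = 0

end Mesh

/-- A discretization of `Ω × (0,T)`: a mesh and the integer `N` of the uniform subdivision
`0 = t⁰ < ⋯ < t^{N+1} = T`. -/
structure Discretization (ℓ : ℕ) where
  mesh : Mesh ℓ
  N : ℕ

/-! ### The finite volume scheme -/

/-- Mobility extended by constants outside `[0,1]`. -/
def extMobility (M : ℝ → ℝ) (s : ℝ) : ℝ := M (max 0 (min s 1))

/-- The upwind numerical flux function `G(a,b;c) = -M(b) c⁺ + M(a) c⁻`. -/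
def upwindFlux (M : ℝ → ℝ) (a b c : ℝ) : ℝ :=
  -(extMobility M b * max c 0) + extMobility M a * max (-c) 0

/-- Density on an interface: `1 / ρ_{K|L}` is the mean value of `1 / ρ` between the two
pressures. -/
def interfaceDensity (ρ : ℝ → ℝ) (a b : ℝ) : ℝ :=
  if a = b then ρ a else (1 / (b - a) * ∫ ζ in a..b, 1 / ρ ζ)⁻¹

/-- Numerical mass flux through an interface of area `A`, the distance being `δ` and the normal
component of gravity `gn`, from a state (pressure, saturation) `(pK, sK)` to a state `(pL, sL)`:
pressure-driven upwind flux plus upwind gravity flux. -/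
def massFlux (ρ M : ℝ → ℝ) (A δ gn pK sK pL sL : ℝ) : ℝ :=
  A / δ * interfaceDensity ρ pK pL * upwindFlux M sK sL (pL - pK) +
    A * interfaceDensity ρ pK pL ^ 2 *
      (extMobility M sK * max gn 0 - extMobility M sL * max (-gn) 0)

/-- Saturations on the Dirichlet boundary: `p_l = p_g = 0` there, hence `p_c(s_l) = 0`, that is
`s_l = 1`. -/
def boundarySat : Phase → ℝ
  | Phase.liquid => 1
  | Phase.gas => 0

namespace Discretization

variable {ℓ : ℕ} (D : Discretization ℓ) (d : Data ℓ)

/-- The time step `δt`. -/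
def dt : ℝ := d.T / ((D.N : ℝ) + 1)

/-- `size(𝓓) = max(size(𝓣), δt)`. -/
def size : ℝ := max D.mesh.size (D.dt d)

/-- Mean value of `f` over the control volume `K`. -/
def cellMean (f : EuclideanSpace ℝ (Fin ℓ) → ℝ) (K : Fin D.mesh.card) : ℝ :=
  ⨍ x in D.mesh.cell K, f x

/-- Mean value of `f` over `(tⁿ, tⁿ⁺¹) × K`. -/
def cylMean (f : ℝ → EuclideanSpace ℝ (Fin ℓ) → ℝ) (n : ℕ) (K : Fin D.mesh.card) : ℝ :=
  ⨍ z in Ioo ((n : ℝ) * D.dt d) (((n : ℝ) + 1) * D.dt d) ×ˢ D.mesh.cell K, f z.1 z.2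

/-- Total outgoing numerical mass flux of phase `α` from `K` for pressures `p` and saturations
`s`: interior interfaces, and Dirichlet boundary faces with the boundary state. -/
def outFlux (α : Phase) (p s : Fin D.mesh.card → ℝ) (K : Fin D.mesh.card) : ℝ :=
  ∑ L ∈ D.mesh.nbrs K, massFlux (d.ρ α) (d.M α) (D.mesh.area K L) (D.mesh.dst K L)
      (inner ℝ d.g (D.mesh.normal K L)) (p K) (s K) (p L) (s L) +
    ∑ b ∈ D.mesh.bfaces K, massFlux (d.ρ α) (d.M α) (D.mesh.barea b) (D.mesh.bdst b)
      (inner ℝ d.g (D.mesh.bnormal b)) (p K) (s K) 0 (boundarySat α)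

/-- `(p, s)`, with values `p α n K`, `s α n K` for `n = 0, …, N+1`, is a solution of the finite
volume scheme. -/
structure IsSolution (p s : Phase → ℕ → Fin D.mesh.card → ℝ) : Prop where
  init_p : ∀ α K, p α 0 K = D.cellMean (d.p0 α) K
  init_s : ∀ α K, s α 0 K = D.cellMean (d.s0 α) K
  balance : ∀ α, ∀ n ≤ D.N, ∀ K,
    D.mesh.vol K * D.cellMean d.φ K *
        ((d.ρ α (p α (n + 1) K) * s α (n + 1) K - d.ρ α (p α n K) * s α n K) / D.dt d) +
      D.outFlux d α (p α (n + 1)) (s α (n + 1)) K +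
      D.mesh.vol K * d.ρ α (p α (n + 1) K) * s α (n + 1) K * D.cylMean d d.fP n K =
    D.mesh.vol K * d.ρ α (p α (n + 1) K) * D.cylMean d (d.sI α) n K * D.cylMean d d.fI n K
  saturation : ∀ n ≤ D.N, ∀ K, s Phase.liquid (n + 1) K + s Phase.gas (n + 1) K = 1
  capillary : ∀ n ≤ D.N, ∀ K,
    d.pc (s Phase.liquid (n + 1) K) = p Phase.gas (n + 1) K - p Phase.liquid (n + 1) K

/-- `U_{α,K}^n = φ_K ρ_α(p_{α,K}^n) s_{α,K}^n`. -/
def U (p s : Phase → ℕ → Fin D.mesh.card → ℝ) (α : Phase) (n : ℕ) (K : Fin D.mesh.card) : ℝ :=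
  D.cellMean d.φ K * d.ρ α (p α n K) * s α n K

open Classical in
/-- The function `Ū_α`: constant in space on each control volume, affine in time on each interval
`(tⁿ, tⁿ⁺¹)`, interpolating between `U_{α,K}^n` and `U_{α,K}^{n+1}`. -/
def Ubar (p s : Phase → ℕ → Fin D.mesh.card → ℝ) (α : Phase) (t : ℝ)
    (x : EuclideanSpace ℝ (Fin ℓ)) : ℝ :=
  ∑ n ∈ Finset.range (D.N + 1), ∑ K,
    if t ∈ Ioo ((n : ℝ) * D.dt d) (((n : ℝ) + 1) * D.dt d) ∧ x ∈ D.mesh.cell K then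
      1 / D.dt d * ((t - (n : ℝ) * D.dt d) * D.U d p s α (n + 1) K +
        (((n : ℝ) + 1) * D.dt d - t) * D.U d p s α n K)
    else 0

/-- `∫_{Ω' × (0,T)} |Ū_α(t,x+y) - Ū_α(t,x)| dx dt`, where `Ω' = {x ∈ Ω : [x,x+y] ⊂ Ω}`. -/
def translateL1 (p s : Phase → ℕ → Fin D.mesh.card → ℝ) (α : Phase)
    (y : EuclideanSpace ℝ (Fin ℓ)) : ℝ≥0∞ :=
  ∫⁻ z in Ioo 0 d.T ×ˢ {x | x ∈ d.Ω ∧ segment ℝ x (x + y) ⊆ d.Ω},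
    ‖D.Ubar d p s α z.1 (z.2 + y) - D.Ubar d p s α z.1 z.2‖ₑ

end Discretization

end TwoPhaseFV

end

namespace TwoPhaseFV

/-! ### Area and volume -/

section Geometry

variable {ℓ : ℕ}

/-! The mass density of a phase is the porosity times `ρ_α(p_α) s_α`. The porosity enters through
cell averages of one fixed integrable function, and these are equicontinuous in L¹ up to the mesh
size (`exists_transNorm_average_le`). The second factor is a uniformly continuous function of two
quantities with a discrete gradient bound: the global pressure and `𝓑(s_l)`. Indeed `s_l` is
recovered from `𝓑(s_l)` because `𝓑⁻¹` is Hölder, the phase pressures from the global pressure and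
`s_l`, and a bounded monotone continuous `ρ_α` is uniformly continuous. As `ρ_α s_α` is also
bounded, its jumps are at most `ε + C_ε` times the jumps of these two quantities
(`exists_density_sub_le`).

The gradient bound comes from an energy estimate. Saturations stay in `[0,1]` (`saturation_nonneg`),
since a negative one would have zero mobility and only inflow. Each balance is tested with `g_α(p) =
∫₀ᵖ 1/ρ_α`. The interface density is defined so that it times the jump of `g_α` equals the jump of
`p_α`; the upwind flux then dissipates mobility times squared pressure jump, with no density left.
The accumulation terms dominate the increments of a free energy (`stateEntropy_sub_le`), because
`g_α` and `∫ p_c` are concave. Gravity is absorbed through `sq_mobility_jump_le`: when the mobility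
of a phase is larger on the downstream side, the capillary law makes the other pressure jump at
least as large, and the total mobility is bounded below. Sources are absorbed by a discrete Poincaré
inequality for the global pressure, which vanishes on `Γ`. Cauchy's mean value theorem bounds the
squared jumps of the global pressure and of `𝓑(s_l)` by the same dissipation.

The Poincaré inequality (`discrete_poincare`) must be uniform in the mesh on a merely connected
domain. The L¹ norm near a piece of `Γ` is bounded by the total variation by integrating along
segments that end on `Γ`. The bound spreads to any larger convex open subset of `Ω` by averaging the
translation estimate, then to all of `Ω` by connectedness; applied to squares, with Young's
inequality, it gives the L² statement.

Finally, the L¹ norm of `v(· + y) - v` is at most `‖y‖` times the total variation of `v`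
(`lintegral_translate_le`): an interface is crossed only from a set of volume at most `‖y‖` times
its area. The initial time level has no gradient bound, but it carries the weight `δt`, so it is
small with the size of the discretization. This yields an ε–δ statement (`exists_translateL1_le`),
which `exists_modulus` turns into moduli. Along a sequence with sizes tending to zero, only finitely
many discretizations are not fine, and each of these has finite total variation of its own, so the
size term disappears. -/

lemma volume_eq_lintegral_slice {η : EuclideanSpace ℝ (Fin ℓ)} (hη : ‖η‖ = 1)
    {t : Set (EuclideanSpace ℝ (Fin ℓ))} (ht : MeasurableSet t) :
    volume t = ∫⁻ c : ℝ, faceMeasure ℓ (t ∩ {x | inner ℝ x η = c}) := by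
  have hη0 : η ≠ 0 := by rintro rfl; simp at hη
  have h := EuclideanGeometry.euclideanHausdorffMeasure_eq_lintegral
    (0 : EuclideanSpace ℝ (Fin ℓ)) hη0 ht
  rw [finrank_euclideanSpace_fin, EuclideanSpace.euclideanHausdorffMeasure_eq_volume] at h
  have h1 : ‖η‖ₑ = 1 := by rw [← ofReal_norm, hη]; simp
  rw [h, h1, one_mul]
  refine lintegral_congr fun c => ?_
  unfold faceMeasure
  congr 2
  ext x
  simp only [SetLike.mem_coe, AffineSubspace.mem_mk', mem_ofPred_eq, vadd_eq_add, add_zero,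
    vsub_eq_sub, Submodule.mem_orthogonal_singleton_iff_inner_left, inner_sub_left,
    inner_smul_left, real_inner_self_eq_norm_sq, hη]
  simp [sub_eq_zero]

lemma faceMeasure_translate (A : Set (EuclideanSpace ℝ (Fin ℓ))) (v : EuclideanSpace ℝ (Fin ℓ)) :
    faceMeasure ℓ ((fun x => x + v) '' A) = faceMeasure ℓ A := by
  unfold faceMeasure
  exact (IsometryEquiv.addRight v).isometry.euclideanHausdorffMeasure_image A

/-- The points from which the segment of direction `y` meets `A`. -/
def sweep (A : Set (EuclideanSpace ℝ (Fin ℓ))) (y : EuclideanSpace ℝ (Fin ℓ)) :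
    Set (EuclideanSpace ℝ (Fin ℓ)) :=
  {x | ∃ t ∈ Icc (0 : ℝ) 1, x + t • y ∈ A}

/-- In a transverse direction the hyperplane is met at exactly one parameter, which is an explicit
function of `x`. Removing the quantifier makes the sweep of a merely measurable set measurable and
its slices computable. -/
lemma sweep_eq_of_transverse {η y : EuclideanSpace ℝ (Fin ℓ)} {c : ℝ}
    {A : Set (EuclideanSpace ℝ (Fin ℓ))} (hA : ∀ x ∈ A, inner ℝ x η = c)
    (hy : inner ℝ y η ≠ 0) :
    sweep A y = {x | (c - inner ℝ x η) / inner ℝ y η ∈ Icc (0 : ℝ) 1 ∧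
      x + ((c - inner ℝ x η) / inner ℝ y η) • y ∈ A} := by
  ext x
  constructor
  · rintro ⟨t, ht, hx⟩
    have h := hA _ hx
    rw [inner_add_left, inner_smul_left] at h
    simp only [conj_trivial] at h
    have : (c - inner ℝ x η) / inner ℝ y η = t := by field_simp; linarith
    simp only [mem_ofPred_eq, this]
    exact ⟨ht, hx⟩
  · rintro ⟨h1, h2⟩
    exact ⟨_, h1, h2⟩

lemma measurableSet_sweep {η y : EuclideanSpace ℝ (Fin ℓ)} {c : ℝ}
    {A : Set (EuclideanSpace ℝ (Fin ℓ))} (hA : ∀ x ∈ A, inner ℝ x η = c)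
    (hAm : MeasurableSet A) (hy : inner ℝ y η ≠ 0) : MeasurableSet (sweep A y) := by
  rw [sweep_eq_of_transverse hA hy]
  have h1 : Measurable fun x : EuclideanSpace ℝ (Fin ℓ) =>
      (c - inner ℝ x η) / inner ℝ y η := by fun_prop
  exact (h1 measurableSet_Icc).inter
    ((measurable_id.add (h1.smul_const y)) hAm)

/-- Volume of the region swept by a flat set under a transverse translation. -/
lemma volume_sweep_eq {η y : EuclideanSpace ℝ (Fin ℓ)} (hη : ‖η‖ = 1) {c : ℝ}
    {A : Set (EuclideanSpace ℝ (Fin ℓ))} (hA : ∀ x ∈ A, inner ℝ x η = c)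
    (hAm : MeasurableSet A) (hy : inner ℝ y η ≠ 0) :
    volume (sweep A y) = ENNReal.ofReal |inner ℝ y η| * faceMeasure ℓ A := by
  rw [volume_eq_lintegral_slice hη (measurableSet_sweep hA hAm hy)]
  -- Each slice of the sweep by a parallel hyperplane is a translate of `A` or empty; the levels
  -- with a nonempty choice of parameter form an interval of length `|⟨y, η⟩|`.
  have hs : ∀ r : ℝ, faceMeasure ℓ (sweep A y ∩ {x | inner ℝ x η = r}) =
      indicator {r : ℝ | (c - r) / inner ℝ y η ∈ Icc (0 : ℝ) 1}
        (fun _ => faceMeasure ℓ A) r := by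
    intro r
    by_cases hr : (c - r) / inner ℝ y η ∈ Icc (0 : ℝ) 1
    · rw [indicator_of_mem (by exact hr),
        ← faceMeasure_translate A (-(((c - r) / inner ℝ y η) • y))]
      congr 1
      ext x
      rw [sweep_eq_of_transverse hA hy]
      constructor
      · rintro ⟨⟨-, h2⟩, h3⟩
        rw [mem_ofPred_eq] at h3
        rw [h3] at h2
        exact ⟨_, h2, by simp⟩
      · rintro ⟨w, hw, rfl⟩
        have hi : inner ℝ (w + -(((c - r) / inner ℝ y η) • y)) η = r := by
          rw [inner_add_left, inner_neg_left, inner_smul_left, hA w hw]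
          simp only [conj_trivial]
          field_simp
          ring
        refine ⟨?_, hi⟩
        simp only [mem_ofPred_eq, hi]
        exact ⟨hr, by simpa using hw⟩
    · rw [indicator_of_notMem (by exact hr)]
      have : sweep A y ∩ {x | inner ℝ x η = r} = ∅ := by
        rw [sweep_eq_of_transverse hA hy]
        ext x
        simp only [mem_inter_iff, mem_ofPred_eq, mem_empty_iff_false, iff_false]
        rintro ⟨⟨h1, -⟩, h3⟩
        rw [h3] at h1
        exact hr h1
      rw [this, measure_empty]
  simp_rw [hs]
  have hset : {r : ℝ | (c - r) / inner ℝ y η ∈ Icc (0 : ℝ) 1} =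
      uIcc (c - inner ℝ y η) c := by
    ext r
    rcases lt_or_gt_of_ne hy with h | h
    · rw [uIcc_of_ge (by linarith)]
      simp only [mem_ofPred_eq, mem_Icc]
      rw [le_div_iff_of_neg h, div_le_iff_of_neg h]
      constructor <;> rintro ⟨h1, h2⟩ <;> constructor <;> linarith
    · rw [uIcc_of_le (by linarith)]
      simp only [mem_ofPred_eq, mem_Icc]
      rw [le_div_iff₀ h, div_le_iff₀ h]
      constructor <;> rintro ⟨h1, h2⟩ <;> constructor <;> linarith
  rw [hset, lintegral_indicator_const measurableSet_uIcc, Real.volume_interval, mul_comm]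
  congr 2
  simp

lemma volume_hyperplane {η : EuclideanSpace ℝ (Fin ℓ)} (hη : ‖η‖ = 1) (c : ℝ) :
    volume {x : EuclideanSpace ℝ (Fin ℓ) | inner ℝ x η = c} = 0 := by
  rw [volume_eq_lintegral_slice hη
    (measurableSet_eq_fun (by fun_prop) (by fun_prop))]
  have : ∀ r : ℝ, r ≠ c → faceMeasure ℓ
      ({x : EuclideanSpace ℝ (Fin ℓ) | inner ℝ x η = c} ∩ {x | inner ℝ x η = r}) = 0 := by
    intro r hr
    convert measure_empty (μ := faceMeasure ℓ)
    ext x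
    simp only [mem_inter_iff, mem_ofPred_eq, mem_empty_iff_false, iff_false]
    rintro ⟨h1, h2⟩
    exact hr (h2.symm.trans h1)
  rw [lintegral_eq_zero_iff' ?_]
  · have h : ∀ᵐ r : ℝ, r ≠ c := by simp [ae_iff, measure_singleton]
    filter_upwards [h] with r hr using this r hr
  · refine ⟨fun _ => 0, measurable_const, ?_⟩
    have h : ∀ᵐ r : ℝ, r ≠ c := by simp [ae_iff, measure_singleton]
    filter_upwards [h] with r hr using this r hr

lemma abs_inner_le_norm_of_unit {η : EuclideanSpace ℝ (Fin ℓ)} (hη : ‖η‖ = 1)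
    (y : EuclideanSpace ℝ (Fin ℓ)) : |inner ℝ y η| ≤ ‖y‖ := by
  simpa [hη] using abs_real_inner_le_norm y η

/-- A direction parallel to the hyperplane keeps the sweep inside that hyperplane, which is null; a
transverse one sweeps the volume `|⟨y, η⟩|` times the area. -/
lemma volume_sweep_le {η : EuclideanSpace ℝ (Fin ℓ)} (hη : ‖η‖ = 1) {c : ℝ}
    {A : Set (EuclideanSpace ℝ (Fin ℓ))} (hA : ∀ x ∈ A, inner ℝ x η = c)
    (hAm : MeasurableSet A) (y : EuclideanSpace ℝ (Fin ℓ)) :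
    volume (sweep A y) ≤ ENNReal.ofReal ‖y‖ * faceMeasure ℓ A := by
  by_cases hy : inner ℝ y η = 0
  · have : sweep A y ⊆ {x | inner ℝ x η = c} := by
      rintro x ⟨t, -, hx⟩
      have := hA _ hx
      rw [inner_add_left, inner_smul_left, hy] at this
      simpa using this
    rw [measure_mono_null this (volume_hyperplane hη c)]
    exact zero_le
  · rw [volume_sweep_eq hη hA hAm hy]
    gcongr
    exact abs_inner_le_norm_of_unit hη y

/-- Sweeping the closure along the unit normal produces a bounded set whose volume is exactly its
area. -/
lemma faceMeasure_lt_top {η : EuclideanSpace ℝ (Fin ℓ)} (hη : ‖η‖ = 1) {c : ℝ}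
    {A : Set (EuclideanSpace ℝ (Fin ℓ))} (hA : ∀ x ∈ A, inner ℝ x η = c)
    (hAb : Bornology.IsBounded A) : faceMeasure ℓ A < ∞ := by
  set A' := closure A with hA'
  have hcl : IsClosed {x : EuclideanSpace ℝ (Fin ℓ) | inner ℝ x η = c} :=
    isClosed_eq (by fun_prop) (by fun_prop)
  have hA'2 : ∀ x ∈ A', inner ℝ x η = c := fun x hx => closure_minimal hA hcl hx
  refine (measure_mono (subset_closure (s := A))).trans_lt ?_
  have hηη : inner ℝ η η = (1 : ℝ) := by rw [real_inner_self_eq_norm_sq, hη]; norm_num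
  have h := volume_sweep_eq hη hA'2 isClosed_closure.measurableSet
    (y := η) (by rw [hηη]; norm_num)
  rw [hηη] at h
  simp only [abs_one, ENNReal.ofReal_one, one_mul] at h
  rw [← hA', ← h]
  obtain ⟨R, hR⟩ := hAb.closure.subset_closedBall 0
  refine (measure_mono (t := Metric.closedBall 0 (R + 1)) ?_).trans_lt
    measure_closedBall_lt_top
  rintro x ⟨t, ht, hx⟩
  have h1 := hR hx
  rw [mem_closedBall_zero_iff] at h1 ⊢
  calc ‖x‖ = ‖(x + t • η) - t • η‖ := by simp
    _ ≤ ‖x + t • η‖ + ‖t • η‖ := norm_sub_le _ _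
    _ ≤ R + 1 := by
      rw [norm_smul, hη, Real.norm_eq_abs, abs_of_nonneg ht.1]
      linarith [ht.2]

/-! ### Cones over flat sets -/

/-- The outer half of the cone with vertex `x₀` over `A`. -/
def halfCone (x₀ : EuclideanSpace ℝ (Fin ℓ)) (A : Set (EuclideanSpace ℝ (Fin ℓ))) :
    Set (EuclideanSpace ℝ (Fin ℓ)) :=
  {z | ∃ t ∈ Ioo (1 / 2 : ℝ) 1, ∃ w ∈ A, z = x₀ + t • (w - x₀)}

lemma halfCone_eq {x₀ η : EuclideanSpace ℝ (Fin ℓ)} {δ : ℝ} (hδ : 0 < δ)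
    {A : Set (EuclideanSpace ℝ (Fin ℓ))} (hA : ∀ x ∈ A, inner ℝ (x - x₀) η = δ) :
    halfCone x₀ A = {z | inner ℝ (z - x₀) η / δ ∈ Ioo (1 / 2 : ℝ) 1 ∧
      x₀ + (inner ℝ (z - x₀) η / δ)⁻¹ • (z - x₀) ∈ A} := by
  ext z
  constructor
  · rintro ⟨t, ht, w, hw, rfl⟩
    have h1 : inner ℝ (x₀ + t • (w - x₀) - x₀) η / δ = t := by
      rw [add_sub_cancel_left, inner_smul_left, hA w hw]
      simp only [conj_trivial]
      field_simp
    have ht0 : t ≠ 0 := by have := ht.1; intro h; norm_num [h] at this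
    simp only [mem_ofPred_eq, h1]
    refine ⟨ht, ?_⟩
    rw [add_sub_cancel_left, smul_smul, inv_mul_cancel₀ ht0]
    simpa using hw
  · rintro ⟨h1, h2⟩
    have ht0 : inner ℝ (z - x₀) η / δ ≠ 0 := by
      have := h1.1; intro h; norm_num [h] at this
    refine ⟨_, h1, _, h2, ?_⟩
    rw [add_sub_cancel_left, smul_smul, mul_inv_cancel₀ ht0]
    simp

lemma measurableSet_halfCone {x₀ η : EuclideanSpace ℝ (Fin ℓ)} {δ : ℝ} (hδ : 0 < δ)
    {A : Set (EuclideanSpace ℝ (Fin ℓ))} (hA : ∀ x ∈ A, inner ℝ (x - x₀) η = δ)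
    (hAm : MeasurableSet A) : MeasurableSet (halfCone x₀ A) := by
  rw [halfCone_eq hδ hA]
  have h1 : Measurable fun z : EuclideanSpace ℝ (Fin ℓ) => inner ℝ (z - x₀) η / δ := by
    fun_prop
  exact (h1 measurableSet_Ioo).inter
    ((measurable_const.add (h1.inv.smul (measurable_id.sub_const x₀))) hAm)

/-- The slice is the image of `A` under a homothety centred at the vertex, which scales area by the
power `ℓ - 1` of the ratio. -/
lemma faceMeasure_halfCone_slice {x₀ η : EuclideanSpace ℝ (Fin ℓ)} {δ : ℝ} (hδ : 0 < δ)
    {A : Set (EuclideanSpace ℝ (Fin ℓ))} (hA : ∀ x ∈ A, inner ℝ (x - x₀) η = δ) (r : ℝ) :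
    faceMeasure ℓ (halfCone x₀ A ∩ {x | inner ℝ x η = r}) =
      indicator {r : ℝ | (r - inner ℝ x₀ η) / δ ∈ Ioo (1 / 2 : ℝ) 1}
        (fun r => ‖(r - inner ℝ x₀ η) / δ‖₊ ^ (ℓ - 1) • faceMeasure ℓ A) r := by
  by_cases hr : (r - inner ℝ x₀ η) / δ ∈ Ioo (1 / 2 : ℝ) 1
  · rw [indicator_of_mem (by exact hr)]
    have ht0 : (r - inner ℝ x₀ η) / δ ≠ 0 := by
      have := hr.1; intro h; norm_num [h] at this
    unfold faceMeasure
    rw [← euclideanHausdorffMeasure_homothety_image (ℓ - 1) x₀ ht0]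
    congr 1
    rw [halfCone_eq hδ hA]
    ext z
    constructor
    · rintro ⟨⟨-, h2⟩, h3⟩
      rw [mem_ofPred_eq] at h3
      rw [inner_sub_left, h3] at h2
      refine ⟨_, h2, ?_⟩
      simp only [AffineMap.homothety_apply, vsub_eq_sub, add_sub_cancel_left, vadd_eq_add,
        smul_smul, mul_inv_cancel₀ ht0]
      simp
    · rintro ⟨w, hw, rfl⟩
      have h4 : inner ℝ (AffineMap.homothety x₀ ((r - inner ℝ x₀ η) / δ) w - x₀) η =
          r - inner ℝ x₀ η := by
        simp only [AffineMap.homothety_apply, vsub_eq_sub, vadd_eq_add, add_sub_cancel_right,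
          inner_smul_left, conj_trivial, hA w hw]
        field_simp
      refine ⟨?_, ?_⟩
      · simp only [mem_ofPred_eq, h4]
        refine ⟨hr, ?_⟩
        simp only [AffineMap.homothety_apply, vsub_eq_sub, vadd_eq_add, add_sub_cancel_right,
          smul_smul, inv_mul_cancel₀ ht0]
        simpa using hw
      · rw [inner_sub_left] at h4
        simp only [mem_ofPred_eq]
        linarith
  · rw [indicator_of_notMem (by exact hr)]
    have : halfCone x₀ A ∩ {x | inner ℝ x η = r} = ∅ := by
      rw [halfCone_eq hδ hA]
      ext x
      simp only [mem_inter_iff, mem_ofPred_eq, mem_empty_iff_false, iff_false]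
      rintro ⟨⟨h1, -⟩, h3⟩
      rw [inner_sub_left, h3] at h1
      exact hr h1
    rw [this, measure_empty]

/-- In the outer half of the cone every slice is a copy of `A` scaled by at least `1/2`, over a
range of heights of length `δ/2`. The crude factor `2 ^ ℓ` replaces the integration of `t ^ (ℓ -
1)`. -/
lemma volume_halfCone_ge {x₀ η : EuclideanSpace ℝ (Fin ℓ)} (hη : ‖η‖ = 1) {δ : ℝ}
    (hδ : 0 < δ) {A : Set (EuclideanSpace ℝ (Fin ℓ))}
    (hA : ∀ x ∈ A, inner ℝ (x - x₀) η = δ) (hAm : MeasurableSet A) :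
    ENNReal.ofReal δ * faceMeasure ℓ A ≤ 2 ^ ℓ * volume (halfCone x₀ A) := by
  rw [volume_eq_lintegral_slice hη (measurableSet_halfCone hδ hA hAm)]
  simp_rw [faceMeasure_halfCone_slice hδ hA]
  set q := inner ℝ x₀ η
  have hle : ∫⁻ r : ℝ, indicator (Ioo (q + δ / 2) (q + δ))
      (fun _ => (2⁻¹ : ℝ≥0∞) ^ (ℓ - 1) * faceMeasure ℓ A) r ≤
      ∫⁻ r : ℝ, indicator {r : ℝ | (r - q) / δ ∈ Ioo (1 / 2 : ℝ) 1}
        (fun r => ‖(r - q) / δ‖₊ ^ (ℓ - 1) • faceMeasure ℓ A) r := by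
    refine lintegral_mono fun r => ?_
    refine (indicator_le_indicator_of_subset
      (t := {r : ℝ | (r - q) / δ ∈ Ioo (1 / 2 : ℝ) 1}) ?_ (fun _ => zero_le) r).trans ?_
    · rintro r ⟨h1, h2⟩
      refine ⟨?_, ?_⟩
      · rw [lt_div_iff₀ hδ]; linarith
      · rw [div_lt_one hδ]; linarith
    · refine indicator_le_indicator' ?_
      intro hr
      rw [ENNReal.smul_def, smul_eq_mul, ENNReal.coe_pow]
      gcongr
      have h3 : (2⁻¹ : ℝ≥0) ≤ ‖(r - q) / δ‖₊ := by
        rw [← NNReal.coe_le_coe, coe_nnnorm, Real.norm_eq_abs]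
        have := hr.1
        refine le_trans ?_ (le_abs_self _)
        push_cast
        linarith
      have : (2⁻¹ : ℝ≥0∞) = ((2⁻¹ : ℝ≥0) : ℝ≥0∞) := by
        rw [ENNReal.coe_inv (by norm_num)]; norm_num
      rw [this]
      exact_mod_cast h3
  refine le_trans ?_ (mul_le_mul_right hle _)
  rw [lintegral_indicator_const measurableSet_Ioo, Real.volume_Ioo]
  -- A unit vector exists only for `ℓ ≥ 1`; this makes the truncated `ℓ - 1` a true predecessor.
  obtain ⟨k, rfl⟩ : ∃ k, ℓ = k + 1 := by
    refine Nat.exists_eq_succ_of_ne_zero ?_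
    rintro rfl
    simp [Subsingleton.elim η 0] at hη
  have e1 : q + δ - (q + δ / 2) = 2⁻¹ * δ := by ring
  rw [e1, ENNReal.ofReal_mul (by norm_num), ENNReal.ofReal_inv_of_pos (by norm_num)]
  simp only [Nat.add_sub_cancel, ENNReal.ofReal_ofNat]
  have e2 : (2 : ℝ≥0∞) ^ (k + 1) * ((2⁻¹) ^ k * faceMeasure (k + 1) A * (2⁻¹ * ENNReal.ofReal δ))
      = ((2 : ℝ≥0∞) * 2⁻¹) ^ (k + 1) * (ENNReal.ofReal δ * faceMeasure (k + 1) A) := by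
    rw [mul_pow]; ring
  rw [e2, ENNReal.mul_inv_cancel (by norm_num) (by norm_num)]
  simp

/-- Makes half cones over faces with null overlap almost everywhere disjoint. -/
lemma volume_halfCone_null {x₀ η : EuclideanSpace ℝ (Fin ℓ)} (hη : ‖η‖ = 1) {δ : ℝ}
    (hδ : 0 < δ) {A : Set (EuclideanSpace ℝ (Fin ℓ))}
    (hA : ∀ x ∈ A, inner ℝ (x - x₀) η = δ) (hAm : MeasurableSet A)
    (h0 : faceMeasure ℓ A = 0) : volume (halfCone x₀ A) = 0 := by
  rw [volume_eq_lintegral_slice hη (measurableSet_halfCone hδ hA hAm)]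
  simp_rw [faceMeasure_halfCone_slice hδ hA, h0]
  simp

end Geometry

end TwoPhaseFV

namespace TwoPhaseFV

/-! ### Piecewise constant functions and their space translates -/

namespace Mesh

variable {ℓ : ℕ}

/-- The function equal to `v K` on the control volume `K`. -/
noncomputable def pw (m : Mesh ℓ) (v : Fin m.card → ℝ) (x : EuclideanSpace ℝ (Fin ℓ)) : ℝ :=
  ∑ K, indicator (m.cell K) (fun _ => v K) x

/-- Total variation across the interfaces (each one counted twice). -/
noncomputable def tvInt (m : Mesh ℓ) (v : Fin m.card → ℝ) : ℝ :=
  ∑ K, ∑ L ∈ m.nbrs K, m.area K L * |v K - v L|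

lemma face_comm (m : Mesh ℓ) (K L : Fin m.card) : m.face K L = m.face L K := inter_comm _ _

lemma area_comm (m : Mesh ℓ) (K L : Fin m.card) : m.area K L = m.area L K := by
  unfold area; rw [face_comm]

lemma dst_comm (m : Mesh ℓ) (K L : Fin m.card) : m.dst K L = m.dst L K := dist_comm _ _

lemma area_nonneg (m : Mesh ℓ) (K L : Fin m.card) : 0 ≤ m.area K L := ENNReal.toReal_nonneg

lemma barea_nonneg (m : Mesh ℓ) (b : Fin m.bcard) : 0 ≤ m.barea b := ENNReal.toReal_nonneg

lemma vol_nonneg (m : Mesh ℓ) (K : Fin m.card) : 0 ≤ m.vol K := ENNReal.toReal_nonneg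

lemma mem_nbrs (m : Mesh ℓ) (K L : Fin m.card) :
    L ∈ m.nbrs K ↔ K ≠ L ∧ 0 < faceMeasure ℓ (m.face K L) := by
  simp [nbrs]

lemma mem_nbrs_comm (m : Mesh ℓ) (K L : Fin m.card) : L ∈ m.nbrs K ↔ K ∈ m.nbrs L := by
  rw [mem_nbrs, mem_nbrs, face_comm, ne_comm]

lemma mem_bfaces (m : Mesh ℓ) (K : Fin m.card) (b : Fin m.bcard) :
    b ∈ m.bfaces K ↔ m.bowner b = K := by
  simp [bfaces]

lemma normal_comm (m : Mesh ℓ) (K L : Fin m.card) : m.normal L K = -m.normal K L := by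
  unfold normal
  rw [dst_comm, ← smul_neg, neg_sub]

lemma tvInt_nonneg (m : Mesh ℓ) (v : Fin m.card → ℝ) : 0 ≤ m.tvInt v :=
  Finset.sum_nonneg fun K _ => Finset.sum_nonneg fun L _ =>
    mul_nonneg (m.area_nonneg K L) (abs_nonneg _)

/-- Symmetric double sums over the interfaces. -/
lemma sum_nbrs_comm (m : Mesh ℓ) (f : Fin m.card → Fin m.card → ℝ) :
    ∑ K, ∑ L ∈ m.nbrs K, f K L = ∑ K, ∑ L ∈ m.nbrs K, f L K := by
  rw [Finset.sum_comm' (t' := Finset.univ) (s' := fun L => m.nbrs L)]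
  intro K L
  simp [m.mem_nbrs_comm K L]

namespace Admissible

variable {m : Mesh ℓ} {Ω Γ : Set (EuclideanSpace ℝ (Fin ℓ))} {ξ : ℝ}

lemma pw_of_mem (h : m.Admissible Ω Γ ξ) (v : Fin m.card → ℝ) {K : Fin m.card}
    {x : EuclideanSpace ℝ (Fin ℓ)} (hx : x ∈ m.cell K) : m.pw v x = v K := by
  unfold pw
  rw [Finset.sum_eq_single K, indicator_of_mem hx]
  · intro L _ hL
    refine indicator_of_notMem (fun hxL => ?_) _
    have : x ∈ m.cell L ∩ m.cell K := ⟨hxL, hx⟩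
    rw [h.cell_disjoint L K hL] at this
    exact this
  · simp

lemma measurable_pw (h : m.Admissible Ω Γ ξ) (v : Fin m.card → ℝ) : Measurable (m.pw v) := by
  unfold pw
  exact Finset.measurable_fun_sum _ fun K _ =>
    measurable_const.indicator (h.cell_open K).measurableSet

lemma dst_pos (h : m.Admissible Ω Γ ξ) {K L : Fin m.card} (hKL : K ≠ L) : 0 < m.dst K L := by
  unfold dst
  rw [dist_pos]
  intro he
  have : m.center K ∈ m.cell K ∩ m.cell L := ⟨h.center_mem K, he ▸ h.center_mem L⟩
  rw [h.cell_disjoint K L hKL] at this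
  exact this

lemma bdst_pos (h : m.Admissible Ω Γ ξ) (b : Fin m.bcard) : 0 < m.bdst b :=
  sub_pos.2 (h.bowner_side b _ (h.center_mem _))

lemma norm_normal (h : m.Admissible Ω Γ ξ) {K L : Fin m.card} (hKL : K ≠ L) :
    ‖m.normal K L‖ = 1 := by
  have := h.dst_pos hKL
  unfold normal
  rw [norm_smul, norm_inv, Real.norm_eq_abs, abs_of_pos this]
  unfold dst at *
  rw [← dist_eq_norm, dist_comm, inv_mul_cancel₀]
  rw [dist_comm]
  exact this.ne'

/-- Disjoint open convex cells are separated by a hyperplane; their closures lie on opposite closed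
sides of it, so common points lie on it. This covers all pairs of cells, including those that touch
along a null set and are not neighbours. -/
lemma exists_hyperplane (h : m.Admissible Ω Γ ξ) {K L : Fin m.card} (hKL : K ≠ L) :
    ∃ (η : EuclideanSpace ℝ (Fin ℓ)) (c : ℝ), ‖η‖ = 1 ∧ ∀ x ∈ m.face K L, inner ℝ x η = c := by
  obtain ⟨f, u, hf, hu⟩ := geometric_hahn_banach_open_open (h.cell_convex K) (h.cell_open K)
    (h.cell_convex L) (h.cell_open L) (disjoint_iff_inter_eq_empty.2 (h.cell_disjoint K L hKL))
  set w := (InnerProductSpace.toDual ℝ (EuclideanSpace ℝ (Fin ℓ))).symm f with hw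
  have hfw : ∀ x, f x = inner ℝ x w := by
    intro x
    rw [real_inner_comm, hw, InnerProductSpace.toDual_symm_apply]
  have hw0 : w ≠ 0 := by
    intro h0
    have h1 := hf _ (h.center_mem K)
    have h2 := hu _ (h.center_mem L)
    rw [hfw, h0, inner_zero_right] at h1 h2
    linarith
  have hn : 0 < ‖w‖ := norm_pos_iff.2 hw0
  refine ⟨‖w‖⁻¹ • w, ‖w‖⁻¹ * u, ?_, ?_⟩
  · rw [norm_smul, norm_inv, norm_norm, inv_mul_cancel₀ hn.ne']
  · rintro x ⟨hxK, hxL⟩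
    have h1 : f x ≤ u := closure_minimal (s := m.cell K) (t := {x | f x ≤ u})
      (fun z hz => (hf z hz).le) (isClosed_le f.continuous continuous_const) hxK
    have h2 : u ≤ f x := closure_minimal (s := m.cell L) (t := {x | u ≤ f x})
      (fun z hz => (hu z hz).le) (isClosed_le continuous_const f.continuous) hxL
    rw [inner_smul_right, ← hfw, le_antisymm h1 h2]

lemma isBounded_cell (h : m.Admissible Ω Γ ξ) (hΩ : Bornology.IsBounded Ω) (K : Fin m.card) :
    Bornology.IsBounded (m.cell K) := hΩ.subset (h.cell_subset K)

lemma faceMeasure_face (h : m.Admissible Ω Γ ξ) (hΩ : Bornology.IsBounded Ω) {K L : Fin m.card}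
    (hKL : K ≠ L) : faceMeasure ℓ (m.face K L) = ENNReal.ofReal (m.area K L) := by
  obtain ⟨η, c, hη, hc⟩ := h.exists_hyperplane hKL
  refine (ENNReal.ofReal_toReal (faceMeasure_lt_top hη hc ?_).ne).symm
  exact (h.isBounded_cell hΩ K).closure.subset inter_subset_left

lemma faceMeasure_bface (h : m.Admissible Ω Γ ξ) (hΩ : Bornology.IsBounded Ω) (b : Fin m.bcard) :
    faceMeasure ℓ (m.bface b) = ENNReal.ofReal (m.barea b) := by
  refine (ENNReal.ofReal_toReal (faceMeasure_lt_top (h.bnormal_unit b) (h.bface_plane b) ?_).ne).symm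
  exact (h.isBounded_cell hΩ _).closure.subset ((h.bface_subset b).trans inter_subset_left)

lemma closure_subset_iUnion (h : m.Admissible Ω Γ ξ) : closure Ω ⊆ ⋃ K, closure (m.cell K) := by
  rw [← h.closure_cells, closure_iUnion_of_finite]

/-- What the cells miss lies in their frontiers, and the frontier of a convex set is null. -/
lemma volume_diff_cells (h : m.Admissible Ω Γ ξ) : volume (Ω \ ⋃ K, m.cell K) = 0 := by
  have hsub : Ω \ ⋃ K, m.cell K ⊆ ⋃ K, frontier (m.cell K) := by
    rintro x ⟨hx, hx'⟩
    obtain ⟨K, hK⟩ := mem_iUnion.1 (h.closure_subset_iUnion (subset_closure hx))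
    refine mem_iUnion.2 ⟨K, ?_⟩
    rw [(h.cell_open K).frontier_eq]
    exact ⟨hK, fun hxK => hx' (mem_iUnion.2 ⟨K, hxK⟩)⟩
  refine measure_mono_null hsub (measure_iUnion_null fun K => ?_)
  exact (h.cell_convex K).addHaar_frontier volume

lemma ae_mem_cell (h : m.Admissible Ω Γ ξ) :
    ∀ᵐ x : EuclideanSpace ℝ (Fin ℓ), x ∈ Ω → ∃ K, x ∈ m.cell K := by
  have := h.volume_diff_cells
  rw [measure_eq_zero_iff_ae_notMem] at this
  filter_upwards [this] with x hx hxΩ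
  by_contra hc
  exact hx ⟨hxΩ, fun h' => hc (mem_iUnion.1 h')⟩

end Admissible

open Classical in
/-- The variation of `v` between two control volumes met by a connected set is at most the
variation across the interfaces that the set meets. -/
lemma abs_sub_le_sum_crossed (m : Mesh ℓ) {S : Set (EuclideanSpace ℝ (Fin ℓ))}
    (hS : IsPreconnected S) (hcov : S ⊆ ⋃ K, closure (m.cell K)) (v : Fin m.card → ℝ)
    {K₀ K₁ : Fin m.card} (h₀ : (S ∩ closure (m.cell K₀)).Nonempty)
    (h₁ : (S ∩ closure (m.cell K₁)).Nonempty) :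
    |v K₀ - v K₁| ≤
      ∑ K, ∑ L, if K ≠ L ∧ (S ∩ m.face K L).Nonempty then |v K - v L| else 0 := by
  -- Two cells are adjacent when `S` meets their common face. A path in this graph turns the
  -- difference of two cell values into a sum of jumps across faces met by `S`.
  let G : SimpleGraph (Fin m.card) :=
    { Adj := fun K L => K ≠ L ∧ (S ∩ m.face K L).Nonempty
      symm := ⟨fun K L hKL => ⟨hKL.1.symm, m.face_comm K L ▸ hKL.2⟩⟩
      loopless := ⟨fun K hK => hK.1 rfl⟩ }
  have hreach : G.Reachable K₀ K₁ := by
    -- The closures of the reachable cells and of the unreachable ones would form two closed sets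
    -- covering `S` and both meeting it. By connectedness they meet inside `S`, which gives an edge
    -- from a reachable to an unreachable cell.
    by_contra hnot
    have hcl : ∀ P : Fin m.card → Prop, IsClosed (⋃ K ∈ {K | P K}, closure (m.cell K)) :=
      fun P => (Set.toFinite _).isClosed_biUnion fun K _ => isClosed_closure
    have := isPreconnected_closed_iff.1 hS _ _ (hcl (fun K => G.Reachable K₀ K))
      (hcl (fun K => ¬ G.Reachable K₀ K)) ?_ ?_ ?_
    · obtain ⟨z, hzS, hz1, hz2⟩ := this
      simp only [mem_iUnion] at hz1 hz2
      obtain ⟨K, hK, hzK⟩ := hz1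
      obtain ⟨L, hL, hzL⟩ := hz2
      have hK' : G.Reachable K₀ K := hK
      have hL' : ¬ G.Reachable K₀ L := hL
      have hne : K ≠ L := fun h => hL' (h ▸ hK')
      have hadj : G.Adj K L := ⟨hne, z, hzS, hzK, hzL⟩
      exact hL' (hK'.trans hadj.reachable)
    · intro z hz
      obtain ⟨K, hK⟩ := mem_iUnion.1 (hcov hz)
      by_cases hr : G.Reachable K₀ K
      · exact Or.inl (mem_biUnion hr hK)
      · exact Or.inr (mem_biUnion hr hK)
    · obtain ⟨z, hz, hz'⟩ := h₀
      exact ⟨z, hz, mem_biUnion (SimpleGraph.Reachable.refl K₀) hz'⟩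
    · obtain ⟨z, hz, hz'⟩ := h₁
      exact ⟨z, hz, mem_biUnion hnot hz'⟩
  obtain ⟨p, hp⟩ := hreach.exists_isPath
  have hwalk : ∀ {a b : Fin m.card} (p : G.Walk a b),
      |v a - v b| ≤ (p.darts.map fun d => |v d.fst - v d.snd|).sum := by
    intro a b p
    induction p with
    | nil => simp
    | cons hadj p ih =>
      rename_i a' b' c'
      simp only [SimpleGraph.Walk.darts_cons, List.map_cons, List.sum_cons]
      calc |v a' - v c'| ≤ |v a' - v b'| + |v b' - v c'| := abs_sub_le _ _ _
        _ ≤ _ := by gcongr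
  refine (hwalk p).trans ?_
  -- A path uses each oriented edge at most once, so its sum is bounded by the sum over all crossed
  -- pairs.
  have hnd : p.darts.Nodup := SimpleGraph.Walk.darts_nodup_of_support_nodup hp.support_nodup
  rw [← List.sum_toFinset _ hnd, ← Finset.sum_product']
  have hinj : ∀ d ∈ p.darts.toFinset, ∀ d' ∈ p.darts.toFinset, d.toProd = d'.toProd → d = d' :=
    fun d _ d' _ hdd => SimpleGraph.Dart.toProd_injective hdd
  rw [← Finset.sum_filter]
  calc ∑ d ∈ p.darts.toFinset, |v d.fst - v d.snd|
      = ∑ q ∈ p.darts.toFinset.image (fun d => d.toProd), |v q.1 - v q.2| := by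
        rw [Finset.sum_image (fun d hd d' hd' h => hinj d hd d' hd' h)]
    _ ≤ _ := by
        refine Finset.sum_le_sum_of_subset_of_nonneg ?_ fun _ _ _ => abs_nonneg _
        intro q hq
        obtain ⟨d, -, rfl⟩ := Finset.mem_image.1 hq
        exact Finset.mem_filter.2 ⟨Finset.mem_product.2 ⟨Finset.mem_univ _, Finset.mem_univ _⟩, d.adj⟩

end Mesh

lemma segment_eq_image_add {ℓ : ℕ} (x y : EuclideanSpace ℝ (Fin ℓ)) :
    segment ℝ x (x + y) = (fun t : ℝ => x + t • y) '' Icc (0 : ℝ) 1 := by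
  rw [segment_eq_image']
  simp

lemma segment_inter_nonempty_iff {ℓ : ℕ} (x y : EuclideanSpace ℝ (Fin ℓ))
    (A : Set (EuclideanSpace ℝ (Fin ℓ))) :
    (segment ℝ x (x + y) ∩ A).Nonempty ↔ x ∈ sweep A y := by
  rw [segment_eq_image_add]
  constructor
  · rintro ⟨_, ⟨t, ht, rfl⟩, hA⟩
    exact ⟨t, ht, hA⟩
  · rintro ⟨t, ht, hA⟩
    exact ⟨_, ⟨t, ht, rfl⟩, hA⟩

/-- The points of `Ω` that can be translated by `y` within `Ω`. -/
def transDom {ℓ : ℕ} (Ω : Set (EuclideanSpace ℝ (Fin ℓ))) (y : EuclideanSpace ℝ (Fin ℓ)) :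
    Set (EuclideanSpace ℝ (Fin ℓ)) :=
  {x | x ∈ Ω ∧ segment ℝ x (x + y) ⊆ Ω}

open scoped Pointwise in
-- The complement is the Minkowski sum of the closed set `Ωᶜ` and a compact segment, hence closed.
lemma isOpen_transDom {ℓ : ℕ} {Ω : Set (EuclideanSpace ℝ (Fin ℓ))} (hΩ : IsOpen Ω)
    (y : EuclideanSpace ℝ (Fin ℓ)) : IsOpen (transDom Ω y) := by
  have h : transDom Ω y = (Ωᶜ + (fun t : ℝ => -(t • y)) '' Icc (0 : ℝ) 1)ᶜ := by
    ext x
    simp only [transDom, mem_ofPred_eq, mem_compl_iff, segment_eq_image_add]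
    constructor
    · rintro ⟨-, hx⟩ ⟨a, ha, _, ⟨t, ht, rfl⟩, rfl⟩
      refine ha (hx ⟨t, ht, ?_⟩)
      simp
    · intro hx
      have key : ∀ t ∈ Icc (0 : ℝ) 1, x + t • y ∈ Ω := by
        intro t ht
        by_contra hc
        exact hx ⟨_, hc, _, ⟨t, ht, rfl⟩, by simp⟩
      refine ⟨by simpa using key 0 (by simp), ?_⟩
      rintro _ ⟨t, ht, rfl⟩
      exact key t ht
  rw [h, isOpen_compl_iff]
  exact hΩ.isClosed_compl.add_right_of_isCompact (isCompact_Icc.image (by fun_prop))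

namespace Mesh.Admissible

variable {ℓ : ℕ} {m : Mesh ℓ} {Ω Γ : Set (EuclideanSpace ℝ (Fin ℓ))} {ξ : ℝ}

lemma volume_sweep_face_le (h : m.Admissible Ω Γ ξ) (hΩ : Bornology.IsBounded Ω)
    {K L : Fin m.card} (hKL : K ≠ L) (y : EuclideanSpace ℝ (Fin ℓ)) :
    volume (sweep (m.face K L) y) ≤ ENNReal.ofReal (‖y‖ * m.area K L) := by
  obtain ⟨η, c, hη, hc⟩ := h.exists_hyperplane hKL
  rw [ENNReal.ofReal_mul (norm_nonneg y), ← h.faceMeasure_face hΩ hKL]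
  exact volume_sweep_le hη hc (isClosed_closure.inter isClosed_closure).measurableSet y

open scoped Pointwise in
lemma isClosed_sweep {A : Set (EuclideanSpace ℝ (Fin ℓ))} (hA : IsClosed A)
    (y : EuclideanSpace ℝ (Fin ℓ)) : IsClosed (sweep A y) := by
  have h : sweep A y = A + (fun t : ℝ => -(t • y)) '' Icc (0 : ℝ) 1 := by
    ext x
    constructor
    · rintro ⟨t, ht, hx⟩
      exact ⟨_, hx, _, ⟨t, ht, rfl⟩, by simp⟩
    · rintro ⟨a, ha, _, ⟨t, ht, rfl⟩, rfl⟩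
      exact ⟨t, ht, by simpa using ha⟩
  rw [h]
  exact hA.add_right_of_isCompact (isCompact_Icc.image (by fun_prop))

open Classical in
/-- The function counting the variation of `v` across the interfaces met by `[x, x + y]` has
integral at most `‖y‖` times the total variation. -/
lemma lintegral_crossed_le (h : m.Admissible Ω Γ ξ) (hΩ : Bornology.IsBounded Ω)
    (v : Fin m.card → ℝ) (y : EuclideanSpace ℝ (Fin ℓ)) :
    ∫⁻ x, ENNReal.ofReal (∑ K, ∑ L,
      if K ≠ L ∧ (segment ℝ x (x + y) ∩ m.face K L).Nonempty then |v K - v L| else 0) ≤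
      ENNReal.ofReal (‖y‖ * m.tvInt v) := by
  have hclosed : ∀ K L, IsClosed (m.face K L) := fun K L =>
    isClosed_closure.inter isClosed_closure
  have hpt : ∀ x, ENNReal.ofReal (∑ K, ∑ L,
      if K ≠ L ∧ (segment ℝ x (x + y) ∩ m.face K L).Nonempty then |v K - v L| else 0) =
      ∑ K, ∑ L, if K ≠ L then indicator (sweep (m.face K L) y)
        (fun _ => ENNReal.ofReal |v K - v L|) x else 0 := by
    intro x
    have hnn : ∀ K L : Fin m.card, 0 ≤
        if K ≠ L ∧ (segment ℝ x (x + y) ∩ m.face K L).Nonempty then |v K - v L| else 0 := by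
      intro K L; split_ifs <;> simp
    rw [ENNReal.ofReal_sum_of_nonneg fun K _ => Finset.sum_nonneg fun L _ => hnn K L]
    refine Finset.sum_congr rfl fun K _ => ?_
    rw [ENNReal.ofReal_sum_of_nonneg fun L _ => hnn K L]
    refine Finset.sum_congr rfl fun L _ => ?_
    simp only [segment_inter_nonempty_iff, indicator_apply]
    by_cases h1 : K = L <;> by_cases h2 : x ∈ sweep (m.face K L) y <;> simp [h1, h2]
  simp_rw [hpt]
  rw [lintegral_finsetSum' _ fun K _ => ?_]
  swap
  · refine Finset.aemeasurable_fun_sum _ fun L _ => ?_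
    split_ifs
    · exact (measurable_const.indicator (isClosed_sweep (hclosed K L) y).measurableSet).aemeasurable
    · exact aemeasurable_const
  unfold tvInt
  rw [Finset.mul_sum, ENNReal.ofReal_sum_of_nonneg fun K _ => mul_nonneg (norm_nonneg y)
    (Finset.sum_nonneg fun L _ => mul_nonneg (m.area_nonneg K L) (abs_nonneg _))]
  refine Finset.sum_le_sum fun K _ => ?_
  rw [lintegral_finsetSum' _ fun L _ => ?_]
  swap
  · split_ifs
    · exact (measurable_const.indicator (isClosed_sweep (hclosed K L) y).measurableSet).aemeasurable
    · exact aemeasurable_const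
  rw [Finset.mul_sum, ENNReal.ofReal_sum_of_nonneg fun L _ => mul_nonneg (norm_nonneg y)
    (mul_nonneg (m.area_nonneg K L) (abs_nonneg _))]
  have hle : ∀ L : Fin m.card, (∫⁻ x, if K ≠ L then indicator (sweep (m.face K L) y)
        (fun _ => ENNReal.ofReal |v K - v L|) x else 0) ≤
      if L ∈ m.nbrs K then ENNReal.ofReal (‖y‖ * (m.area K L * |v K - v L|)) else 0 := by
    intro L
    by_cases hKL : K = L
    · subst hKL; simp
    · simp only [ne_eq, hKL, not_false_eq_true, if_true]
      rw [lintegral_indicator_const (isClosed_sweep (hclosed K L) y).measurableSet]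
      have hv := h.volume_sweep_face_le hΩ hKL y
      split_ifs with hn
      · calc _ ≤ ENNReal.ofReal |v K - v L| * ENNReal.ofReal (‖y‖ * m.area K L) := by gcongr
          _ = _ := by
            rw [← ENNReal.ofReal_mul (abs_nonneg _)]
            congr 1; ring
      -- Cells that touch without being neighbours share a null face, whose sweep is null; only
      -- genuine interfaces contribute.
      · have h0 : m.area K L = 0 := by
          rw [mem_nbrs, not_and] at hn
          have := hn hKL
          rw [not_lt, nonpos_iff_eq_zero] at this
          unfold area
          rw [this]; rfl
        rw [h0, mul_zero, ENNReal.ofReal_zero, nonpos_iff_eq_zero] at hv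
        rw [hv, mul_zero]
  refine (Finset.sum_le_sum fun L _ => hle L).trans ?_
  rw [← Finset.sum_filter, Finset.filter_mem_eq_inter, Finset.univ_inter]

/-- Translation estimate for piecewise constant functions. -/
lemma lintegral_translate_le (h : m.Admissible Ω Γ ξ) (hΩ : Bornology.IsBounded Ω)
    (hΩo : IsOpen Ω) (v : Fin m.card → ℝ) (y : EuclideanSpace ℝ (Fin ℓ)) :
    ∫⁻ x in transDom Ω y, ‖m.pw v (x + y) - m.pw v x‖ₑ ≤ ENNReal.ofReal (‖y‖ * m.tvInt v) := by
  classical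
  refine le_trans ?_ (h.lintegral_crossed_le hΩ v y)
  refine le_trans (lintegral_mono_ae ?_) (setLIntegral_le_lintegral (transDom Ω y) _)
  rw [ae_restrict_iff' (isOpen_transDom hΩo y).measurableSet]
  have h1 := h.ae_mem_cell
  have h2 : ∀ᵐ x : EuclideanSpace ℝ (Fin ℓ), x + y ∈ Ω → ∃ K, x + y ∈ m.cell K :=
    (measurePreserving_add_right volume y).quasiMeasurePreserving.ae h1
  filter_upwards [h1, h2] with x hx1 hx2 hx
  obtain ⟨K₀, hK₀⟩ := hx1 hx.1
  obtain ⟨K₁, hK₁⟩ := hx2 (hx.2 (right_mem_segment ℝ _ _))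
  rw [h.pw_of_mem v hK₀, h.pw_of_mem v hK₁, ← ofReal_norm, Real.norm_eq_abs]
  refine ENNReal.ofReal_le_ofReal ?_
  rw [abs_sub_comm]
  exact m.abs_sub_le_sum_crossed (convex_segment _ _).isPreconnected
    ((hx.2.trans subset_closure).trans h.closure_subset_iUnion) v
    ⟨x, left_mem_segment ℝ _ _, subset_closure hK₀⟩
    ⟨x + y, right_mem_segment ℝ _ _, subset_closure hK₁⟩

end Mesh.Admissible

end TwoPhaseFV

/-! ### Discrete Poincaré inequality, uniform in the mesh -/

namespace TwoPhaseFV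

namespace Mesh

variable {ℓ : ℕ}

/-- Total variation across the interfaces and the Dirichlet faces. -/
noncomputable def tv (m : Mesh ℓ) (v : Fin m.card → ℝ) : ℝ :=
  m.tvInt v + ∑ b, m.barea b * |v (m.bowner b)|

namespace Admissible

variable {m : Mesh ℓ} {Ω Γ : Set (EuclideanSpace ℝ (Fin ℓ))} {ξ : ℝ}

lemma volume_cell (h : m.Admissible Ω Γ ξ) (hΩ : Bornology.IsBounded Ω) (K : Fin m.card) :
    volume (m.cell K) = ENNReal.ofReal (m.vol K) :=
  (ENNReal.ofReal_toReal (h.isBounded_cell hΩ K).measure_lt_top.ne).symm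

lemma vol_pos (h : m.Admissible Ω Γ ξ) (hΩ : Bornology.IsBounded Ω) (K : Fin m.card) :
    0 < m.vol K :=
  ENNReal.toReal_pos ((h.cell_open K).measure_pos volume (h.cell_nonempty K)).ne'
    (h.isBounded_cell hΩ K).measure_lt_top.ne

lemma pairwise_disjoint_cell (h : m.Admissible Ω Γ ξ) :
    Pairwise (Function.onFun Disjoint m.cell) := fun K L hKL =>
  disjoint_iff_inter_eq_empty.2 (h.cell_disjoint K L hKL)

lemma sum_vol_le (h : m.Admissible Ω Γ ξ) (hΩ : Bornology.IsBounded Ω) :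
    ∑ K, m.vol K ≤ (volume Ω).toReal := by
  rw [← ENNReal.ofReal_le_iff_le_toReal hΩ.measure_lt_top.ne,
    ENNReal.ofReal_sum_of_nonneg fun K _ => m.vol_nonneg K]
  simp_rw [← h.volume_cell hΩ]
  rw [← tsum_fintype (L := .unconditional _), ← measure_iUnion h.pairwise_disjoint_cell
    fun K => (h.cell_open K).measurableSet]
  exact measure_mono (iUnion_subset h.cell_subset)

lemma lintegral_eq_sum_cells (h : m.Admissible Ω Γ ξ) (f : EuclideanSpace ℝ (Fin ℓ) → ℝ≥0∞) :
    ∫⁻ x in Ω, f x = ∑ K, ∫⁻ x in m.cell K, f x := by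
  have h1 : (⋃ K, m.cell K : Set (EuclideanSpace ℝ (Fin ℓ))) =ᵐ[volume] Ω := by
    refine Filter.EventuallyLE.antisymm ?_ ?_
    · exact (iUnion_subset h.cell_subset).eventuallyLE
    · filter_upwards [h.ae_mem_cell] with x hx hxΩ
      exact mem_iUnion.2 (hx hxΩ)
  rw [← setLIntegral_congr h1, lintegral_iUnion (fun K => (h.cell_open K).measurableSet)
    h.pairwise_disjoint_cell, tsum_fintype]

lemma lintegral_pw (h : m.Admissible Ω Γ ξ) (hΩ : Bornology.IsBounded Ω) (v : Fin m.card → ℝ) :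
    ∫⁻ x in Ω, ‖m.pw v x‖ₑ = ENNReal.ofReal (∑ K, m.vol K * |v K|) := by
  rw [h.lintegral_eq_sum_cells, ENNReal.ofReal_sum_of_nonneg fun K _ =>
    mul_nonneg (m.vol_nonneg K) (abs_nonneg _)]
  refine Finset.sum_congr rfl fun K _ => ?_
  rw [setLIntegral_congr_fun (h.cell_open K).measurableSet
    (g := fun _ => ENNReal.ofReal |v K|), setLIntegral_const, h.volume_cell hΩ, mul_comm,
    ENNReal.ofReal_mul (m.vol_nonneg K)]
  intro x hx
  simp only
  rw [h.pw_of_mem v hx, ← ofReal_norm, Real.norm_eq_abs]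

/-- The Dirichlet faces of a control volume satisfy `∑ |σ| d_{K,σ} ≤ 2^ℓ |K|`. -/
lemma sum_barea_mul_bdst_le (h : m.Admissible Ω Γ ξ) (hΩ : Bornology.IsBounded Ω)
    (K : Fin m.card) :
    ∑ b ∈ m.bfaces K, m.barea b * m.bdst b ≤ 2 ^ ℓ * m.vol K := by
  have hA : ∀ b ∈ m.bfaces K, ∀ x ∈ m.bface b,
      inner ℝ (x - m.center K) (m.bnormal b) = m.bdst b := by
    intro b hb x hx
    rw [mem_bfaces] at hb
    rw [inner_sub_left, h.bface_plane b x hx, bdst, hb]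
  have hmeas : ∀ b ∈ m.bfaces K, MeasurableSet (halfCone (m.center K) (m.bface b)) :=
    fun b hb => measurableSet_halfCone (h.bdst_pos b) (hA b hb) (h.bface_meas b)
  have hsub : ∀ b ∈ m.bfaces K, halfCone (m.center K) (m.bface b) ⊆ m.cell K := by
    rintro b hb z ⟨t, ht, w, hw, rfl⟩
    rw [mem_bfaces] at hb
    have hwK : w ∈ closure (m.cell K) := hb ▸ (h.bface_subset b hw).1
    have := (h.cell_convex K).combo_interior_closure_mem_interior
      (x := m.center K) (y := w) (by
        rw [(h.cell_open K).interior_eq]; exact h.center_mem K) hwK (a := 1 - t) (b := t)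
      (by linarith [ht.2]) (by linarith [ht.1]) (by ring)
    rw [(h.cell_open K).interior_eq] at this
    convert this using 1
    module
  have hdisj : Set.Pairwise (m.bfaces K : Set (Fin m.bcard))
      (Function.onFun (AEDisjoint volume) fun b => halfCone (m.center K) (m.bface b)) := by
    intro b hb b' hb' hbb
    have hb1 : b ∈ m.bfaces K := hb
    have hb1' : b' ∈ m.bfaces K := hb'
    refine measure_mono_null ?_ (volume_halfCone_null (h.bnormal_unit b) (h.bdst_pos b)
      (x₀ := m.center K) (A := m.bface b ∩ m.bface b') (fun x hx => hA b hb x hx.1)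
      ((h.bface_meas b).inter (h.bface_meas b')) ?_)
    -- If a point lies in two half cones, the base point `w` of the first is on the inner side of
    -- the hyperplane of the second face, which forces `t' ≤ t`. By symmetry the parameters agree,
    -- then the base points, so the overlap is the half cone over the common part of the two faces.
    · have aux : ∀ {b b'}, b ∈ m.bfaces K → b' ∈ m.bfaces K → ∀ {t t' : ℝ} {w w'},
          w ∈ m.bface b → w' ∈ m.bface b' → 0 < t → 0 < t' →
          m.center K + t • (w - m.center K) = m.center K + t' • (w' - m.center K) → t' ≤ t := by
        intro b b' hb hb' t t' w w' hw hw' ht ht' heq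
        have h1 : inner ℝ (t • (w - m.center K)) (m.bnormal b') =
            t' * m.bdst b' := by
          rw [add_left_cancel heq, inner_smul_left, hA b' hb' w' hw', conj_trivial]
        rw [inner_smul_left, inner_sub_left, conj_trivial] at h1
        rw [mem_bfaces] at hb hb'
        have hwK : w ∈ closure (m.cell (m.bowner b')) := by
          rw [hb', ← hb]; exact (h.bface_subset b hw).1
        have h2 : inner ℝ w (m.bnormal b') ≤ m.boffset b' :=
          closure_minimal (t := {x | inner ℝ x (m.bnormal b') ≤ m.boffset b'})
            (fun z hz => (h.bowner_side b' z hz).le)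
            (isClosed_le (by fun_prop) (by fun_prop)) hwK
        have h3 := h.bdst_pos b'
        have h4 : inner ℝ w (m.bnormal b') - inner ℝ (m.center K) (m.bnormal b') ≤ m.bdst b' := by
          rw [bdst, hb']; linarith
        have h5 : t' * m.bdst b' ≤ t * m.bdst b' := by
          rw [← h1]; exact mul_le_mul_of_nonneg_left h4 ht.le
        exact le_of_mul_le_mul_right h5 h3
      rintro z ⟨⟨t, ht, w, hw, rfl⟩, t', ht', w', hw', heq⟩
      have ht0 : 0 < t := by linarith [ht.1]
      have ht0' : 0 < t' := by linarith [ht'.1]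
      have htt : t = t' := le_antisymm (aux hb1' hb1 hw' hw ht0' ht0 heq.symm)
        (aux hb1 hb1' hw hw' ht0 ht0' heq)
      subst htt
      have hww : w = w' := by
        have := smul_right_injective (EuclideanSpace ℝ (Fin ℓ)) ht0.ne' (add_left_cancel heq)
        exact sub_left_injective this
      exact ⟨t, ht, w, ⟨hw, hww ▸ hw'⟩, rfl⟩
    · refine h.bface_disjoint b b' hbb ?_
      rw [(m.mem_bfaces K b).1 hb1, (m.mem_bfaces K b').1 hb1']
  rw [← ENNReal.ofReal_le_ofReal_iff (mul_nonneg (by positivity) (m.vol_nonneg K)),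
    ENNReal.ofReal_sum_of_nonneg fun b _ => mul_nonneg (m.barea_nonneg b) (h.bdst_pos b).le,
    ENNReal.ofReal_mul (by positivity), ← h.volume_cell hΩ]
  calc ∑ b ∈ m.bfaces K, ENNReal.ofReal (m.barea b * m.bdst b)
      ≤ ∑ b ∈ m.bfaces K, 2 ^ ℓ * volume (halfCone (m.center K) (m.bface b)) := by
        refine Finset.sum_le_sum fun b hb => ?_
        rw [mul_comm, ENNReal.ofReal_mul (h.bdst_pos b).le, ← h.faceMeasure_bface hΩ]
        exact volume_halfCone_ge (h.bnormal_unit b) (h.bdst_pos b) (hA b hb) (h.bface_meas b)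
    _ = 2 ^ ℓ * volume (⋃ b ∈ m.bfaces K, halfCone (m.center K) (m.bface b)) := by
        rw [measure_biUnion_finset₀ hdisj fun b hb => (hmeas b hb).nullMeasurableSet,
          Finset.mul_sum]
    _ ≤ ENNReal.ofReal (2 ^ ℓ) * volume (m.cell K) := by
        rw [ENNReal.ofReal_pow (by norm_num), ENNReal.ofReal_ofNat]
        gcongr
        exact iUnion₂_subset hsub

lemma tv_nonneg (m : Mesh ℓ) (v : Fin m.card → ℝ) : 0 ≤ m.tv v :=
  add_nonneg (m.tvInt_nonneg v) (Finset.sum_nonneg fun b _ =>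
    mul_nonneg (m.barea_nonneg b) (abs_nonneg _))

/-- Finitely many Dirichlet faces and finitely many null sets cover `Γ`, so the faces cannot all be
null. -/
lemma exists_barea_pos (h : m.Admissible Ω Γ ξ) (hΓ : Γ ⊆ frontier Ω)
    (hpos : 0 < faceMeasure ℓ Γ) : ∃ b, 0 < faceMeasure ℓ (m.bface b) := by
  by_contra hc
  push Not at hc
  have hsub : Γ ⊆ (⋃ K, ((closure (m.cell K) ∩ Γ) \ ⋃ b ∈ m.bfaces K, m.bface b)) ∪
      ⋃ b, m.bface b := by
    intro x hx
    obtain ⟨K, hK⟩ := mem_iUnion.1 (h.closure_subset_iUnion (frontier_subset_closure (hΓ hx)))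
    by_cases hb : x ∈ ⋃ b ∈ m.bfaces K, m.bface b
    · right
      obtain ⟨b, -, hxb⟩ := mem_iUnion₂.1 hb
      exact mem_iUnion.2 ⟨b, hxb⟩
    · left
      exact mem_iUnion.2 ⟨K, ⟨hK, hx⟩, hb⟩
  refine hpos.ne' (measure_mono_null hsub (measure_union_null
    (measure_iUnion_null h.bface_cover) (measure_iUnion_null fun b => ?_)))
  exact nonpos_iff_eq_zero.1 (hc b)

end Admissible

end Mesh

/-- The `L¹` norm on `S` of piecewise constant functions is controlled by their total variation,
uniformly in the mesh. -/
def TVControlled {ℓ : ℕ} (Ω Γ : Set (EuclideanSpace ℝ (Fin ℓ))) (ξ : ℝ)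
    (S : Set (EuclideanSpace ℝ (Fin ℓ))) : Prop :=
  ∃ C : ℝ≥0∞, C ≠ ∞ ∧ ∀ m : Mesh ℓ, m.Admissible Ω Γ ξ → ∀ v : Fin m.card → ℝ,
    ∫⁻ x in S, ‖m.pw v x‖ₑ ≤ C * ENNReal.ofReal (m.tv v)

section Poincare

variable {ℓ : ℕ} {Ω Γ : Set (EuclideanSpace ℝ (Fin ℓ))} {ξ : ℝ}

lemma TVControlled.mono {S S' : Set (EuclideanSpace ℝ (Fin ℓ))} (h : TVControlled Ω Γ ξ S)
    (hS : S' ⊆ S) : TVControlled Ω Γ ξ S' := by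
  obtain ⟨C, hC, hm⟩ := h
  exact ⟨C, hC, fun m hm' v => (lintegral_mono_set hS).trans (hm m hm' v)⟩

/-- Substitute `w = z + y` and exchange the integrals. Convexity of `W` puts the segment from `z` to
`z + y` inside `Ω`, so the translation bound applies for each `y`, and only `‖y‖ ≤ R` occurs. -/
lemma lintegral_lintegral_sub_le (hΩo : IsOpen Ω) {W : Set (EuclideanSpace ℝ (Fin ℓ))}
    (hWo : IsOpen W) (hW : Convex ℝ W) (hWΩ : W ⊆ Ω) {R : ℝ} (hR : ∀ x ∈ W, ∀ y ∈ W, ‖y - x‖ ≤ R)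
    {f : EuclideanSpace ℝ (Fin ℓ) → ℝ} (hf : Measurable f) {A : ℝ≥0∞}
    (hA : ∀ y, ‖y‖ ≤ R → ∫⁻ x in transDom Ω y, ‖f (x + y) - f x‖ₑ ≤ A) :
    ∫⁻ z in W, ∫⁻ w in W, ‖f w - f z‖ₑ ≤
      A * volume (Metric.closedBall (0 : EuclideanSpace ℝ (Fin ℓ)) R) := by
  set F : EuclideanSpace ℝ (Fin ℓ) → EuclideanSpace ℝ (Fin ℓ) → ℝ≥0∞ := fun z w =>
    indicator W (fun _ => 1) z * (indicator W (fun _ => 1) w * ‖f w - f z‖ₑ) with hF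
  have hind : Measurable (indicator W (fun _ => (1 : ℝ≥0∞))) :=
    measurable_const.indicator hWo.measurableSet
  have hind' : ∀ g : EuclideanSpace ℝ (Fin ℓ) → ℝ≥0∞,
      ∫⁻ z in W, g z = ∫⁻ z, indicator W (fun _ => 1) z * g z := by
    intro g
    rw [← lintegral_indicator hWo.measurableSet]
    refine lintegral_congr fun z => ?_
    by_cases hz : z ∈ W <;> simp [hz]
  have hFm : Measurable (Function.uncurry F) := by
    refine (hind.comp measurable_fst).mul ((hind.comp measurable_snd).mul ?_)
    exact ((hf.comp measurable_snd).sub (hf.comp measurable_fst)).enorm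
  have e1 : ∫⁻ z in W, ∫⁻ w in W, ‖f w - f z‖ₑ = ∫⁻ z, ∫⁻ y, F z (z + y) := by
    rw [hind']
    refine lintegral_congr fun z => ?_
    rw [lintegral_add_left_eq_self (fun w => F z w) z, hind', hF]
    simp only
    rw [lintegral_const_mul]
    exact hind.mul (hf.sub measurable_const).enorm
  rw [e1, lintegral_lintegral_swap]
  swap
  · exact (hFm.comp (measurable_fst.prodMk (measurable_fst.add measurable_snd))).aemeasurable
  have e2 : ∀ y, ∫⁻ z, F z (z + y) ≤
      indicator (Metric.closedBall (0 : EuclideanSpace ℝ (Fin ℓ)) R) (fun _ => A) y := by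
    intro y
    by_cases hy : ‖y‖ ≤ R
    · rw [indicator_of_mem (by simpa using hy)]
      refine le_trans ?_ (hA y hy)
      rw [← lintegral_indicator (isOpen_transDom hΩo y).measurableSet]
      refine lintegral_mono fun z => ?_
      by_cases hz : z ∈ W
      · by_cases hzy : z + y ∈ W
        · have : z ∈ transDom Ω y := ⟨hWΩ hz, (hW.segment_subset hz hzy).trans hWΩ⟩
          simp [hF, hz, hzy, this]
        · simp [hF, hzy]
      · simp [hF, hz]
    · have : ∀ z, F z (z + y) = 0 := by
        intro z
        by_cases hz : z ∈ W
        · by_cases hzy : z + y ∈ W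
          · exact absurd (by simpa using hR z hz (z + y) hzy) hy
          · simp [hF, hzy]
        · simp [hF, hz]
      simp [this]
  refine (lintegral_mono e2).trans ?_
  rw [lintegral_indicator_const Metric.isClosed_closedBall.measurableSet]

/-- Average `f z = f w - (f w - f z)` over `w ∈ S`: the first term is controlled by hypothesis, the
second by the translation estimate on the convex set `W`. The positive volume of `S` is the divisor.
-/
lemma TVControlled.extend (hΩo : IsOpen Ω) (hΩ : Bornology.IsBounded Ω)
    {S W : Set (EuclideanSpace ℝ (Fin ℓ))} (h : TVControlled Ω Γ ξ S)
    (hSpos : volume S ≠ 0) (hSW : S ⊆ W) (hWo : IsOpen W)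
    (hW : Convex ℝ W) (hWΩ : W ⊆ Ω) : TVControlled Ω Γ ξ W := by
  obtain ⟨C, hC, hm⟩ := h
  obtain ⟨R, hR⟩ := Metric.isBounded_iff.1 (hΩ.subset hWΩ)
  have hWb : volume W ≠ ∞ := (hΩ.subset hWΩ).measure_lt_top.ne
  have hSb : volume S ≠ ∞ := (hΩ.subset (hSW.trans hWΩ)).measure_lt_top.ne
  set V := volume (Metric.closedBall (0 : EuclideanSpace ℝ (Fin ℓ)) R)
  have hVb : V ≠ ∞ := measure_closedBall_lt_top.ne
  refine ⟨(volume S)⁻¹ * (volume W * C + ENNReal.ofReal R * V),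
    ENNReal.mul_ne_top (ENNReal.inv_ne_top.2 hSpos) (ENNReal.add_ne_top.2
      ⟨ENNReal.mul_ne_top hWb hC, ENNReal.mul_ne_top ENNReal.ofReal_ne_top hVb⟩), ?_⟩
  intro m hadm v
  set f := m.pw v
  have hf : Measurable f := hadm.measurable_pw v
  set τ := ENNReal.ofReal (m.tv v)
  have h1 : ∫⁻ z in W, ∫⁻ w in W, ‖f w - f z‖ₑ ≤ (ENNReal.ofReal R * τ) * V := by
    refine lintegral_lintegral_sub_le hΩo hWo hW hWΩ (R := R) ?_ hf ?_
    · intro x hx y hy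
      rw [← dist_eq_norm]
      exact hR hy hx
    · intro y hy
      refine (hadm.lintegral_translate_le hΩ hΩo v y).trans ?_
      rw [← ENNReal.ofReal_mul ((norm_nonneg y).trans hy)]
      refine ENNReal.ofReal_le_ofReal ?_
      have : m.tvInt v ≤ m.tv v := le_add_of_nonneg_right (Finset.sum_nonneg fun b _ =>
        mul_nonneg (m.barea_nonneg b) (abs_nonneg _))
      exact mul_le_mul hy this (m.tvInt_nonneg v) ((norm_nonneg y).trans hy)
  have h2 : volume S * ∫⁻ z in W, ‖f z‖ₑ ≤ volume W * (C * τ) + (ENNReal.ofReal R * τ) * V := by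
    calc volume S * ∫⁻ z in W, ‖f z‖ₑ = ∫⁻ z in W, ∫⁻ w in S, ‖f z‖ₑ := by
          rw [← lintegral_const_mul _ hf.enorm]
          refine lintegral_congr fun z => ?_
          rw [setLIntegral_const, mul_comm]
      _ ≤ ∫⁻ z in W, ∫⁻ w in S, (‖f w‖ₑ + ‖f w - f z‖ₑ) := by
          refine lintegral_mono fun z => lintegral_mono fun w => ?_
          have : f z = f w - (f w - f z) := by ring
          calc ‖f z‖ₑ = ‖f w - (f w - f z)‖ₑ := by rw [← this]
            _ ≤ _ := enorm_sub_le
      _ = ∫⁻ z in W, ((∫⁻ w in S, ‖f w‖ₑ) + ∫⁻ w in S, ‖f w - f z‖ₑ) := by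
          refine lintegral_congr fun z => ?_
          rw [lintegral_add_left hf.enorm]
      _ = (∫⁻ w in S, ‖f w‖ₑ) * volume W + ∫⁻ z in W, ∫⁻ w in S, ‖f w - f z‖ₑ := by
          rw [lintegral_add_left measurable_const, setLIntegral_const]
      _ ≤ (C * τ) * volume W + ∫⁻ z in W, ∫⁻ w in W, ‖f w - f z‖ₑ := by
          gcongr
          exact hm m hadm v
      _ ≤ _ := by rw [mul_comm]; gcongr
  calc ∫⁻ z in W, ‖f z‖ₑ = (volume S)⁻¹ * (volume S * ∫⁻ z in W, ‖f z‖ₑ) := by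
        rw [← mul_assoc, ENNReal.inv_mul_cancel hSpos hSb, one_mul]
    _ ≤ (volume S)⁻¹ * (volume W * (C * τ) + (ENNReal.ofReal R * τ) * V) := by gcongr
    _ = _ := by ring

/-- Control near a part of the Dirichlet boundary. -/
lemma exists_tvControlled (hΩ : Bornology.IsBounded Ω) (hΓm : MeasurableSet Γ)
    (hΓ : Γ ⊆ frontier Ω) (hpos : 0 < faceMeasure ℓ Γ) {m₀ : Mesh ℓ}
    (h₀ : m₀.Admissible Ω Γ ξ) : ∃ (K : Fin m₀.card) (S : Set (EuclideanSpace ℝ (Fin ℓ))),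
      S ⊆ m₀.cell K ∧ volume S ≠ 0 ∧ TVControlled Ω Γ ξ S := by
  classical
  obtain ⟨b₀, hb₀⟩ := h₀.exists_barea_pos hΓ hpos
  set K₀ := m₀.bowner b₀
  set η := m₀.bnormal b₀
  set x₀ := m₀.center K₀
  obtain ⟨r, hr, hball⟩ := Metric.isOpen_iff.1 (h₀.cell_open K₀) x₀ (h₀.center_mem K₀)
  -- The point `w₀` is chosen so that every neighbourhood of it in the face has positive area. With
  -- `r` the radius of a ball around the center inside the cell, each `w` in the face within `r` of
  -- `w₀` has `w - y` in that ball, where `y = w₀ - x₀`; by convexity the segment back from `w` then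
  -- stays in the cell.
  obtain ⟨w₀, hw₀, hw₀pos⟩ := exists_mem_forall_mem_nhdsWithin_pos_measure hb₀.ne'
  set A := m₀.bface b₀ ∩ Metric.ball w₀ r
  have hApos : 0 < faceMeasure ℓ A := hw₀pos A
    (inter_mem_nhdsWithin _ (Metric.ball_mem_nhds w₀ hr))
  have hAm : MeasurableSet A := (h₀.bface_meas b₀).inter Metric.isOpen_ball.measurableSet
  have hAη : ∀ x ∈ A, inner ℝ x η = m₀.boffset b₀ := fun x hx => h₀.bface_plane b₀ x hx.1
  have hη : ‖η‖ = 1 := h₀.bnormal_unit b₀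
  set y := w₀ - x₀ with hy
  have hyη : 0 < inner ℝ y η := by
    rw [hy, inner_sub_left, h₀.bface_plane b₀ w₀ hw₀]
    exact sub_pos.2 (h₀.bowner_side b₀ _ (h₀.center_mem _))
  have hin : ∀ w ∈ A, ∀ t ∈ Ioc (0 : ℝ) 1, w - t • y ∈ m₀.cell K₀ := by
    intro w hw t ht
    have hc : w - y ∈ interior (m₀.cell K₀) := by
      rw [(h₀.cell_open K₀).interior_eq]
      apply hball
      have := hw.2
      rw [Metric.mem_ball, dist_eq_norm] at this ⊢
      rw [hy]
      convert this using 2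
      abel
    have := (h₀.cell_convex K₀).combo_interior_closure_mem_interior hc
      (h₀.bface_subset b₀ hw.1).1 ht.1 (b := 1 - t) (by linarith [ht.2]) (by ring)
    rw [(h₀.cell_open K₀).interior_eq] at this
    convert this using 1
    module
  set S := sweep A y ∩ m₀.cell K₀
  have hSm : MeasurableSet S :=
    (measurableSet_sweep hAη hAm hyη.ne').inter (h₀.cell_open K₀).measurableSet
  refine ⟨K₀, S, inter_subset_right, ?_, ENNReal.ofReal ‖y‖, ENNReal.ofReal_ne_top, ?_⟩
  · intro hS
    have h1 : volume (sweep A y) = 0 := by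
      refine measure_mono_null (t := S ∪ {x | inner ℝ x η = m₀.boffset b₀}) ?_
        (measure_union_null hS (volume_hyperplane hη _))
      rintro x ⟨t, ht, hx⟩
      rcases ht.1.eq_or_lt with h0 | h0
      · right
        subst h0
        rw [zero_smul, add_zero] at hx
        exact hAη x hx
      · left
        refine ⟨⟨t, ht, hx⟩, ?_⟩
        simpa using hin _ hx t ⟨h0, ht.2⟩
    rw [volume_sweep_eq hη hAη hAm hyη.ne'] at h1
    rcases mul_eq_zero.1 h1 with h2 | h2
    · rw [ENNReal.ofReal_eq_zero] at h2
      exact absurd (abs_pos.2 hyη.ne') (not_lt.2 h2)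
    · exact hApos.ne' h2
  -- The set `S` depends only on the auxiliary mesh `m₀`, while `m` is now arbitrary. From almost
  -- every point of `S` a segment along `y` reaches a Dirichlet face of `m`; the null part `Z` of
  -- `Γ` missed by these faces has a null sweep.
  · intro m hm v
    set Z := ⋃ K, ((closure (m.cell K) ∩ Γ) \ ⋃ b ∈ m.bfaces K, m.bface b)
    have hZ0 : faceMeasure ℓ Z = 0 := measure_iUnion_null hm.bface_cover
    have hZm : MeasurableSet Z := MeasurableSet.iUnion fun K =>
      (isClosed_closure.measurableSet.inter hΓm).diff
        (Finset.measurableSet_biUnion _ fun b _ => hm.bface_meas b)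
    have hflat : ∀ B : Set (EuclideanSpace ℝ (Fin ℓ)), ∀ x ∈ B ∩ A,
        inner ℝ x η = m₀.boffset b₀ := fun B x hx => hAη x hx.2
    have hZsweep : volume (sweep (Z ∩ A) y) = 0 := by
      rw [← nonpos_iff_eq_zero]
      refine (volume_sweep_le hη (hflat Z) (hZm.inter hAm) y).trans ?_
      rw [measure_mono_null inter_subset_left hZ0, mul_zero]
    have hbmeas : ∀ b, MeasurableSet (sweep (m.bface b ∩ A) y) := fun b =>
      measurableSet_sweep (hflat _) ((hm.bface_meas b).inter hAm) hyη.ne'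
    have hpt : ∀ᵐ x, x ∈ S → ‖m.pw v x‖ₑ ≤ ENNReal.ofReal (∑ K, ∑ L,
          if K ≠ L ∧ (segment ℝ x (x + y) ∩ m.face K L).Nonempty then |v K - v L| else 0) +
        ∑ b, indicator (sweep (m.bface b ∩ A) y)
          (fun _ => ENNReal.ofReal |v (m.bowner b)|) x := by
      have hZae := measure_eq_zero_iff_ae_notMem.1 hZsweep
      filter_upwards [hm.ae_mem_cell, hZae] with x hx hxZ hxS
      have hxΩ : x ∈ Ω := h₀.cell_subset _ hxS.2
      obtain ⟨K, hK⟩ := hx hxΩ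
      obtain ⟨t, ht, hw⟩ := hxS.1
      set w := x + t • y with hwdef
      have hwcl : w ∈ closure (m₀.cell K₀) := (h₀.bface_subset b₀ hw.1).1
      have hwΓ : w ∈ Γ := (h₀.bface_subset b₀ hw.1).2
      have hseg : segment ℝ x w ⊆ ⋃ K, closure (m.cell K) := by
        refine Subset.trans ?_ hm.closure_subset_iUnion
        refine ((h₀.cell_convex K₀).closure.segment_subset (subset_closure hxS.2) hwcl).trans ?_
        exact closure_mono (h₀.cell_subset K₀)
      obtain ⟨K₁, hK₁⟩ := mem_iUnion.1 (hseg (right_mem_segment ℝ x w))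
      have hwZ : w ∉ Z := fun hZ => hxZ ⟨t, ht, hZ, hw⟩
      have hwb : ∃ b ∈ m.bfaces K₁, w ∈ m.bface b := by
        by_contra hc
        push Not at hc
        refine hwZ (mem_iUnion.2 ⟨K₁, ⟨hK₁, hwΓ⟩, ?_⟩)
        intro h'
        obtain ⟨b, hb, hwb⟩ := mem_iUnion₂.1 h'
        exact hc b hb hwb
      obtain ⟨b, hb, hwb⟩ := hwb
      rw [Mesh.mem_bfaces] at hb
      rw [hm.pw_of_mem v hK, ← ofReal_norm, Real.norm_eq_abs]
      have h1 := m.abs_sub_le_sum_crossed (convex_segment x w).isPreconnected hseg v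
        ⟨x, left_mem_segment ℝ x w, subset_closure hK⟩ ⟨w, right_mem_segment ℝ x w, hK₁⟩
      have hsub : segment ℝ x w ⊆ segment ℝ x (x + y) := by
        refine (convex_segment x (x + y)).segment_subset (left_mem_segment ℝ _ _) ?_
        rw [segment_eq_image_add]
        exact ⟨t, ht, rfl⟩
      have h2 : (∑ K, ∑ L, if K ≠ L ∧ (segment ℝ x w ∩ m.face K L).Nonempty
            then |v K - v L| else 0) ≤ ∑ K, ∑ L,
          if K ≠ L ∧ (segment ℝ x (x + y) ∩ m.face K L).Nonempty then |v K - v L| else 0 := by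
        refine Finset.sum_le_sum fun K _ => Finset.sum_le_sum fun L _ => ?_
        by_cases hh : K ≠ L ∧ (segment ℝ x w ∩ m.face K L).Nonempty
        · rw [if_pos hh, if_pos ⟨hh.1, hh.2.mono (inter_subset_inter_left _ hsub)⟩]
        · rw [if_neg hh]
          split_ifs <;> simp
      have h3 : |v K| ≤ |v K - v K₁| + |v K₁| := by
        simpa using abs_add_le (v K - v K₁) (v K₁)
      refine (ENNReal.ofReal_le_ofReal (h3.trans (add_le_add_left (h1.trans h2) _))).trans ?_
      refine ENNReal.ofReal_add_le.trans ?_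
      gcongr
      refine le_trans ?_ (Finset.single_le_sum (fun _ _ => zero_le) (Finset.mem_univ b))
      rw [indicator_of_mem (show x ∈ sweep (m.bface b ∩ A) y from ⟨t, ht, hwb, hw⟩), hb]
    calc ∫⁻ x in S, ‖m.pw v x‖ₑ
        ≤ ∫⁻ x in S, (ENNReal.ofReal (∑ K, ∑ L,
          if K ≠ L ∧ (segment ℝ x (x + y) ∩ m.face K L).Nonempty then |v K - v L| else 0) +
          ∑ b, indicator (sweep (m.bface b ∩ A) y)
            (fun _ => ENNReal.ofReal |v (m.bowner b)|) x) :=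
          lintegral_mono_ae ((ae_restrict_iff' hSm).2 hpt)
      _ ≤ ∫⁻ x, (ENNReal.ofReal (∑ K, ∑ L,
          if K ≠ L ∧ (segment ℝ x (x + y) ∩ m.face K L).Nonempty then |v K - v L| else 0) +
          ∑ b, indicator (sweep (m.bface b ∩ A) y)
            (fun _ => ENNReal.ofReal |v (m.bowner b)|) x) := setLIntegral_le_lintegral _ _
      _ ≤ ENNReal.ofReal (‖y‖ * m.tvInt v) +
          ∑ b, ENNReal.ofReal (‖y‖ * (m.barea b * |v (m.bowner b)|)) := by
          rw [lintegral_add_right _ (Finset.measurable_fun_sum _ fun b _ =>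
            measurable_const.indicator (hbmeas b)),
            lintegral_finsetSum _ fun b _ => measurable_const.indicator (hbmeas b)]
          refine add_le_add (hm.lintegral_crossed_le hΩ v y) (Finset.sum_le_sum fun b _ => ?_)
          rw [lintegral_indicator_const (hbmeas b)]
          have h1 : volume (sweep (m.bface b ∩ A) y) ≤ ENNReal.ofReal (‖y‖ * m.barea b) := by
            refine (volume_sweep_le hη (hflat _) ((hm.bface_meas b).inter hAm) y).trans ?_
            rw [ENNReal.ofReal_mul (norm_nonneg y), ← hm.faceMeasure_bface hΩ]
            gcongr
            exact inter_subset_left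
          calc _ ≤ ENNReal.ofReal |v (m.bowner b)| * ENNReal.ofReal (‖y‖ * m.barea b) := by gcongr
            _ = _ := by rw [← ENNReal.ofReal_mul (abs_nonneg _)]; congr 1; ring
      _ = ENNReal.ofReal ‖y‖ * ENNReal.ofReal (m.tv v) := by
          have hnn : ∀ b ∈ Finset.univ, 0 ≤ ‖y‖ * (m.barea b * |v (m.bowner b)|) := fun b _ =>
            mul_nonneg (norm_nonneg y) (mul_nonneg (m.barea_nonneg b) (abs_nonneg _))
          rw [← ENNReal.ofReal_sum_of_nonneg hnn, ← ENNReal.ofReal_add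
            (mul_nonneg (norm_nonneg y) (m.tvInt_nonneg v)) (Finset.sum_nonneg hnn),
            ← Finset.mul_sum, ← mul_add, ENNReal.ofReal_mul (norm_nonneg y), Mesh.tv]

open Mesh.Admissible in
-- One fixed admissible mesh supplies a controlled starting set; without any such mesh the claim is
-- vacuous. The points having a controlled ball form an open set, also relatively closed in `Ω`,
-- since a ball in `Ω` containing such a point inherits control by `TVControlled.extend`.
-- Connectedness makes this set all of `Ω`. Each of the finitely many convex cells of the fixed mesh
-- then contains a controlled ball, so it is controlled, and the constants add up.
lemma tvControlled_domain (hΩo : IsOpen Ω) (hΩ : Bornology.IsBounded Ω) (hΩc : IsConnected Ω)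
    (hΓm : MeasurableSet Γ) (hΓ : Γ ⊆ frontier Ω) (hpos : 0 < faceMeasure ℓ Γ) :
    TVControlled Ω Γ ξ Ω := by
  by_cases hex : ∃ m₀ : Mesh ℓ, m₀.Admissible Ω Γ ξ
  swap
  · exact ⟨0, by simp, fun m hm => absurd ⟨m, hm⟩ hex⟩
  obtain ⟨m₀, h₀⟩ := hex
  obtain ⟨K₀, S, hS, hSpos, hSc⟩ := exists_tvControlled hΩ hΓm hΓ hpos h₀
  have hK₀ : TVControlled Ω Γ ξ (m₀.cell K₀) := hSc.extend hΩo hΩ hSpos hS (h₀.cell_open K₀)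
    (h₀.cell_convex K₀) (h₀.cell_subset K₀)
  set U := {x | ∃ r > 0, Metric.ball x r ⊆ Ω ∧ TVControlled Ω Γ ξ (Metric.ball x r)} with hU
  have hspread : ∀ x R, Metric.ball x R ⊆ Ω → ∀ z ∈ Metric.ball x R, z ∈ U →
      TVControlled Ω Γ ξ (Metric.ball x R) := by
    rintro x R hR z hz ⟨r, hr, -, hc⟩
    obtain ⟨r', hr', hsub⟩ := Metric.isOpen_iff.1 Metric.isOpen_ball z hz
    have hmin : 0 < min r r' := lt_min hr hr'
    refine (hc.mono (Metric.ball_subset_ball (min_le_left r r'))).extend hΩo hΩ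
      (Metric.measure_ball_pos volume z hmin).ne'
      ((Metric.ball_subset_ball (min_le_right r r')).trans hsub) Metric.isOpen_ball
      (convex_ball x R) hR
  have hmemU : ∀ x R, Metric.ball x R ⊆ Ω → TVControlled Ω Γ ξ (Metric.ball x R) →
      Metric.ball x R ⊆ U := by
    intro x R hR hc z hz
    obtain ⟨r', hr', hsub⟩ := Metric.isOpen_iff.1 Metric.isOpen_ball z hz
    exact ⟨r', hr', hsub.trans hR, hc.mono hsub⟩
  have hUo : IsOpen U := by
    rw [Metric.isOpen_iff]
    rintro x ⟨r, hr, hsub, hc⟩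
    exact ⟨r, hr, hmemU x r hsub hc⟩
  have hΩU : Ω ⊆ U := by
    refine hΩc.isPreconnected.subset_of_closure_inter_subset hUo ?_ ?_
    · obtain ⟨r, hr, hsub⟩ := Metric.isOpen_iff.1 (h₀.cell_open K₀) _ (h₀.center_mem K₀)
      exact ⟨_, h₀.cell_subset _ (h₀.center_mem K₀), r, hr, hsub.trans (h₀.cell_subset _),
        hK₀.mono hsub⟩
    · rintro x ⟨hx, hxΩ⟩
      obtain ⟨R, hR, hsub⟩ := Metric.isOpen_iff.1 hΩo x hxΩ
      obtain ⟨z, hz, hzU⟩ := mem_closure_iff.1 hx _ Metric.isOpen_ball (Metric.mem_ball_self hR)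
      exact hmemU x R hsub (hspread x R hsub z hz hzU) (Metric.mem_ball_self hR)
  have hcell : ∀ K, TVControlled Ω Γ ξ (m₀.cell K) := by
    intro K
    obtain ⟨r, hr, -, hc⟩ := hΩU (h₀.cell_subset K (h₀.center_mem K))
    obtain ⟨r', hr', hsub⟩ := Metric.isOpen_iff.1 (h₀.cell_open K) _ (h₀.center_mem K)
    refine (hc.mono (Metric.ball_subset_ball (min_le_left r r'))).extend hΩo hΩ
      (Metric.measure_ball_pos volume _ (lt_min hr hr')).ne'
      ((Metric.ball_subset_ball (min_le_right r r')).trans hsub) (h₀.cell_open K)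
      (h₀.cell_convex K) (h₀.cell_subset K)
  choose C hC hCm using hcell
  refine ⟨∑ K, C K, (ENNReal.sum_ne_top).2 fun K _ => hC K, fun m hm v => ?_⟩
  rw [h₀.lintegral_eq_sum_cells, Finset.sum_mul]
  exact Finset.sum_le_sum fun K _ => hCm K m hm v

/-- Discrete Poincaré inequality for functions vanishing on the Dirichlet boundary. -/
lemma discrete_poincare (hΩo : IsOpen Ω) (hΩ : Bornology.IsBounded Ω) (hΩc : IsConnected Ω)
    (hΓm : MeasurableSet Γ) (hΓ : Γ ⊆ frontier Ω) (hpos : 0 < faceMeasure ℓ Γ) (hξ : 0 < ξ) :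
    ∃ C : ℝ, 0 < C ∧ ∀ m : Mesh ℓ, m.Admissible Ω Γ ξ → ∀ u : Fin m.card → ℝ,
      ∑ K, m.vol K * u K ^ 2 ≤ C * (∑ K, ∑ L ∈ m.nbrs K, m.area K L / m.dst K L * (u L - u K) ^ 2 +
        ∑ K, ∑ b ∈ m.bfaces K, m.barea b / m.bdst b * u K ^ 2) := by
  obtain ⟨C₀, hC₀, hctrl⟩ := tvControlled_domain (ξ := ξ) hΩo hΩ hΩc hΓm hΓ hpos
  set c := C₀.toReal + 1
  have hc : 0 < c := by positivity
  have hcC : C₀ ≤ ENNReal.ofReal c := by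
    rw [← ENNReal.ofReal_toReal hC₀]
    exact ENNReal.ofReal_le_ofReal (by simp [c])
  -- The geometric constants: `2 * ξ` for the interfaces and `2 ^ ℓ` for the Dirichlet faces. The
  -- Young parameter `lam` is fixed by `c * (lam * q) = 1 / 2`, so that half of the L² term can be
  -- absorbed on the left.
  set q : ℝ := 2 * ξ + 2 ^ ℓ with hq
  have hq0 : 0 < q := by positivity
  set lam : ℝ := (2 * c * q)⁻¹ with hlam
  have hlam0 : 0 < lam := by positivity
  refine ⟨2 * c * (2 * lam)⁻¹, by positivity, fun m hm u => ?_⟩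
  -- The L¹ control is applied to `u ^ 2`, whose jumps factor as `|u L - u K| * |u K + u L|`.
  have h1 : ∑ K, m.vol K * u K ^ 2 ≤ c * m.tv fun K => u K ^ 2 := by
    have := hctrl m hm fun K => u K ^ 2
    rw [hm.lintegral_pw hΩ] at this
    have h2 := this.trans (mul_le_mul_left hcC _)
    rw [← ENNReal.ofReal_mul hc.le, ENNReal.ofReal_le_ofReal_iff
      (mul_nonneg hc.le (Mesh.Admissible.tv_nonneg m _))] at h2
    simpa using h2
  have hint : m.tvInt (fun K => u K ^ 2) ≤ (2 * lam)⁻¹ *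
      (∑ K, ∑ L ∈ m.nbrs K, m.area K L / m.dst K L * (u L - u K) ^ 2) +
      lam * (2 * ξ * ∑ K, m.vol K * u K ^ 2) := by
    have hsq : ∑ K, ∑ L ∈ m.nbrs K, m.area K L * m.dst K L * (u K ^ 2 + u L ^ 2) ≤
        2 * ξ * ∑ K, m.vol K * u K ^ 2 := by
      have e : ∑ K, ∑ L ∈ m.nbrs K, m.area K L * m.dst K L * u L ^ 2 =
          ∑ K, ∑ L ∈ m.nbrs K, m.area K L * m.dst K L * u K ^ 2 := by
        rw [m.sum_nbrs_comm]
        refine Finset.sum_congr rfl fun K _ => Finset.sum_congr rfl fun L _ => ?_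
        rw [m.area_comm, m.dst_comm]
      simp_rw [mul_add, Finset.sum_add_distrib]
      rw [e, ← two_mul, mul_assoc]
      refine mul_le_mul_of_nonneg_left ?_ (by norm_num)
      rw [Finset.mul_sum]
      refine Finset.sum_le_sum fun K _ => ?_
      rw [← Finset.sum_mul, ← mul_assoc]
      exact mul_le_mul_of_nonneg_right (hm.regular K) (sq_nonneg _)
    refine le_trans ?_ (add_le_add_right (mul_le_mul_of_nonneg_left hsq hlam0.le) _)
    unfold Mesh.tvInt
    rw [Finset.mul_sum, Finset.mul_sum, ← Finset.sum_add_distrib]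
    refine Finset.sum_le_sum fun K _ => ?_
    rw [Finset.mul_sum, Finset.mul_sum, ← Finset.sum_add_distrib]
    refine Finset.sum_le_sum fun L hL => ?_
    have hd := hm.dst_pos ((m.mem_nbrs K L).1 hL).1
    have hA := m.area_nonneg K L
    have key : |u K ^ 2 - u L ^ 2| ≤ (2 * lam)⁻¹ * (1 / m.dst K L * (u L - u K) ^ 2) +
        lam * (m.dst K L * (u K ^ 2 + u L ^ 2)) := by
      have hfac : |u K ^ 2 - u L ^ 2| = |u L - u K| * |u K + u L| := by
        rw [← abs_mul, abs_sub_comm]; congr 1; ring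
      rw [hfac]
      have h3 : (u K + u L) ^ 2 ≤ 2 * (u K ^ 2 + u L ^ 2) := by nlinarith [sq_nonneg (u K - u L)]
      have h4 : lam * (m.dst K L * (u K + u L) ^ 2) ≤
          lam * (m.dst K L * (2 * (u K ^ 2 + u L ^ 2))) := by gcongr
      set a := |u L - u K|
      set b := |u K + u L|
      have ha : (u L - u K) ^ 2 = a ^ 2 := (sq_abs _).symm
      have hb : (u K + u L) ^ 2 = b ^ 2 := (sq_abs _).symm
      rw [ha]
      rw [hb] at h4
      have h5 : a * b ≤ (2 * lam)⁻¹ * (1 / m.dst K L * a ^ 2) +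
          lam * (m.dst K L * b ^ 2) / 2 := by
        have : (2 * lam)⁻¹ * (1 / m.dst K L * a ^ 2) + lam * (m.dst K L * b ^ 2) / 2 - a * b =
          (a - lam * m.dst K L * b) ^ 2 / (2 * lam * m.dst K L) := by
          field_simp
          ring
        have h6 : 0 ≤ (a - lam * m.dst K L * b) ^ 2 / (2 * lam * m.dst K L) := by positivity
        linarith
      linarith
    calc m.area K L * |u K ^ 2 - u L ^ 2| ≤ m.area K L * _ := mul_le_mul_of_nonneg_left key hA
      _ = _ := by ring
  have hbd : ∑ b, m.barea b * |u (m.bowner b) ^ 2| ≤ (2 * lam)⁻¹ *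
      (∑ K, ∑ b ∈ m.bfaces K, m.barea b / m.bdst b * u K ^ 2) +
      lam * (2 ^ ℓ * ∑ K, m.vol K * u K ^ 2) := by
    have hsplit : ∑ b, m.barea b * |u (m.bowner b) ^ 2| =
        ∑ K, ∑ b ∈ m.bfaces K, m.barea b * u K ^ 2 := by
      classical
      rw [← Finset.sum_fiberwise (s := Finset.univ) (g := m.bowner)]
      refine Finset.sum_congr rfl fun K _ => ?_
      refine Finset.sum_congr (by ext b; simp [Mesh.mem_bfaces]) fun b hb => ?_
      rw [Mesh.mem_bfaces] at hb
      rw [hb, abs_of_nonneg (sq_nonneg _)]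
    rw [hsplit, Finset.mul_sum, Finset.mul_sum, Finset.mul_sum, ← Finset.sum_add_distrib]
    refine Finset.sum_le_sum fun K _ => ?_
    have hcone := hm.sum_barea_mul_bdst_le hΩ K
    have h2 : lam * (∑ b ∈ m.bfaces K, m.barea b * m.bdst b) * u K ^ 2 ≤
        lam * (2 ^ ℓ * m.vol K) * u K ^ 2 := by gcongr
    refine le_trans ?_ (add_le_add_right (h2.trans_eq (by ring)) _)
    rw [Finset.mul_sum, Finset.mul_sum, Finset.sum_mul, ← Finset.sum_add_distrib]
    refine Finset.sum_le_sum fun b _ => ?_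
    have hd := hm.bdst_pos b
    have hA := m.barea_nonneg b
    have key : 1 ≤ (2 * lam)⁻¹ * (1 / m.bdst b) + lam * m.bdst b := by
      have : (2 * lam)⁻¹ * (1 / m.bdst b) + lam * m.bdst b - 1 =
        ((1 - lam * m.bdst b) ^ 2 + (lam * m.bdst b) ^ 2) / (2 * lam * m.bdst b) := by
        field_simp
        ring
      have h6 : 0 ≤ ((1 - lam * m.bdst b) ^ 2 + (lam * m.bdst b) ^ 2) /
        (2 * lam * m.bdst b) := by positivity
      linarith
    calc m.barea b * u K ^ 2 = m.barea b * u K ^ 2 * 1 := by ring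
      _ ≤ m.barea b * u K ^ 2 * ((2 * lam)⁻¹ * (1 / m.bdst b) + lam * m.bdst b) := by gcongr
      _ = _ := by ring
  have hX : 0 ≤ ∑ K, m.vol K * u K ^ 2 :=
    Finset.sum_nonneg fun K _ => mul_nonneg (m.vol_nonneg K) (sq_nonneg _)
  have hclq : c * (lam * q) = 1 / 2 := by
    rw [hlam]; field_simp
  have h7 : c * m.tv (fun K => u K ^ 2) ≤ c * ((2 * lam)⁻¹ *
      (∑ K, ∑ L ∈ m.nbrs K, m.area K L / m.dst K L * (u L - u K) ^ 2 +
        ∑ K, ∑ b ∈ m.bfaces K, m.barea b / m.bdst b * u K ^ 2)) +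
      c * (lam * q) * ∑ K, m.vol K * u K ^ 2 := by
    have : m.tv (fun K => u K ^ 2) ≤ (2 * lam)⁻¹ *
      (∑ K, ∑ L ∈ m.nbrs K, m.area K L / m.dst K L * (u L - u K) ^ 2 +
        ∑ K, ∑ b ∈ m.bfaces K, m.barea b / m.bdst b * u K ^ 2) +
      lam * q * ∑ K, m.vol K * u K ^ 2 := by
      unfold Mesh.tv
      rw [hq]
      linarith
    calc _ ≤ c * _ := mul_le_mul_of_nonneg_left this hc.le
      _ = _ := by ring
  rw [hclq] at h7
  linarith

end Poincare

end TwoPhaseFV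

namespace TwoPhaseFV

/-! ### The constitutive functions -/

lemma extMobility_of_mem (M : ℝ → ℝ) {s : ℝ} (hs : s ∈ Icc (0 : ℝ) 1) : extMobility M s = M s := by
  unfold extMobility
  rw [min_eq_left hs.2, max_eq_right hs.1]

/-- `g(p) = ∫₀ᵖ 1 / ρ`. -/
noncomputable def invDensityPrimitive (ρ : ℝ → ℝ) (p : ℝ) : ℝ := ∫ ζ in (0 : ℝ)..p, 1 / ρ ζ

section Density

variable {ρ : ℝ → ℝ} {ρm ρM : ℝ}

lemma invDensityPrimitive_zero (ρ : ℝ → ℝ) : invDensityPrimitive ρ 0 = 0 := by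
  simp [invDensityPrimitive]

lemma hasDerivAt_invDensityPrimitive (hρ : Continuous ρ) (h0 : ∀ q, 0 < ρ q) (p : ℝ) :
    HasDerivAt (invDensityPrimitive ρ) (1 / ρ p) p := by
  have hc : Continuous fun ζ => 1 / ρ ζ := continuous_const.div hρ fun q => (h0 q).ne'
  exact intervalIntegral.integral_hasDerivAt_right (hc.intervalIntegrable _ _)
    hc.stronglyMeasurable.stronglyMeasurableAtFilter hc.continuousAt

lemma exists_invDensityPrimitive_sub (hρ : Continuous ρ) (h0 : ∀ q, 0 < ρ q) (a b : ℝ) :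
    ∃ c ∈ uIcc a b, b - a = ρ c * (invDensityPrimitive ρ b - invDensityPrimitive ρ a) := by
  have hlt : ∀ a b : ℝ, a < b → ∃ c ∈ uIcc a b,
      b - a = ρ c * (invDensityPrimitive ρ b - invDensityPrimitive ρ a) := by
    intro a b hab
    obtain ⟨c, hc, hc'⟩ := exists_hasDerivAt_eq_slope (invDensityPrimitive ρ) (fun p => 1 / ρ p) hab
      (fun x _ => (hasDerivAt_invDensityPrimitive hρ h0 x).continuousAt.continuousWithinAt)
      (fun x _ => hasDerivAt_invDensityPrimitive hρ h0 x)
    refine ⟨c, Ioo_subset_Icc_self.trans Icc_subset_uIcc hc, ?_⟩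
    have h1 := h0 c
    have h2 : b - a ≠ 0 := (sub_pos.2 hab).ne'
    field_simp at hc'
    linarith
  rcases lt_trichotomy a b with h | h | h
  · exact hlt a b h
  · subst h; exact ⟨a, left_mem_uIcc, by simp⟩
  · obtain ⟨c, hc, hc'⟩ := hlt b a h
    exact ⟨c, uIcc_comm b a ▸ hc, by linarith⟩

lemma invDensityPrimitive_sub (hρ : Continuous ρ) (h0 : ∀ q, 0 < ρ q) (a b : ℝ) :
    invDensityPrimitive ρ b - invDensityPrimitive ρ a = ∫ ζ in a..b, 1 / ρ ζ := by
  have hc : Continuous fun ζ => 1 / ρ ζ := continuous_const.div hρ fun q => (h0 q).ne'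
  exact intervalIntegral.integral_interval_sub_left (hc.intervalIntegrable _ _)
    (hc.intervalIntegrable _ _)

/-- The harmonic mean is what converts a jump of `invDensityPrimitive` into a jump of pressure. By
the mean value theorem it is also a value of `ρ`, so it inherits the bounds of `ρ`; both facts
persist when the pressures coincide. -/
lemma interfaceDensity_spec (hρ : Continuous ρ) (h0 : ∀ q, 0 < ρ q) (a b : ℝ) :
    (∃ c, interfaceDensity ρ a b = ρ c) ∧
      b - a = interfaceDensity ρ a b * (invDensityPrimitive ρ b - invDensityPrimitive ρ a) := by
  obtain ⟨c, -, hc⟩ := exists_invDensityPrimitive_sub hρ h0 a b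
  by_cases hab : a = b
  · subst hab
    exact ⟨⟨a, by simp [interfaceDensity]⟩, by simp⟩
  · have h1 : interfaceDensity ρ a b = ρ c := by
      have hg : invDensityPrimitive ρ b - invDensityPrimitive ρ a ≠ 0 := by
        intro h; rw [h, mul_zero] at hc
        exact hab (by linarith)
      rw [interfaceDensity, if_neg hab, ← invDensityPrimitive_sub hρ h0, hc]
      have := (h0 c).ne'
      field_simp
    exact ⟨⟨c, h1⟩, by rw [h1]; exact hc⟩

lemma interfaceDensity_comm (ρ : ℝ → ℝ) (a b : ℝ) :
    interfaceDensity ρ a b = interfaceDensity ρ b a := by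
  unfold interfaceDensity
  by_cases h : a = b
  · subst h; rfl
  · rw [if_neg h, if_neg (Ne.symm h), intervalIntegral.integral_symm]
    congr 1
    rw [show a - b = -(b - a) by ring, one_div, one_div, inv_neg]
    ring

lemma abs_invDensityPrimitive_le (hρ : Continuous ρ) (hm : 0 < ρm) (hb : ∀ q, ρm ≤ ρ q) (p : ℝ) :
    |invDensityPrimitive ρ p| ≤ |p| / ρm := by
  obtain ⟨c, -, hc⟩ := exists_invDensityPrimitive_sub hρ (fun q => hm.trans_le (hb q)) 0 p
  rw [invDensityPrimitive_zero, sub_zero, sub_zero] at hc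
  rw [le_div_iff₀ hm]
  nth_rw 2 [hc]
  rw [abs_mul, abs_of_pos (hm.trans_le (hb c)), mul_comm]
  exact mul_le_mul_of_nonneg_right (hb c) (abs_nonneg _)

/-- The derivative `1 / ρ` decreases, so the primitive is concave and lies below its tangent at `q`.
-/
lemma invDensityPrimitive_le_add (hρ : Continuous ρ) (h0 : ∀ q, 0 < ρ q) (hmono : Monotone ρ)
    (p q : ℝ) :
    ρ q * (invDensityPrimitive ρ p - invDensityPrimitive ρ q) ≤ p - q := by
  obtain ⟨c, hc, he⟩ := exists_invDensityPrimitive_sub hρ h0 q p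
  set D := invDensityPrimitive ρ p - invDensityPrimitive ρ q
  rw [he]
  rcases le_total q p with h | h
  · have hD : 0 ≤ D := by
      by_contra hneg
      push Not at hneg
      nlinarith [h0 c]
    rw [uIcc_of_le h] at hc
    exact mul_le_mul_of_nonneg_right (hmono hc.1) hD
  · have hD : D ≤ 0 := by
      by_contra hneg
      push Not at hneg
      nlinarith [h0 c]
    rw [uIcc_of_ge h] at hc
    exact mul_le_mul_of_nonpos_right (hmono hc.2) hD

/-- `H(p) = ρ(p) g(p) - p`. -/
noncomputable def entropyDensity (ρ : ℝ → ℝ) (p : ℝ) : ℝ := ρ p * invDensityPrimitive ρ p - p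

lemma entropyDensity_nonneg (hρ : Continuous ρ) (h0 : ∀ q, 0 < ρ q) (hmono : Monotone ρ) (p : ℝ) :
    0 ≤ entropyDensity ρ p := by
  have := invDensityPrimitive_le_add hρ h0 hmono 0 p
  rw [invDensityPrimitive_zero] at this
  unfold entropyDensity
  linarith

lemma entropyDensity_le (hρ : Continuous ρ) (hm : 0 < ρm) (hb : ∀ q, ρm ≤ ρ q ∧ ρ q ≤ ρM) (p : ℝ) :
    entropyDensity ρ p ≤ (ρM / ρm + 1) * |p| := by
  have h1 := abs_invDensityPrimitive_le hρ hm (fun q => (hb q).1) p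
  have h2 : ρ p * invDensityPrimitive ρ p ≤ ρM * (|p| / ρm) := by
    calc ρ p * invDensityPrimitive ρ p ≤ ρ p * |invDensityPrimitive ρ p| :=
          mul_le_mul_of_nonneg_left (le_abs_self _) (hm.le.trans (hb p).1)
      _ ≤ ρM * (|p| / ρm) := mul_le_mul (hb p).2 h1 (abs_nonneg _)
          (hm.le.trans ((hb p).1.trans (hb p).2))
  unfold entropyDensity
  have h3 := neg_abs_le p
  have : ρM * (|p| / ρm) = ρM / ρm * |p| := by ring
  linarith

/-- A discrete chain rule: the difference of the two sides is `s'` times the defect in the tangent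
inequality at `p'`. The remaining term `p * (s - s')` is kept for the capillary pressure. -/
lemma accumulation_le (hρ : Continuous ρ) (h0 : ∀ q, 0 < ρ q) (hmono : Monotone ρ)
    {p p' s s' : ℝ} (hs' : 0 ≤ s') :
    entropyDensity ρ p * s - entropyDensity ρ p' * s' + p * (s - s') ≤
      (ρ p * s - ρ p' * s') * invDensityPrimitive ρ p := by
  have := mul_le_mul_of_nonneg_left (invDensityPrimitive_le_add hρ h0 hmono p p') hs'
  unfold entropyDensity
  linarith

end Density

/-- Primitives, on `[0,1]`, of functions that are continuous there. -/
lemma hasDerivAt_primitive {f : ℝ → ℝ} (hf : ContinuousOn f (Icc 0 1)) {s : ℝ}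
    (hs : s ∈ Ioo (0 : ℝ) 1) : HasDerivAt (fun s => ∫ z in (0 : ℝ)..s, f z) (f s) s := by
  have hnhds : Icc (0 : ℝ) 1 ∈ 𝓝 s := Icc_mem_nhds hs.1 hs.2
  refine intervalIntegral.integral_hasDerivAt_right ?_ ?_ (hf.continuousAt hnhds)
  · refine (hf.mono ?_).intervalIntegrable
    rw [uIcc_of_le hs.1.le]
    exact Icc_subset_Icc_right hs.2.le
  · exact ⟨Icc 0 1, hnhds, hf.aestronglyMeasurable measurableSet_Icc⟩

lemma continuousOn_primitive_Icc {f : ℝ → ℝ} (hf : ContinuousOn f (Icc 0 1)) :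
    ContinuousOn (fun s => ∫ z in (0 : ℝ)..s, f z) (Icc 0 1) :=
  intervalIntegral.continuousOn_primitive_interval
    (by rw [uIcc_of_le zero_le_one]; exact hf.integrableOn_Icc) |>.mono
    (by rw [uIcc_of_le zero_le_one])

/-- Cauchy's mean value theorem for a primitive of `h q'`. -/
lemma exists_primitive_sub {q h : ℝ → ℝ} (hq : ContDiffOn ℝ 1 q (Icc 0 1))
    (hh : ContinuousOn h (Icc 0 1)) (hq' : ∀ s ∈ Icc (0 : ℝ) 1, derivWithin q (Icc 0 1) s ≠ 0)
    {a b : ℝ} (ha : a ∈ Icc (0 : ℝ) 1) (hb : b ∈ Icc (0 : ℝ) 1) :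
    ∃ z ∈ uIcc a b,
      (∫ x in (0 : ℝ)..b, h x * derivWithin q (Icc 0 1) x) -
        (∫ x in (0 : ℝ)..a, h x * derivWithin q (Icc 0 1) x) = h z * (q b - q a) := by
  set F := fun s => ∫ x in (0 : ℝ)..s, h x * derivWithin q (Icc 0 1) x with hF
  have hdq : ContinuousOn (derivWithin q (Icc 0 1)) (Icc 0 1) :=
    hq.continuousOn_derivWithin (uniqueDiffOn_Icc zero_lt_one) le_rfl
  have hhq : ContinuousOn (fun x => h x * derivWithin q (Icc 0 1) x) (Icc 0 1) := hh.mul hdq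
  have hlt : ∀ a b, a ∈ Icc (0 : ℝ) 1 → b ∈ Icc (0 : ℝ) 1 → a < b →
      ∃ z ∈ uIcc a b, F b - F a = h z * (q b - q a) := by
    intro a b ha hb hab
    have hIcc : Icc a b ⊆ Icc (0 : ℝ) 1 := Icc_subset_Icc ha.1 hb.2
    have hIoo : Ioo a b ⊆ Ioo (0 : ℝ) 1 := Ioo_subset_Ioo ha.1 hb.2
    obtain ⟨c, hc, hc'⟩ := exists_ratio_hasDerivAt_eq_ratio_slope F
      (fun x => h x * derivWithin q (Icc 0 1) x) hab
      ((continuousOn_primitive_Icc hhq).mono hIcc)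
      (fun x hx => hasDerivAt_primitive hhq (hIoo hx)) q (derivWithin q (Icc 0 1))
      (hq.continuousOn.mono hIcc) (fun x hx => by
        have hx' := hIoo hx
        exact ((hq.differentiableOn (by norm_num)) x
          (Ioo_subset_Icc_self hx')).hasDerivWithinAt.hasDerivAt (Icc_mem_nhds hx'.1 hx'.2))
    have hc1 : c ∈ Icc (0 : ℝ) 1 := hIcc (Ioo_subset_Icc_self hc)
    refine ⟨c, Ioo_subset_Icc_self.trans Icc_subset_uIcc hc, ?_⟩
    have : derivWithin q (Icc 0 1) c * (F b - F a - h c * (q b - q a)) = 0 := by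
      linarith
    rcases mul_eq_zero.1 this with h0 | h0
    · exact absurd h0 (hq' c hc1)
    · linarith
  rcases lt_trichotomy a b with h | h | h
  · exact hlt a b ha hb h
  · subst h; exact ⟨a, left_mem_uIcc, by simp⟩
  · obtain ⟨z, hz, hz'⟩ := hlt b a hb ha h
    exact ⟨z, uIcc_comm b a ▸ hz, by simp only [hF] at hz' ⊢; linarith⟩

/-- The primitive of a decreasing function is concave. -/
lemma primitive_sub_le {f : ℝ → ℝ} (hf : ContinuousOn f (Icc 0 1)) (hanti : AntitoneOn f (Icc 0 1))
    {a b : ℝ} (ha : a ∈ Icc (0 : ℝ) 1) (hb : b ∈ Icc (0 : ℝ) 1) :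
    (∫ x in (0 : ℝ)..b, f x) - (∫ x in (0 : ℝ)..a, f x) ≤ f a * (b - a) := by
  have key : ∀ a b, a ∈ Icc (0 : ℝ) 1 → b ∈ Icc (0 : ℝ) 1 → a < b → ∃ c ∈ Icc a b,
      (∫ x in (0 : ℝ)..b, f x) - (∫ x in (0 : ℝ)..a, f x) = f c * (b - a) := by
    intro a b ha hb hab
    obtain ⟨c, hc, hc'⟩ := exists_hasDerivAt_eq_slope (fun s => ∫ x in (0 : ℝ)..s, f x) f hab
      ((continuousOn_primitive_Icc hf).mono (Icc_subset_Icc ha.1 hb.2))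
      (fun x hx => hasDerivAt_primitive hf (Ioo_subset_Ioo ha.1 hb.2 hx))
    refine ⟨c, Ioo_subset_Icc_self hc, ?_⟩
    have : b - a ≠ 0 := (sub_pos.2 hab).ne'
    field_simp at hc'
    linarith
  rcases lt_trichotomy a b with h | h | h
  · obtain ⟨c, hc, he⟩ := key a b ha hb h
    rw [he]
    exact mul_le_mul_of_nonneg_right (hanti ha ⟨ha.1.trans hc.1, hc.2.trans hb.2⟩ hc.1)
      (sub_pos.2 h).le
  · subst h; simp
  · obtain ⟨c, hc, he⟩ := key b a hb ha h
    have := mul_le_mul_of_nonneg_right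
      (hanti ⟨hb.1.trans hc.1, hc.2.trans ha.2⟩ ha hc.2) (sub_pos.2 h).le
    linarith

namespace Data

variable {ℓ : ℕ}

/-- Explicit bounds for the coefficients. -/
structure Bounds (d : Data ℓ) (φ₀ φ₁ m₀ Mx ρm ρM : ℝ) : Prop where
  φ₀_pos : 0 < φ₀
  φ_bounds : ∀ᵐ x ∂(volume.restrict d.Ω), φ₀ ≤ d.φ x ∧ d.φ x ≤ φ₁
  m₀_pos : 0 < m₀
  le_Mtot : ∀ s ∈ Icc (0 : ℝ) 1, m₀ ≤ d.Mtot s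
  M_le : ∀ α, ∀ s ∈ Icc (0 : ℝ) 1, d.M α s ≤ Mx
  ρm_pos : 0 < ρm
  ρ_bounds : ∀ α q, ρm ≤ d.ρ α q ∧ d.ρ α q ≤ ρM

lemma Assumptions.exists_bounds {d : Data ℓ} (hd : d.Assumptions) :
    ∃ φ₀ φ₁ m₀ Mx ρm ρM : ℝ, d.Bounds φ₀ φ₁ m₀ Mx ρm ρM := by
  obtain ⟨φ₀, φ₁, h1, h2⟩ := hd.φ_bounds
  obtain ⟨m₀, h3, h4⟩ := hd.Mtot_lower
  obtain ⟨ρm, ρM, h5, h6⟩ := hd.ρ_bounds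
  refine ⟨φ₀, φ₁, m₀, max (d.M Phase.liquid 1) (d.M Phase.gas 1), ρm, ρM,
    h1, h2, h3, h4, ?_, h5, h6⟩
  intro α s hs
  have h1 : (1 : ℝ) ∈ Icc (0 : ℝ) 1 := ⟨zero_le_one, le_rfl⟩
  cases α
  · exact (hd.M_mono _ hs h1 hs.2).trans (le_max_left _ _)
  · exact (hd.M_mono _ hs h1 hs.2).trans (le_max_right _ _)

/-- Fraction of the total mobility carried by the gas, as a function of the liquid saturation. -/
noncomputable def gasFraction (d : Data ℓ) (s : ℝ) : ℝ := d.M Phase.gas (1 - s) / d.Mtot s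

/-- The primitive of `(M_g / M) p_c'`. -/
noncomputable def pcGasPrimitive (d : Data ℓ) (s : ℝ) : ℝ :=
  ∫ z in (0 : ℝ)..s, d.gasFraction z * derivWithin d.pc (Icc 0 1) z

/-- The global pressure, normalised so as to vanish on the Dirichlet boundary. -/
noncomputable def globalPressure (d : Data ℓ) (pl s : ℝ) : ℝ :=
  pl + (d.pcGasPrimitive s - d.pcGasPrimitive 1)

/-- Pressures and saturations of the two phases that are compatible with the capillary law. -/
structure IsState (d : Data ℓ) (p s : Phase → ℝ) : Prop where
  nonneg : ∀ α, 0 ≤ s α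
  sum_eq : s Phase.liquid + s Phase.gas = 1
  capillary : d.pc (s Phase.liquid) = p Phase.gas - p Phase.liquid

lemma IsState.mem_Icc {d : Data ℓ} {p s : Phase → ℝ} (h : d.IsState p s) (α : Phase) :
    s α ∈ Icc (0 : ℝ) 1 := by
  have h1 := h.nonneg Phase.liquid
  have h2 := h.nonneg Phase.gas
  have h3 := h.sum_eq
  cases α
  · exact ⟨h1, by linarith⟩
  · exact ⟨h2, by linarith⟩

lemma IsState.gas_eq {d : Data ℓ} {p s : Phase → ℝ} (h : d.IsState p s) :
    s Phase.gas = 1 - s Phase.liquid := by linarith [h.sum_eq]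

/-- The Dirichlet values form a state too, so boundary faces obey the same estimates as interior
interfaces. -/
lemma isState_boundary {d : Data ℓ} (hd : d.Assumptions) : d.IsState (fun _ => 0) boundarySat := by
  refine ⟨fun α => ?_, ?_, ?_⟩
  · cases α <;> simp [boundarySat]
  · simp [boundarySat]
  · simp [boundarySat, hd.pc_one]

end Data

/-- Upwind dissipation of one phase between two states with mobilities `a`, `a'` and pressure jump
`δ`. -/
noncomputable def upwindEnergy (a a' δ : ℝ) : ℝ := a * max (-δ) 0 ^ 2 + a' * max δ 0 ^ 2

lemma upwindEnergy_nonneg {a a' : ℝ} (ha : 0 ≤ a) (ha' : 0 ≤ a') (δ : ℝ) :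
    0 ≤ upwindEnergy a a' δ := by
  unfold upwindEnergy; positivity

lemma upwindEnergy_swap (a a' δ : ℝ) : upwindEnergy a a' δ = upwindEnergy a' a (-δ) := by
  unfold upwindEnergy; rw [neg_neg]; ring

/-- The dissipation contains `a * δ ^ 2` directly if `δ ≤ 0`, and dominates it if `a ≤ a'`. In the
remaining case the other phase has a jump `ε ≥ δ > 0`, so both phases dissipate with the primed
mobilities, whose sum is at least `m₀`. -/
lemma sq_mobility_mul_le {a a' b b' δ ε m₀ Mx : ℝ} (ha : 0 ≤ a) (ha' : 0 ≤ a') (hb : 0 ≤ b)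
    (hb' : 0 ≤ b') (haM : a ≤ Mx) (hm₀ : 0 < m₀) (hm : m₀ ≤ a' + b')
    (h : a' < a → 0 < δ → δ ≤ ε) :
    (a * δ) ^ 2 ≤ (Mx + Mx ^ 2 / m₀) * (upwindEnergy a a' δ + upwindEnergy b b' ε) := by
  have hMx : 0 ≤ Mx := ha.trans haM
  have hE1 := upwindEnergy_nonneg ha ha' δ
  have hE2 := upwindEnergy_nonneg hb hb' ε
  have hq : 0 ≤ Mx ^ 2 / m₀ := by positivity
  have simple : a * δ ^ 2 ≤ upwindEnergy a a' δ →
      (a * δ) ^ 2 ≤ (Mx + Mx ^ 2 / m₀) * (upwindEnergy a a' δ + upwindEnergy b b' ε) := by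
    intro h1
    calc (a * δ) ^ 2 = a * (a * δ ^ 2) := by ring
      _ ≤ Mx * upwindEnergy a a' δ := mul_le_mul haM h1 (by positivity) hMx
      _ ≤ _ := mul_le_mul (by linarith) (by linarith) hE1 (by positivity)
  rcases le_or_gt δ 0 with hδ | hδ
  · refine simple ?_
    unfold upwindEnergy
    rw [max_eq_left (by linarith), max_eq_right hδ]
    nlinarith
  · rcases le_or_gt a a' with haa | haa
    · refine simple ?_
      unfold upwindEnergy
      rw [max_eq_right (by linarith), max_eq_left hδ.le]
      nlinarith [sq_nonneg δ]
    · have hε := h haa hδ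
      have h1 : m₀ * δ ^ 2 ≤ upwindEnergy a a' δ + upwindEnergy b b' ε := by
        unfold upwindEnergy
        rw [max_eq_right (by linarith), max_eq_left hδ.le, max_eq_right (by linarith),
          max_eq_left (by linarith)]
        have h2 : b' * δ ^ 2 ≤ b' * ε ^ 2 := by gcongr
        nlinarith [sq_nonneg δ]
      calc (a * δ) ^ 2 = a ^ 2 * δ ^ 2 := by ring
        _ ≤ Mx ^ 2 * δ ^ 2 := by gcongr
        _ = Mx ^ 2 / m₀ * (m₀ * δ ^ 2) := by field_simp
        _ ≤ Mx ^ 2 / m₀ * (upwindEnergy a a' δ + upwindEnergy b b' ε) := by gcongr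
        _ ≤ _ := by
          refine mul_le_mul_of_nonneg_right (by linarith) (by linarith)

/-! ### Dissipation across one interface -/

namespace Data

variable {ℓ : ℕ} {d : Data ℓ} {φ₀ φ₁ m₀ Mx ρm ρM : ℝ}

/-- Upwind dissipation of one phase between two states. -/
noncomputable def phaseEnergy (d : Data ℓ) (α : Phase) (p s p' s' : Phase → ℝ) : ℝ :=
  upwindEnergy (d.M α (s α)) (d.M α (s' α)) (p' α - p α)

/-- Upwind dissipation between two states. -/
noncomputable def edgeEnergy (d : Data ℓ) (p s p' s' : Phase → ℝ) : ℝ :=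
  d.phaseEnergy Phase.liquid p s p' s' + d.phaseEnergy Phase.gas p s p' s'

lemma edgeEnergy_comm (d : Data ℓ) (p s p' s' : Phase → ℝ) :
    d.edgeEnergy p s p' s' = d.edgeEnergy p' s' p s := by
  unfold edgeEnergy phaseEnergy
  rw [upwindEnergy_swap, upwindEnergy_swap (d.M Phase.gas _)]
  simp only [neg_sub]

lemma edgeEnergy_nonneg (hd : d.Assumptions) {p s p' s' : Phase → ℝ} (h : d.IsState p s)
    (h' : d.IsState p' s') : 0 ≤ d.edgeEnergy p s p' s' :=
  add_nonneg
    (upwindEnergy_nonneg (hd.M_nonneg _ _ (h.mem_Icc _)) (hd.M_nonneg _ _ (h'.mem_Icc _)) _)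
    (upwindEnergy_nonneg (hd.M_nonneg _ _ (h.mem_Icc _)) (hd.M_nonneg _ _ (h'.mem_Icc _)) _)

lemma Bounds.le_sum (hB : d.Bounds φ₀ φ₁ m₀ Mx ρm ρM) {p s : Phase → ℝ} (h : d.IsState p s) :
    m₀ ≤ d.M Phase.liquid (s Phase.liquid) + d.M Phase.gas (s Phase.gas) := by
  rw [h.gas_eq]
  exact hB.le_Mtot _ (h.mem_Icc _)

lemma Bounds.Mx_pos (hd : d.Assumptions) (hB : d.Bounds φ₀ φ₁ m₀ Mx ρm ρM) : 0 < Mx := by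
  have h0 : (0 : ℝ) ∈ Icc (0 : ℝ) 1 := ⟨le_rfl, zero_le_one⟩
  have h1 : (1 : ℝ) ∈ Icc (0 : ℝ) 1 := ⟨zero_le_one, le_rfl⟩
  have := hB.le_Mtot 0 h0
  unfold Mtot at this
  rw [hd.M_zero, zero_add, sub_zero] at this
  exact hB.m₀_pos.trans_le (this.trans (hB.M_le _ 1 h1))

/-- Constant in the comparison of mobility-weighted pressure jumps with the dissipation. -/
noncomputable def mobConst (m₀ Mx : ℝ) : ℝ := Mx + Mx ^ 2 / m₀

lemma mobConst_pos (hd : d.Assumptions) (hB : d.Bounds φ₀ φ₁ m₀ Mx ρm ρM) : 0 < mobConst m₀ Mx := by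
  have h1 := hB.Mx_pos hd
  have h2 := hB.m₀_pos
  unfold mobConst
  positivity

/-- Pressure jumps weighted by the mobility on either side are controlled by the upwind
dissipation of both phases. -/
lemma sq_mobility_jump_le (hd : d.Assumptions) (hB : d.Bounds φ₀ φ₁ m₀ Mx ρm ρM)
    {p s p' s' : Phase → ℝ} (h : d.IsState p s) (h' : d.IsState p' s') (α : Phase) :
    (d.M α (s α) * (p' α - p α)) ^ 2 ≤ mobConst m₀ Mx * d.edgeEnergy p s p' s' := by
  have hnn : ∀ β, 0 ≤ d.M β (s β) := fun β => hd.M_nonneg β _ (h.mem_Icc β)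
  have hnn' : ∀ β, 0 ≤ d.M β (s' β) := fun β => hd.M_nonneg β _ (h'.mem_Icc β)
  have hsum := hB.le_sum h'
  have hc := h.capillary
  have hc' := h'.capillary
  have hlt : ∀ β, d.M β (s' β) < d.M β (s β) → s' β ≤ s β := by
    intro β hβ
    by_contra hcon
    push Not at hcon
    exact absurd (hd.M_mono β (h.mem_Icc β) (h'.mem_Icc β) hcon.le) (not_le.2 hβ)
  cases α
  -- A larger liquid mobility at `s` means `s'_l ≤ s_l`, hence a larger capillary pressure at `s'`,
  -- so the gas pressure jump exceeds the liquid one. The gas case is the mirror image.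
  · refine sq_mobility_mul_le (hnn _) (hnn' _) (hnn Phase.gas) (hnn' _)
      (hB.M_le _ _ (h.mem_Icc _)) hB.m₀_pos hsum fun h1 _ => ?_
    have := hd.pc_anti (h'.mem_Icc Phase.liquid) (h.mem_Icc Phase.liquid) (hlt _ h1)
    linarith
  · have := sq_mobility_mul_le (hnn Phase.gas) (hnn' _) (hnn Phase.liquid) (hnn' _)
      (hB.M_le Phase.gas _ (h.mem_Icc _)) hB.m₀_pos (hsum.trans_eq (add_comm _ _))
      (δ := p' Phase.gas - p Phase.gas) (ε := p' Phase.liquid - p Phase.liquid) fun h1 _ => by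
        have h2 := hlt _ h1
        rw [h.gas_eq, h'.gas_eq] at h2
        have := hd.pc_anti (h.mem_Icc Phase.liquid) (h'.mem_Icc Phase.liquid) (by linarith)
        linarith
    refine this.trans_eq ?_
    unfold mobConst edgeEnergy phaseEnergy
    rw [add_comm (upwindEnergy _ _ _)]

lemma sq_mobility_jump_le' (hd : d.Assumptions) (hB : d.Bounds φ₀ φ₁ m₀ Mx ρm ρM)
    {p s p' s' : Phase → ℝ} (h : d.IsState p s) (h' : d.IsState p' s') (α : Phase) :
    (d.M α (s' α) * (p' α - p α)) ^ 2 ≤ mobConst m₀ Mx * d.edgeEnergy p s p' s' := by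
  rw [edgeEnergy_comm]
  refine le_trans (le_of_eq ?_) (sq_mobility_jump_le hd hB h' h α)
  ring

lemma continuousOn_gas (hd : d.Assumptions) :
    ContinuousOn (fun s => d.M Phase.gas (1 - s)) (Icc 0 1) :=
  (hd.M_cont Phase.gas).comp (by fun_prop) fun s hs => ⟨by linarith [hs.2], by linarith [hs.1]⟩

lemma continuousOn_Mtot (hd : d.Assumptions) : ContinuousOn d.Mtot (Icc 0 1) :=
  (hd.M_cont Phase.liquid).add (continuousOn_gas hd)

lemma Mtot_pos (hd : d.Assumptions) {s : ℝ} (hs : s ∈ Icc (0 : ℝ) 1) : 0 < d.Mtot s := by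
  obtain ⟨m₀, h0, h1⟩ := hd.Mtot_lower
  exact h0.trans_le (h1 s hs)

lemma continuousOn_gasFraction (hd : d.Assumptions) : ContinuousOn d.gasFraction (Icc 0 1) :=
  (continuousOn_gas hd).div (continuousOn_Mtot hd) fun _ hs => (Mtot_pos hd hs).ne'

lemma continuousOn_derivWithin_pc (hd : d.Assumptions) :
    ContinuousOn (derivWithin d.pc (Icc 0 1)) (Icc 0 1) :=
  hd.pc_smooth.continuousOn_derivWithin (uniqueDiffOn_Icc zero_lt_one) le_rfl

lemma derivWithin_pc_ne_zero (hd : d.Assumptions) {s : ℝ} (hs : s ∈ Icc (0 : ℝ) 1) :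
    derivWithin d.pc (Icc 0 1) s ≠ 0 := by
  obtain ⟨c, hc, h⟩ := hd.pc_deriv
  exact abs_pos.1 (hc.trans_le (h s hs))

/-- Between two states, the mobility at an intermediate saturation is at most one of the two
mobilities. -/
lemma sq_intermediate_jump_le (hd : d.Assumptions) (hB : d.Bounds φ₀ φ₁ m₀ Mx ρm ρM)
    {p s p' s' : Phase → ℝ} (h : d.IsState p s) (h' : d.IsState p' s') {z : ℝ}
    (hz : z ∈ uIcc (s Phase.liquid) (s' Phase.liquid)) :
    (d.M Phase.liquid z * (p' Phase.liquid - p Phase.liquid)) ^ 2 ≤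
        mobConst m₀ Mx * d.edgeEnergy p s p' s' ∧
      (d.M Phase.gas (1 - z) * (p' Phase.gas - p Phase.gas)) ^ 2 ≤
        mobConst m₀ Mx * d.edgeEnergy p s p' s' := by
  have hl := h.mem_Icc Phase.liquid
  have hl' := h'.mem_Icc Phase.liquid
  have hz01 : z ∈ Icc (0 : ℝ) 1 := uIcc_subset_Icc hl hl' hz
  have hz01' : 1 - z ∈ Icc (0 : ℝ) 1 := ⟨by linarith [hz01.2], by linarith [hz01.1]⟩
  have aux : ∀ α, ∀ x ∈ Icc (0 : ℝ) 1, (x ≤ s α ∨ x ≤ s' α) →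
      (d.M α x * (p' α - p α)) ^ 2 ≤ mobConst m₀ Mx * d.edgeEnergy p s p' s' := by
    intro α x hx hor
    have h0 := hd.M_nonneg α x hx
    rcases hor with h1 | h1
    · refine le_trans ?_ (sq_mobility_jump_le hd hB h h' α)
      rw [mul_pow, mul_pow]
      have := hd.M_mono α hx (h.mem_Icc α) h1
      gcongr
    · refine le_trans ?_ (sq_mobility_jump_le' hd hB h h' α)
      rw [mul_pow, mul_pow]
      have := hd.M_mono α hx (h'.mem_Icc α) h1
      gcongr
  refine ⟨aux Phase.liquid z hz01 ?_, aux Phase.gas (1 - z) hz01' ?_⟩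
  · rcases le_total (s Phase.liquid) (s' Phase.liquid) with hle | hle
    · rw [uIcc_of_le hle] at hz
      exact Or.inr hz.2
    · rw [uIcc_of_ge hle] at hz
      exact Or.inl hz.2
  · rw [h.gas_eq, h'.gas_eq]
    rcases le_total (s Phase.liquid) (s' Phase.liquid) with hle | hle
    · rw [uIcc_of_le hle] at hz
      exact Or.inl (by linarith [hz.1])
    · rw [uIcc_of_ge hle] at hz
      exact Or.inr (by linarith [hz.1])

/-- At a single intermediate saturation `z`, Cauchy's mean value theorem and the capillary law give:
total mobility at `z` times the jump of global pressure equals `M_l(z)` times the liquid jump plus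
`M_g(1 - z)` times the gas jump. Both weighted jumps are bounded by the dissipation, and the total
mobility is at least `m₀`. -/
lemma sq_globalPressure_jump_le (hd : d.Assumptions) (hB : d.Bounds φ₀ φ₁ m₀ Mx ρm ρM)
    {p s p' s' : Phase → ℝ} (h : d.IsState p s) (h' : d.IsState p' s') :
    (d.globalPressure (p' Phase.liquid) (s' Phase.liquid) -
        d.globalPressure (p Phase.liquid) (s Phase.liquid)) ^ 2 ≤
      4 * mobConst m₀ Mx / m₀ ^ 2 * d.edgeEnergy p s p' s' := by
  obtain ⟨z, hz, he⟩ := exists_primitive_sub hd.pc_smooth (continuousOn_gasFraction hd)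
    (fun _ hs => derivWithin_pc_ne_zero hd hs) (h.mem_Icc Phase.liquid) (h'.mem_Icc Phase.liquid)
  have hz01 : z ∈ Icc (0 : ℝ) 1 := uIcc_subset_Icc (h.mem_Icc _) (h'.mem_Icc _) hz
  obtain ⟨h1, h2⟩ := sq_intermediate_jump_le hd hB h h' hz
  set δ := d.globalPressure (p' Phase.liquid) (s' Phase.liquid) -
        d.globalPressure (p Phase.liquid) (s Phase.liquid) with hδ
  have hM := Mtot_pos hd hz01
  have hmul : d.Mtot z * δ = d.M Phase.liquid z * (p' Phase.liquid - p Phase.liquid) +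
      d.M Phase.gas (1 - z) * (p' Phase.gas - p Phase.gas) := by
    have e1 : δ = (p' Phase.liquid - p Phase.liquid) +
        d.gasFraction z * (d.pc (s' Phase.liquid) - d.pc (s Phase.liquid)) := by
      rw [← he, hδ]
      simp only [globalPressure, pcGasPrimitive]
      ring
    rw [e1, h.capillary, h'.capillary, gasFraction]
    field_simp
    unfold Mtot
    ring
  have hm₀ := hB.m₀_pos
  rw [div_mul_eq_mul_div, le_div_iff₀ (by positivity)]
  have h3 : m₀ ^ 2 * δ ^ 2 ≤ (d.Mtot z * δ) ^ 2 := by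
    rw [mul_pow]
    have := hB.le_Mtot z hz01
    gcongr
  rw [hmul] at h3
  nlinarith [sq_nonneg (d.M Phase.liquid z * (p' Phase.liquid - p Phase.liquid) -
      d.M Phase.gas (1 - z) * (p' Phase.gas - p Phase.gas))]

/-- With the weight `-M_l M_g / M`, the same mean value argument writes the jump of `𝓑` as a
difference of the two mobility-weighted pressure jumps, with coefficients `M_g / M` and `M_l / M` in
`[0,1]`. -/
lemma sq_B_jump_le (hd : d.Assumptions) (hB : d.Bounds φ₀ φ₁ m₀ Mx ρm ρM)
    {p s p' s' : Phase → ℝ} (h : d.IsState p s) (h' : d.IsState p' s') :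
    (d.B (s' Phase.liquid) - d.B (s Phase.liquid)) ^ 2 ≤
      4 * mobConst m₀ Mx * d.edgeEnergy p s p' s' := by
  obtain ⟨z, hz, he⟩ := exists_primitive_sub hd.pc_smooth
    (h := fun s => -(d.M Phase.liquid s * d.M Phase.gas (1 - s) / d.Mtot s))
    (((hd.M_cont Phase.liquid).mul (continuousOn_gas hd)).div (continuousOn_Mtot hd)
      fun _ hs => (Mtot_pos hd hs).ne').neg
    (fun _ hs => derivWithin_pc_ne_zero hd hs) (h.mem_Icc Phase.liquid) (h'.mem_Icc Phase.liquid)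
  have hz01 : z ∈ Icc (0 : ℝ) 1 := uIcc_subset_Icc (h.mem_Icc _) (h'.mem_Icc _) hz
  obtain ⟨h1, h2⟩ := sq_intermediate_jump_le hd hB h h' hz
  have hM := Mtot_pos hd hz01
  have hml := hd.M_nonneg Phase.liquid z hz01
  have hmg := hd.M_nonneg Phase.gas (1 - z) ⟨by linarith [hz01.2], by linarith [hz01.1]⟩
  have hBe : d.B (s' Phase.liquid) - d.B (s Phase.liquid) =
      d.M Phase.gas (1 - z) / d.Mtot z *
        (d.M Phase.liquid z * (p' Phase.liquid - p Phase.liquid)) -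
      d.M Phase.liquid z / d.Mtot z *
        (d.M Phase.gas (1 - z) * (p' Phase.gas - p Phase.gas)) := by
    have e1 : d.B (s' Phase.liquid) - d.B (s Phase.liquid) = _ := he
    rw [e1, h.capillary, h'.capillary]
    ring
  set u := d.M Phase.gas (1 - z) / d.Mtot z with hu
  set w := d.M Phase.liquid z / d.Mtot z with hw
  have hu0 : 0 ≤ u := by positivity
  have hw0 : 0 ≤ w := by positivity
  have hu1 : u ≤ 1 := by
    rw [hu, div_le_one hM]; unfold Mtot; linarith
  have hw1 : w ≤ 1 := by
    rw [hw, div_le_one hM]; unfold Mtot; linarith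
  rw [hBe]
  set X := d.M Phase.liquid z * (p' Phase.liquid - p Phase.liquid)
  set Y := d.M Phase.gas (1 - z) * (p' Phase.gas - p Phase.gas)
  have h3 : (u * X) ^ 2 ≤ X ^ 2 := by
    rw [mul_pow]
    exact mul_le_of_le_one_left (sq_nonneg _) (pow_le_one₀ hu0 hu1)
  have h4 : (w * Y) ^ 2 ≤ Y ^ 2 := by
    rw [mul_pow]
    exact mul_le_of_le_one_left (sq_nonneg _) (pow_le_one₀ hw0 hw1)
  nlinarith [sq_nonneg (u * X + w * Y)]

lemma ρ_pos (hd : d.Assumptions) (α : Phase) (q : ℝ) : 0 < d.ρ α q := by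
  obtain ⟨ρm, ρM, h1, h2⟩ := hd.ρ_bounds
  exact h1.trans_le (h2 α q).1

/-- Lower bound for the dissipation of the flux of one phase through an interface. -/
lemma massFlux_mul_ge (hd : d.Assumptions) (hB : d.Bounds φ₀ φ₁ m₀ Mx ρm ρM)
    {p s p' s' : Phase → ℝ} (h : d.IsState p s) (h' : d.IsState p' s') (α : Phase) {A δ gn G : ℝ}
    (hA : 0 ≤ A) (hδ : 0 < δ) (hgn : |gn| ≤ G) :
    A / δ * (d.phaseEnergy α p s p' s' - d.edgeEnergy p s p' s' / 4) -
        4 * mobConst m₀ Mx * (ρM * G) ^ 2 * (A * δ) ≤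
      massFlux (d.ρ α) (d.M α) A δ gn (p α) (s α) (p' α) (s' α) *
        (invDensityPrimitive (d.ρ α) (p α) - invDensityPrimitive (d.ρ α) (p' α)) := by
  obtain ⟨⟨c, hc⟩, hg⟩ := interfaceDensity_spec (hd.ρ_smooth α).continuous (ρ_pos hd α) (p α) (p' α)
  have hC := mobConst_pos hd hB
  have hX := sq_mobility_jump_le hd hB h h' α
  have hY := sq_mobility_jump_le' hd hB h h' α
  have hM0 := hd.M_nonneg α _ (h.mem_Icc α)
  have hM0' := hd.M_nonneg α _ (h'.mem_Icc α)
  set E := d.edgeEnergy p s p' s'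
  set C := mobConst m₀ Mx
  set r := interfaceDensity (d.ρ α) (p α) (p' α)
  have hr0 : 0 < r := by rw [hc]; exact ρ_pos hd α c
  have hrM : r ≤ ρM := by rw [hc]; exact (hB.ρ_bounds α c).2
  have hρM : 0 ≤ ρM := hr0.le.trans hrM
  have hG : 0 ≤ G := (abs_nonneg gn).trans hgn
  set D := p' α - p α with hD
  -- The interface density divides out here, so the pressure part of the flux yields exactly
  -- `phaseEnergy`, while gravity only sees mobility-weighted pressure jumps.
  have hgsub : invDensityPrimitive (d.ρ α) (p α) - invDensityPrimitive (d.ρ α) (p' α) = -D / r := by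
    rw [hg]; field_simp; ring
  rw [hgsub]
  unfold massFlux upwindFlux
  rw [extMobility_of_mem _ (h.mem_Icc α), extMobility_of_mem _ (h'.mem_Icc α)]
  have hpe : d.phaseEnergy α p s p' s' =
      (-(d.M α (s' α) * max D 0) + d.M α (s α) * max (-D) 0) * (-D) := by
    unfold phaseEnergy upwindEnergy
    rw [← hD]
    rcases le_total D 0 with h0 | h0
    · rw [max_eq_right h0, max_eq_left (by linarith)]; ring
    · rw [max_eq_left h0, max_eq_right (by linarith)]; ring
  have hsplit : (A / δ * r * (-(d.M α (s' α) * max D 0) + d.M α (s α) * max (-D) 0) +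
        A * r ^ 2 * (d.M α (s α) * max gn 0 - d.M α (s' α) * max (-gn) 0)) * (-D / r) =
      A / δ * d.phaseEnergy α p s p' s' - A * (r * (max gn 0 * (d.M α (s α) * D) -
        max (-gn) 0 * (d.M α (s' α) * D))) := by
    rw [hpe]; field_simp; ring
  rw [hsplit]
  -- The Young weights make each of the two upwind gravity terms cost `E / (8 * δ)`, that is a
  -- quarter of the edge energy per phase and a half for both phases.
  have young : ∀ k w : ℝ, 0 ≤ k → k ≤ G → w ^ 2 ≤ C * E →
      r * (k * |w|) ≤ E / (8 * δ) + 2 * C * (ρM * G) ^ 2 * δ := by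
    intro k w hk hkG hw
    have h1 : r * (k * |w|) ≤ ρM * G * |w| := by
      calc r * (k * |w|) ≤ ρM * (G * |w|) := by gcongr
        _ = _ := by ring
    have h2 : ρM * G * |w| ≤ w ^ 2 / (8 * C * δ) + 2 * C * (ρM * G) ^ 2 * δ := by
      rw [← sq_abs w]
      have : |w| ^ 2 / (8 * C * δ) + 2 * C * (ρM * G) ^ 2 * δ - ρM * G * |w| =
          (|w| - 4 * C * δ * (ρM * G)) ^ 2 / (8 * C * δ) := by
        field_simp
        ring
      have h3 : 0 ≤ (|w| - 4 * C * δ * (ρM * G)) ^ 2 / (8 * C * δ) := by positivity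
      linarith
    have h4 : w ^ 2 / (8 * C * δ) ≤ E / (8 * δ) := by
      rw [div_le_div_iff₀ (by positivity) (by positivity)]
      nlinarith
    linarith
  have hk1 : max gn 0 ≤ G := max_le ((le_abs_self _).trans hgn) hG
  have hk2 : max (-gn) 0 ≤ G := max_le ((neg_le_abs _).trans hgn) hG
  have y1 := young (max gn 0) _ (le_max_right _ _) hk1 hX
  have y2 := young (max (-gn) 0) _ (le_max_right _ _) hk2 hY
  have hgrav : r * (max gn 0 * (d.M α (s α) * D) - max (-gn) 0 * (d.M α (s' α) * D)) ≤
      E / (4 * δ) + 4 * C * (ρM * G) ^ 2 * δ := by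
    have i1 : max gn 0 * (d.M α (s α) * D) ≤ max gn 0 * |d.M α (s α) * D| := by
      gcongr; exact le_abs_self _
    have i2 : -(max (-gn) 0 * (d.M α (s' α) * D)) ≤ max (-gn) 0 * |d.M α (s' α) * D| := by
      rw [← mul_neg]; gcongr; exact neg_le_abs _
    have i3 : r * (max gn 0 * (d.M α (s α) * D) - max (-gn) 0 * (d.M α (s' α) * D)) ≤
        r * (max gn 0 * |d.M α (s α) * D|) + r * (max (-gn) 0 * |d.M α (s' α) * D|) := by
      rw [← mul_add]; gcongr; linarith
    have e : E / (4 * δ) = E / (8 * δ) + E / (8 * δ) := by field_simp; ring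
    linarith
  have := mul_le_mul_of_nonneg_left hgrav hA
  have e2 : A / δ * (d.phaseEnergy α p s p' s' - E / 4) - 4 * C * (ρM * G) ^ 2 * (A * δ) =
      A / δ * d.phaseEnergy α p s p' s' - A * (E / (4 * δ) + 4 * C * (ρM * G) ^ 2 * δ) := by
    field_simp
    ring
  rw [e2]
  linarith

/-- Lower bound for the dissipation of the fluxes of both phases through an interface. -/
lemma sum_massFlux_mul_ge (hd : d.Assumptions) (hB : d.Bounds φ₀ φ₁ m₀ Mx ρm ρM)
    {p s p' s' : Phase → ℝ} (h : d.IsState p s) (h' : d.IsState p' s') {A δ gn G : ℝ}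
    (hA : 0 ≤ A) (hδ : 0 < δ) (hgn : |gn| ≤ G) :
    A / δ * (d.edgeEnergy p s p' s' / 2) - 8 * mobConst m₀ Mx * (ρM * G) ^ 2 * (A * δ) ≤
      massFlux (d.ρ Phase.liquid) (d.M Phase.liquid) A δ gn (p Phase.liquid) (s Phase.liquid)
          (p' Phase.liquid) (s' Phase.liquid) *
        (invDensityPrimitive (d.ρ Phase.liquid) (p Phase.liquid) -
          invDensityPrimitive (d.ρ Phase.liquid) (p' Phase.liquid)) +
      massFlux (d.ρ Phase.gas) (d.M Phase.gas) A δ gn (p Phase.gas) (s Phase.gas)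
          (p' Phase.gas) (s' Phase.gas) *
        (invDensityPrimitive (d.ρ Phase.gas) (p Phase.gas) -
          invDensityPrimitive (d.ρ Phase.gas) (p' Phase.gas)) := by
  have h1 := massFlux_mul_ge hd hB h h' Phase.liquid hA hδ hgn
  have h2 := massFlux_mul_ge hd hB h h' Phase.gas hA hδ hgn
  refine le_trans (le_of_eq ?_) (add_le_add h1 h2)
  unfold edgeEnergy
  ring

/-- Fluxes are conservative. -/
lemma massFlux_antisymm (ρ M : ℝ → ℝ) (A δ gn p s p' s' : ℝ) :
    massFlux ρ M A δ (-gn) p' s' p s = -massFlux ρ M A δ gn p s p' s' := by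
  unfold massFlux upwindFlux
  rw [interfaceDensity_comm ρ p' p, neg_neg, neg_sub, ← neg_sub p' p]
  ring

/-! ### Entropy -/

/-- Free energy of a state. -/
noncomputable def stateEntropy (d : Data ℓ) (p s : Phase → ℝ) : ℝ :=
  entropyDensity (d.ρ Phase.liquid) (p Phase.liquid) * s Phase.liquid +
    entropyDensity (d.ρ Phase.gas) (p Phase.gas) * s Phase.gas -
    ∫ z in (0 : ℝ)..s Phase.liquid, d.pc z

/-- The leftover terms `p_α (s_α - s'_α)` combine, by the capillary law at the new state, into
`p_c(s_l) (s'_l - s_l)`, which bounds the increment of `-∫ p_c` by concavity of the primitive.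
Nothing capillary is asked of the old state, because the initial data need not satisfy that law. -/
lemma stateEntropy_sub_le (hd : d.Assumptions) {p s p' s' : Phase → ℝ} (h : d.IsState p s)
    (hs' : ∀ α, 0 ≤ s' α) (hsum' : s' Phase.liquid + s' Phase.gas = 1) :
    d.stateEntropy p s - d.stateEntropy p' s' ≤
      (d.ρ Phase.liquid (p Phase.liquid) * s Phase.liquid -
          d.ρ Phase.liquid (p' Phase.liquid) * s' Phase.liquid) *
        invDensityPrimitive (d.ρ Phase.liquid) (p Phase.liquid) +
      (d.ρ Phase.gas (p Phase.gas) * s Phase.gas -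
          d.ρ Phase.gas (p' Phase.gas) * s' Phase.gas) *
        invDensityPrimitive (d.ρ Phase.gas) (p Phase.gas) := by
  have h1 := accumulation_le (hd.ρ_smooth Phase.liquid).continuous (ρ_pos hd _) (hd.ρ_mono _)
    (p := p Phase.liquid) (p' := p' Phase.liquid) (s := s Phase.liquid) (hs' Phase.liquid)
  have h2 := accumulation_le (hd.ρ_smooth Phase.gas).continuous (ρ_pos hd _) (hd.ρ_mono _)
    (p := p Phase.gas) (p' := p' Phase.gas) (s := s Phase.gas) (hs' Phase.gas)
  have hl' : s' Phase.liquid ∈ Icc (0 : ℝ) 1 := by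
    have := hs' Phase.gas
    exact ⟨hs' _, by linarith⟩
  have h3 := primitive_sub_le hd.pc_smooth.continuousOn hd.pc_anti (h.mem_Icc Phase.liquid) hl'
  have h4 : p Phase.liquid * (s Phase.liquid - s' Phase.liquid) +
      p Phase.gas * (s Phase.gas - s' Phase.gas) =
      d.pc (s Phase.liquid) * (s' Phase.liquid - s Phase.liquid) := by
    rw [h.capillary, h.gas_eq, show s' Phase.gas = 1 - s' Phase.liquid by linarith]
    ring
  unfold stateEntropy
  linarith

lemma primitive_pc_mem (hd : d.Assumptions) {s : ℝ} (hs : s ∈ Icc (0 : ℝ) 1) :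
    0 ≤ ∫ z in (0 : ℝ)..s, d.pc z ∧ ∫ z in (0 : ℝ)..s, d.pc z ≤ d.pc 0 := by
  have h0 : (0 : ℝ) ∈ Icc (0 : ℝ) 1 := ⟨le_rfl, zero_le_one⟩
  constructor
  · exact intervalIntegral.integral_nonneg hs.1 fun z hz =>
      hd.pc_nonneg z ⟨hz.1, hz.2.trans hs.2⟩
  · have := primitive_sub_le hd.pc_smooth.continuousOn hd.pc_anti h0 hs
    rw [intervalIntegral.integral_same, sub_zero, sub_zero] at this
    refine this.trans ?_
    exact mul_le_of_le_one_right (hd.pc_nonneg 0 h0) hs.2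

/-- Only the term `-∫ p_c` can be negative, and on `[0,1]` the integral is at most `p_c(0)`. -/
lemma le_stateEntropy (hd : d.Assumptions) {p s : Phase → ℝ} (hs : ∀ α, s α ∈ Icc (0 : ℝ) 1) :
    -d.pc 0 ≤ d.stateEntropy p s := by
  have h1 := mul_nonneg (entropyDensity_nonneg (hd.ρ_smooth Phase.liquid).continuous (ρ_pos hd _)
    (hd.ρ_mono _) (p Phase.liquid)) (hs Phase.liquid).1
  have h2 := mul_nonneg (entropyDensity_nonneg (hd.ρ_smooth Phase.gas).continuous (ρ_pos hd _)
    (hd.ρ_mono _) (p Phase.gas)) (hs Phase.gas).1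
  have h3 := (primitive_pc_mem hd (hs Phase.liquid)).2
  unfold stateEntropy
  linarith

lemma stateEntropy_le (hd : d.Assumptions) (hB : d.Bounds φ₀ φ₁ m₀ Mx ρm ρM) {p s : Phase → ℝ}
    (hs : ∀ α, s α ∈ Icc (0 : ℝ) 1) :
    d.stateEntropy p s ≤ (ρM / ρm + 1) * (|p Phase.liquid| + |p Phase.gas|) := by
  have aux : ∀ α, entropyDensity (d.ρ α) (p α) * s α ≤ (ρM / ρm + 1) * |p α| := fun α =>
    (mul_le_of_le_one_right (entropyDensity_nonneg (hd.ρ_smooth α).continuous (ρ_pos hd _)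
      (hd.ρ_mono _) _) (hs α).2).trans
      (entropyDensity_le (hd.ρ_smooth α).continuous hB.ρm_pos (hB.ρ_bounds α) _)
  have h3 := (primitive_pc_mem hd (hs Phase.liquid)).1
  have h1 := aux Phase.liquid
  have h2 := aux Phase.gas
  unfold stateEntropy
  rw [mul_add]
  linarith

end Data

end TwoPhaseFV

namespace TwoPhaseFV

/-! ### Mean values -/

section Average

variable {X : Type*} [MeasurableSpace X] {μ : Measure X} {S : Set X} {f : X → ℝ}

lemma sq_setAverage_le (h0 : μ S ≠ 0) (ht : μ S ≠ ∞) (hf : MemLp f 2 (μ.restrict S)) :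
    μ.real S * (⨍ x in S, f x ∂μ) ^ 2 ≤ ∫ x in S, f x ^ 2 ∂μ := by
  have : IsFiniteMeasure (μ.restrict S) := ⟨by simpa using ht.lt_top⟩
  have h := (even_two.convexOn_pow (𝕜 := ℝ)).map_set_average_le (μ := μ) (t := S) (f := f)
    (by fun_prop) isClosed_univ h0 ht (by simp) (hf.integrable one_le_two) hf.integrable_sq
  have hpos : 0 < μ.real S := ENNReal.toReal_pos h0 ht
  rw [setAverage_eq μ (fun x => f x ^ 2), smul_eq_mul] at h
  calc _ ≤ μ.real S * _ := mul_le_mul_of_nonneg_left h hpos.le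
    _ = _ := by rw [← mul_assoc, mul_inv_cancel₀ hpos.ne', one_mul]

lemma abs_setAverage_mul_le :
    μ.real S * |⨍ x in S, f x ∂μ| ≤ ∫ x in S, |f x| ∂μ := by
  rw [setAverage_eq, smul_eq_mul, abs_mul, abs_of_nonneg (by positivity), ← mul_assoc]
  have h1 := abs_integral_le_integral_abs (f := f) (μ := μ.restrict S)
  rcases eq_or_ne (μ.real S) 0 with h | h
  · rw [h]; simp only [inv_zero, mul_zero, zero_mul]
    exact integral_nonneg fun x => abs_nonneg _
  · rw [mul_inv_cancel₀ h, one_mul]; exact h1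

lemma setAverage_mem_Icc {a b : ℝ} (h0 : μ S ≠ 0) (ht : μ S ≠ ∞)
    (hf : AEStronglyMeasurable f (μ.restrict S))
    (hab : ∀ᵐ x ∂(μ.restrict S), a ≤ f x ∧ f x ≤ b) : ⨍ x in S, f x ∂μ ∈ Icc a b := by
  refine (convex_Icc a b).set_average_mem isClosed_Icc h0 ht hab ?_
  have : IsFiniteMeasure (μ.restrict S) := ⟨by simpa using ht.lt_top⟩
  refine Integrable.of_bound hf (max |a| |b|) ?_
  filter_upwards [hab] with x hx
  rw [Real.norm_eq_abs]
  exact abs_le_max_abs_abs hx.1 hx.2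

lemma setAverage_nonneg (h : ∀ᵐ x ∂(μ.restrict S), 0 ≤ f x) : 0 ≤ ⨍ x in S, f x ∂μ := by
  rw [setAverage_eq]
  exact smul_nonneg (by positivity) (integral_nonneg_of_ae h)

end Average

namespace Discretization

variable {ℓ : ℕ} {D : Discretization ℓ} {d : Data ℓ} {ξ : ℝ}
  {φ₀ φ₁ m₀ Mx ρm ρM : ℝ}

lemma dt_pos (D : Discretization ℓ) (hd : d.Assumptions) : 0 < D.dt d := by
  have := hd.T_pos
  unfold dt
  positivity

lemma sum_dt (D : Discretization ℓ) (d : Data ℓ) :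
    ∑ _n ∈ Finset.range (D.N + 1), D.dt d = d.T := by
  rw [Finset.sum_const, Finset.card_range, nsmul_eq_mul]
  unfold dt
  push_cast
  field_simp

/-- The space-time cylinder `(tⁿ, tⁿ⁺¹) × K`. -/
def cyl (D : Discretization ℓ) (d : Data ℓ) (n : ℕ) (K : Fin D.mesh.card) :
    Set (ℝ × EuclideanSpace ℝ (Fin ℓ)) :=
  Ioo ((n : ℝ) * D.dt d) (((n : ℝ) + 1) * D.dt d) ×ˢ D.mesh.cell K

lemma cyl_subset (hd : d.Assumptions) (hadm : D.mesh.Admissible d.Ω d.Γ ξ) {n : ℕ} (hn : n ≤ D.N)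
    (K : Fin D.mesh.card) : D.cyl d n K ⊆ d.QT := by
  refine prod_mono (Ioo_subset_Ioo ?_ ?_) (hadm.cell_subset K)
  · have := D.dt_pos hd
    positivity
  · unfold dt
    have h1 : (n : ℝ) ≤ D.N := by exact_mod_cast hn
    have h2 := hd.T_pos
    rw [mul_div_assoc', div_le_iff₀ (by positivity), mul_comm]
    gcongr

lemma volume_cyl (hd : d.Assumptions) (hadm : D.mesh.Admissible d.Ω d.Γ ξ) (n : ℕ)
    (K : Fin D.mesh.card) :
    volume (D.cyl d n K) = ENNReal.ofReal (D.dt d * D.mesh.vol K) := by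
  unfold cyl
  rw [Measure.volume_eq_prod, Measure.prod_prod, Real.volume_Ioo,
    hadm.volume_cell hd.Ω_bounded, ← ENNReal.ofReal_mul]
  · congr 2; ring
  · have := D.dt_pos hd
    linarith

lemma volume_cyl_ne_zero (hd : d.Assumptions) (hadm : D.mesh.Admissible d.Ω d.Γ ξ) (n : ℕ)
    (K : Fin D.mesh.card) : volume (D.cyl d n K) ≠ 0 := by
  rw [volume_cyl hd hadm]
  have := mul_pos (D.dt_pos hd) (hadm.vol_pos hd.Ω_bounded K)
  simpa using this

lemma measurableSet_cyl (hadm : D.mesh.Admissible d.Ω d.Γ ξ) (n : ℕ)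
    (K : Fin D.mesh.card) : MeasurableSet (D.cyl d n K) :=
  measurableSet_Ioo.prod (hadm.cell_open K).measurableSet

lemma disjoint_cyl (hd : d.Assumptions) (hadm : D.mesh.Admissible d.Ω d.Γ ξ) {n n' : ℕ}
    {K K' : Fin D.mesh.card} (h : (n, K) ≠ (n', K')) : Disjoint (D.cyl d n K) (D.cyl d n' K') := by
  rw [cyl, cyl, Set.disjoint_prod]
  by_cases hK : K = K'
  · left
    have hn : n ≠ n' := fun hn => h (by rw [hn, hK])
    have hdt := D.dt_pos hd
    have aux : ∀ a b : ℕ, a < b → Disjoint (Ioo ((a : ℝ) * D.dt d) (((a : ℝ) + 1) * D.dt d))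
        (Ioo ((b : ℝ) * D.dt d) (((b : ℝ) + 1) * D.dt d)) := by
      intro a b hab
      rw [Set.disjoint_left]
      rintro t ⟨-, h1⟩ ⟨h2, -⟩
      have : (a : ℝ) + 1 ≤ b := by exact_mod_cast hab
      nlinarith
    rcases lt_or_gt_of_ne hn with h1 | h1
    · exact aux _ _ h1
    · exact (aux _ _ h1).symm
  · right
    exact hadm.pairwise_disjoint_cell hK

/-- Jensen's inequality on each space-time cylinder, the cylinders being disjoint and contained in
`Q_T`. -/
lemma sum_sq_cylMean_le (hd : d.Assumptions) (hadm : D.mesh.Admissible d.Ω d.Γ ξ)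
    {f : ℝ → EuclideanSpace ℝ (Fin ℓ) → ℝ}
    (hf : MemLp (Function.uncurry f) 2 (volume.restrict d.QT)) :
    ∑ n ∈ Finset.range (D.N + 1), D.dt d * ∑ K, D.mesh.vol K * D.cylMean d f n K ^ 2 ≤
      ∫ z in d.QT, Function.uncurry f z ^ 2 := by
  have hcyl : ∀ n ∈ Finset.range (D.N + 1), ∀ K, D.dt d * (D.mesh.vol K * D.cylMean d f n K ^ 2) ≤
      ∫ z in D.cyl d n K, Function.uncurry f z ^ 2 := by
    intro n hn K
    have hn' : n ≤ D.N := Nat.lt_succ_iff.1 (Finset.mem_range.1 hn)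
    have hv := volume_cyl hd hadm n K
    have h := sq_setAverage_le (volume_cyl_ne_zero hd hadm n K) (by rw [hv]; simp)
      (hf.mono_measure (Measure.restrict_mono (cyl_subset hd hadm hn' K) le_rfl))
    refine le_trans (le_of_eq ?_) h
    rw [measureReal_def, hv, ENNReal.toReal_ofReal
      (mul_nonneg (D.dt_pos hd).le (D.mesh.vol_nonneg K)), mul_assoc]
    rfl
  calc ∑ n ∈ Finset.range (D.N + 1), D.dt d * ∑ K, D.mesh.vol K * D.cylMean d f n K ^ 2
      ≤ ∑ n ∈ Finset.range (D.N + 1), ∑ K, ∫ z in D.cyl d n K, Function.uncurry f z ^ 2 := by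
        refine Finset.sum_le_sum fun n hn => ?_
        rw [Finset.mul_sum]
        exact Finset.sum_le_sum fun K _ => hcyl n hn K
    _ = ∑ q ∈ Finset.range (D.N + 1) ×ˢ Finset.univ, ∫ z in D.cyl d q.1 q.2,
          Function.uncurry f z ^ 2 := by rw [Finset.sum_product]
    _ = ∫ z in ⋃ q ∈ Finset.range (D.N + 1) ×ˢ Finset.univ, D.cyl d q.1 q.2,
          Function.uncurry f z ^ 2 := by
        rw [integral_biUnion_finset _ (fun q _ => measurableSet_cyl hadm q.1 q.2)]
        · intro q _ q' _ hqq
          exact disjoint_cyl hd hadm hqq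
        · intro q hq
          rw [Finset.mem_product, Finset.mem_range] at hq
          exact hf.integrable_sq.mono_measure (Measure.restrict_mono
            (cyl_subset hd hadm (Nat.lt_succ_iff.1 hq.1) q.2) le_rfl)
    _ ≤ _ := by
        refine setIntegral_mono_set hf.integrable_sq (ae_of_all _ fun z => sq_nonneg _)
          (LE.le.eventuallyLE (iUnion₂_subset fun q hq => ?_))
        rw [Finset.mem_product, Finset.mem_range] at hq
        exact cyl_subset hd hadm (Nat.lt_succ_iff.1 hq.1) q.2

lemma cellMean_φ_mem (hd : d.Assumptions) (hB : d.Bounds φ₀ φ₁ m₀ Mx ρm ρM)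
    (hadm : D.mesh.Admissible d.Ω d.Γ ξ) (K : Fin D.mesh.card) :
    D.cellMean d.φ K ∈ Icc φ₀ φ₁ := by
  have hle : volume.restrict (D.mesh.cell K) ≤ volume.restrict d.Ω :=
    Measure.restrict_mono (hadm.cell_subset K) le_rfl
  exact setAverage_mem_Icc ((hadm.cell_open K).measure_pos volume (hadm.cell_nonempty K)).ne'
    (hadm.isBounded_cell hd.Ω_bounded K).measure_lt_top.ne
    (hd.φ_meas.mono_measure hle).aestronglyMeasurable (ae_mono hle hB.φ_bounds)

lemma sum_vol_mul_abs_cellMean_le (hadm : D.mesh.Admissible d.Ω d.Γ ξ)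
    {f : EuclideanSpace ℝ (Fin ℓ) → ℝ} (hf : IntegrableOn f d.Ω) :
    ∑ K, D.mesh.vol K * |D.cellMean f K| ≤ ∫ x in d.Ω, |f x| := by
  calc ∑ K, D.mesh.vol K * |D.cellMean f K| ≤ ∑ K, ∫ x in D.mesh.cell K, |f x| :=
        Finset.sum_le_sum fun K _ => abs_setAverage_mul_le
    _ = ∫ x in ⋃ K, D.mesh.cell K, |f x| := by
        rw [integral_iUnion_fintype (fun K => (hadm.cell_open K).measurableSet)
          hadm.pairwise_disjoint_cell fun K => IntegrableOn.mono_set hf.abs (hadm.cell_subset K)]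
    _ ≤ _ := setIntegral_mono_set hf.abs (ae_of_all _ fun x => abs_nonneg _)
        (LE.le.eventuallyLE (iUnion_subset hadm.cell_subset))

lemma cylMean_nonneg (hd : d.Assumptions) (hadm : D.mesh.Admissible d.Ω d.Γ ξ)
    {f : ℝ → EuclideanSpace ℝ (Fin ℓ) → ℝ} (hf : ∀ᵐ z ∂(volume.restrict d.QT), 0 ≤ f z.1 z.2)
    {n : ℕ} (hn : n ≤ D.N) (K : Fin D.mesh.card) : 0 ≤ D.cylMean d f n K :=
  setAverage_nonneg (ae_mono (Measure.restrict_mono (cyl_subset hd hadm hn K) le_rfl) hf)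

lemma cylMean_sI_mem (hd : d.Assumptions) (hadm : D.mesh.Admissible d.Ω d.Γ ξ) (α : Phase)
    {n : ℕ} (hn : n ≤ D.N) (K : Fin D.mesh.card) :
    D.cylMean d (d.sI α) n K ∈ Icc (0 : ℝ) 1 := by
  have hle : volume.restrict (D.cyl d n K) ≤ volume.restrict d.QT :=
    Measure.restrict_mono (cyl_subset hd hadm hn K) le_rfl
  have ht : volume (D.cyl d n K) ≠ ∞ := by rw [volume_cyl hd hadm]; simp
  exact setAverage_mem_Icc (volume_cyl_ne_zero hd hadm n K) ht ((hd.sI_meas α).mono_measure hle).aestronglyMeasurable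
    (ae_mono hle (hd.sI_bounds α))

variable {p s : Phase → ℕ → Fin D.mesh.card → ℝ}

/-! ### Maximum principle -/

lemma init_s_spec (hd : d.Assumptions) (hadm : D.mesh.Admissible d.Ω d.Γ ξ)
    (hsol : D.IsSolution d p s) (K : Fin D.mesh.card) :
    (∀ α, 0 ≤ s α 0 K) ∧ s Phase.liquid 0 K + s Phase.gas 0 K = 1 := by
  have hle : volume.restrict (D.mesh.cell K) ≤ volume.restrict d.Ω :=
    Measure.restrict_mono (hadm.cell_subset K) le_rfl
  have h0 := ((hadm.cell_open K).measure_pos volume (hadm.cell_nonempty K)).ne'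
  have ht : volume (D.mesh.cell K) ≠ ∞ :=
    (hadm.isBounded_cell hd.Ω_bounded K).measure_lt_top.ne
  have : IsFiniteMeasure (volume.restrict (D.mesh.cell K)) := ⟨by simpa using ht.lt_top⟩
  have hnn : ∀ α, ∀ᵐ x ∂(volume.restrict (D.mesh.cell K)), 0 ≤ d.s0 α x :=
    fun α => ae_mono hle (hd.s0_nonneg α)
  have hsum : ∀ᵐ x ∂(volume.restrict (D.mesh.cell K)),
      d.s0 Phase.liquid x + d.s0 Phase.gas x = 1 := ae_mono hle hd.s0_sum
  have hint : ∀ α, Integrable (d.s0 α) (volume.restrict (D.mesh.cell K)) := by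
    intro α
    refine Integrable.of_bound ((hd.s0_meas α).mono_measure hle).aestronglyMeasurable 1 ?_
    filter_upwards [hnn Phase.liquid, hnn Phase.gas, hsum] with x h1 h2 h3
    rw [Real.norm_eq_abs, abs_le]
    cases α <;> constructor <;> linarith
  refine ⟨fun α => ?_, ?_⟩
  · rw [hsol.init_s]
    exact setAverage_nonneg (hnn α)
  · rw [hsol.init_s, hsol.init_s, cellMean, cellMean, setAverage_eq, setAverage_eq, ← smul_add,
      ← integral_add (hint _) (hint _), integral_congr_ae hsum, integral_const, smul_eq_mul,
      smul_eq_mul, mul_one, measureReal_restrict_apply_univ]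
    exact inv_mul_cancel₀ (ENNReal.toReal_pos h0 ht).ne'

lemma extMobility_nonneg (hd : d.Assumptions) (α : Phase) (x : ℝ) :
    0 ≤ extMobility (d.M α) x :=
  hd.M_nonneg α _ ⟨le_max_left _ _, max_le zero_le_one (min_le_right _ _)⟩

/-- For a nonpositive saturation the extended mobility is `M(0) = 0`, so nothing flows out and only
upwind inflow from the other side remains. -/
lemma massFlux_nonpos (hd : d.Assumptions) (α : Phase) {A δ gn a x b y : ℝ} (hA : 0 ≤ A)
    (hδ : 0 < δ) (hx : x ≤ 0) : massFlux (d.ρ α) (d.M α) A δ gn a x b y ≤ 0 := by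
  have h0 : extMobility (d.M α) x = 0 := by
    unfold extMobility
    rw [min_eq_left (hx.trans zero_le_one), max_eq_left hx, hd.M_zero]
  have h1 := extMobility_nonneg hd α y
  obtain ⟨⟨c, hc⟩, -⟩ := interfaceDensity_spec (hd.ρ_smooth α).continuous (Data.ρ_pos hd α) a b
  have hr : 0 < interfaceDensity (d.ρ α) a b := hc ▸ Data.ρ_pos hd α c
  unfold massFlux upwindFlux
  rw [h0]
  have e1 : 0 ≤ A / δ * interfaceDensity (d.ρ α) a b *
      (extMobility (d.M α) y * max (b - a) 0) := by positivity
  have e2 : 0 ≤ A * interfaceDensity (d.ρ α) a b ^ 2 *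
      (extMobility (d.M α) y * max (-gn) 0) := by positivity
  linarith

/-- The argument is local to one cell: at a negative saturation, accumulation is negative and fluxes
and production are nonpositive, whereas injection is nonnegative. -/
lemma saturation_nonneg (hd : d.Assumptions) (hadm : D.mesh.Admissible d.Ω d.Γ ξ)
    (hsol : D.IsSolution d p s) : ∀ n ≤ D.N + 1, ∀ α K, 0 ≤ s α n K := by
  obtain ⟨φ₀, φ₁, m₀, Mx, ρm, ρM, hB⟩ := hd.exists_bounds
  intro n
  induction n with
  | zero => exact fun _ α K => (init_s_spec hd hadm hsol K).1 α
  | succ n ih =>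
    intro hn α K
    have hn' : n ≤ D.N := by omega
    by_contra hneg
    push Not at hneg
    have hbal := hsol.balance α n hn' K
    have hold := ih (by omega) α K
    have hflux : D.outFlux d α (p α (n + 1)) (s α (n + 1)) K ≤ 0 := by
      unfold outFlux
      refine add_nonpos (Finset.sum_nonpos fun L hL => ?_) (Finset.sum_nonpos fun b _ => ?_)
      · exact massFlux_nonpos hd α (D.mesh.area_nonneg _ _)
          (hadm.dst_pos ((D.mesh.mem_nbrs K L).1 hL).1) hneg.le
      · exact massFlux_nonpos hd α (D.mesh.barea_nonneg _) (hadm.bdst_pos b) hneg.le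
    have hv := hadm.vol_pos hd.Ω_bounded K
    have hφ : 0 < D.cellMean d.φ K := hB.φ₀_pos.trans_le (cellMean_φ_mem hd hB hadm K).1
    have hρ := Data.ρ_pos hd α (p α (n + 1) K)
    have hρ' := Data.ρ_pos hd α (p α n K)
    have hdt := D.dt_pos hd
    have hfP := cylMean_nonneg hd hadm hd.fP_nonneg hn' K
    have hfI := cylMean_nonneg hd hadm hd.fI_nonneg hn' K
    have hsI := (cylMean_sI_mem hd hadm α hn' K).1
    have t1 : D.mesh.vol K * D.cellMean d.φ K * ((d.ρ α (p α (n + 1) K) * s α (n + 1) K -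
        d.ρ α (p α n K) * s α n K) / D.dt d) < 0 := by
      refine mul_neg_of_pos_of_neg (mul_pos hv hφ) (div_neg_of_neg_of_pos ?_ hdt)
      have := mul_neg_of_pos_of_neg hρ hneg
      have := mul_nonneg hρ'.le hold
      linarith
    have t2 : D.mesh.vol K * d.ρ α (p α (n + 1) K) * s α (n + 1) K *
        D.cylMean d d.fP n K ≤ 0 :=
      mul_nonpos_of_nonpos_of_nonneg (mul_neg_of_pos_of_neg (mul_pos hv hρ) hneg).le hfP
    have t3 : 0 ≤ D.mesh.vol K * d.ρ α (p α (n + 1) K) * D.cylMean d (d.sI α) n K *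
        D.cylMean d d.fI n K := by positivity
    linarith

lemma saturation_sum (hd : d.Assumptions) (hadm : D.mesh.Admissible d.Ω d.Γ ξ)
    (hsol : D.IsSolution d p s) {n : ℕ} (hn : n ≤ D.N + 1) (K : Fin D.mesh.card) :
    s Phase.liquid n K + s Phase.gas n K = 1 := by
  cases n with
  | zero => exact (init_s_spec hd hadm hsol K).2
  | succ n => exact hsol.saturation n (by omega) K

lemma saturation_mem (hd : d.Assumptions) (hadm : D.mesh.Admissible d.Ω d.Γ ξ)
    (hsol : D.IsSolution d p s) {n : ℕ} (hn : n ≤ D.N + 1) (α : Phase) (K : Fin D.mesh.card) :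
    s α n K ∈ Icc (0 : ℝ) 1 := by
  have h1 := saturation_nonneg hd hadm hsol n hn Phase.liquid K
  have h2 := saturation_nonneg hd hadm hsol n hn Phase.gas K
  have h3 := saturation_sum hd hadm hsol hn K
  cases α
  · exact ⟨h1, by linarith⟩
  · exact ⟨h2, by linarith⟩

lemma isState (hd : d.Assumptions) (hadm : D.mesh.Admissible d.Ω d.Γ ξ)
    (hsol : D.IsSolution d p s) {n : ℕ} (hn : n ≤ D.N) (K : Fin D.mesh.card) :
    d.IsState (fun α => p α (n + 1) K) (fun α => s α (n + 1) K) :=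
  ⟨fun α => saturation_nonneg hd hadm hsol (n + 1) (by omega) α K,
    hsol.saturation n hn K, hsol.capillary n hn K⟩

end Discretization

end TwoPhaseFV

/-! ### Energy estimate and bounds on total variations -/

namespace TwoPhaseFV

namespace Data

variable {ℓ : ℕ} {d : Data ℓ}

/-- The global pressure differs from each phase pressure by a continuous function of the saturation
on the compact interval `[0,1]`. -/
lemma exists_abs_le_globalPressure (hd : d.Assumptions) :
    ∃ C : ℝ, 0 ≤ C ∧ ∀ p s : Phase → ℝ, d.IsState p s →
      |p Phase.liquid| + |p Phase.gas| ≤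
        2 * |d.globalPressure (p Phase.liquid) (s Phase.liquid)| + C := by
  have hcont : ContinuousOn (fun s => d.pcGasPrimitive s - d.pcGasPrimitive 1) (Icc 0 1) :=
    (continuousOn_primitive_Icc ((continuousOn_gasFraction hd).mul
      (continuousOn_derivWithin_pc hd))).sub continuousOn_const
  obtain ⟨c, hc⟩ := isCompact_Icc.exists_bound_of_continuousOn hcont
  have hc0 : 0 ≤ c := (norm_nonneg _).trans (hc 0 ⟨le_rfl, zero_le_one⟩)
  have h0 : (0 : ℝ) ∈ Icc (0 : ℝ) 1 := ⟨le_rfl, zero_le_one⟩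
  refine ⟨2 * c + d.pc 0, by have := hd.pc_nonneg 0 h0; positivity, fun p s h => ?_⟩
  have h1 := hc _ (h.mem_Icc Phase.liquid)
  rw [Real.norm_eq_abs] at h1
  have hpc := hd.pc_nonneg _ (h.mem_Icc Phase.liquid)
  have hpc' := hd.pc_anti h0 (h.mem_Icc Phase.liquid) (h.mem_Icc Phase.liquid).1
  have h2 := h.capillary
  have e : p Phase.liquid = d.globalPressure (p Phase.liquid) (s Phase.liquid) -
    (d.pcGasPrimitive (s Phase.liquid) - d.pcGasPrimitive 1) := by unfold globalPressure; ring
  have h3 : |p Phase.liquid| ≤ |d.globalPressure (p Phase.liquid) (s Phase.liquid)| + c := by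
    nth_rw 1 [e]
    exact (abs_sub _ _).trans (by gcongr)
  have h4 : |p Phase.gas| ≤ |p Phase.liquid| + d.pc 0 := by
    have e2 : p Phase.gas = p Phase.liquid + d.pc (s Phase.liquid) := by linarith
    rw [e2]
    refine (abs_add_le _ _).trans ?_
    rw [abs_of_nonneg hpc]
    gcongr
  linarith

end Data

namespace Discretization

variable {ℓ : ℕ} {D : Discretization ℓ} {d : Data ℓ} {ξ : ℝ}
  {φ₀ φ₁ m₀ Mx ρm ρM : ℝ} {p s : Phase → ℕ → Fin D.mesh.card → ℝ}

/-- Total dissipation at time step `n`, through the interfaces and the Dirichlet faces. -/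
noncomputable def dissipation (D : Discretization ℓ) (d : Data ℓ)
    (p s : Phase → ℕ → Fin D.mesh.card → ℝ) (n : ℕ) : ℝ :=
  ∑ K, ∑ L ∈ D.mesh.nbrs K, D.mesh.area K L / D.mesh.dst K L *
      d.edgeEnergy (fun α => p α n K) (fun α => s α n K) (fun α => p α n L) (fun α => s α n L) +
    ∑ K, ∑ b ∈ D.mesh.bfaces K, D.mesh.barea b / D.mesh.bdst b *
      d.edgeEnergy (fun α => p α n K) (fun α => s α n K) (fun _ => 0) boundarySat

/-- Total free energy at time step `n`. -/
noncomputable def entropy (D : Discretization ℓ) (d : Data ℓ)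
    (p s : Phase → ℕ → Fin D.mesh.card → ℝ) (n : ℕ) : ℝ :=
  ∑ K, D.mesh.vol K * D.cellMean d.φ K *
    d.stateEntropy (fun α => p α n K) (fun α => s α n K)

/-- Global pressure in the control volumes. -/
noncomputable def gp (D : Discretization ℓ) (d : Data ℓ)
    (p s : Phase → ℕ → Fin D.mesh.card → ℝ) (n : ℕ) (K : Fin D.mesh.card) : ℝ :=
  d.globalPressure (p Phase.liquid n K) (s Phase.liquid n K)

lemma abs_inner_g_le {η : EuclideanSpace ℝ (Fin ℓ)} (hη : ‖η‖ = 1) : |inner ℝ d.g η| ≤ ‖d.g‖ := by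
  simpa [hη] using abs_real_inner_le_norm d.g η

lemma dissipation_terms_nonneg (hd : d.Assumptions) (hadm : D.mesh.Admissible d.Ω d.Γ ξ)
    (hsol : D.IsSolution d p s) {n : ℕ} (hn : n ≤ D.N) :
    (0 ≤ ∑ K, ∑ L ∈ D.mesh.nbrs K, D.mesh.area K L / D.mesh.dst K L *
      d.edgeEnergy (fun α => p α (n + 1) K) (fun α => s α (n + 1) K)
        (fun α => p α (n + 1) L) (fun α => s α (n + 1) L)) ∧
    0 ≤ ∑ K, ∑ b ∈ D.mesh.bfaces K, D.mesh.barea b / D.mesh.bdst b *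
      d.edgeEnergy (fun α => p α (n + 1) K) (fun α => s α (n + 1) K) (fun _ => 0) boundarySat := by
  constructor
  · refine Finset.sum_nonneg fun K _ => Finset.sum_nonneg fun L _ => ?_
    exact mul_nonneg (div_nonneg (D.mesh.area_nonneg K L) dist_nonneg)
      (Data.edgeEnergy_nonneg hd (isState hd hadm hsol hn K) (isState hd hadm hsol hn L))
  · refine Finset.sum_nonneg fun K _ => Finset.sum_nonneg fun b _ => ?_
    exact mul_nonneg (div_nonneg (D.mesh.barea_nonneg b) (hadm.bdst_pos b).le)
      (Data.edgeEnergy_nonneg hd (isState hd hadm hsol hn K) (Data.isState_boundary hd))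

/-- Discrete integration by parts for a conservative flux. -/
lemma sum_flux_mul (m : Mesh ℓ) {F : Fin m.card → Fin m.card → ℝ}
    (hF : ∀ K, ∀ L ∈ m.nbrs K, F L K = -F K L) (u : Fin m.card → ℝ) :
    ∑ K, ∑ L ∈ m.nbrs K, F K L * u K = (∑ K, ∑ L ∈ m.nbrs K, F K L * (u K - u L)) / 2 := by
  have h := m.sum_nbrs_comm fun K L => F K L * u L
  have h2 : ∑ K, ∑ L ∈ m.nbrs K, F L K * u K = -∑ K, ∑ L ∈ m.nbrs K, F K L * u K := by
    rw [← Finset.sum_neg_distrib]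
    refine Finset.sum_congr rfl fun K _ => ?_
    rw [← Finset.sum_neg_distrib]
    refine Finset.sum_congr rfl fun L hL => ?_
    rw [hF K L hL]; ring
  simp_rw [mul_sub, Finset.sum_sub_distrib]
  rw [h, h2]
  ring

/-- Work of the interior fluxes of phase `α` against the primitive of the inverse density. -/
noncomputable def interiorWork (D : Discretization ℓ) (d : Data ℓ) (α : Phase)
    (p s : Fin D.mesh.card → ℝ) : ℝ :=
  ∑ K, ∑ L ∈ D.mesh.nbrs K, massFlux (d.ρ α) (d.M α) (D.mesh.area K L) (D.mesh.dst K L)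
    (inner ℝ d.g (D.mesh.normal K L)) (p K) (s K) (p L) (s L) *
    (invDensityPrimitive (d.ρ α) (p K) - invDensityPrimitive (d.ρ α) (p L))

/-- Work of the fluxes through the Dirichlet faces. -/
noncomputable def boundaryWork (D : Discretization ℓ) (d : Data ℓ) (α : Phase)
    (p s : Fin D.mesh.card → ℝ) : ℝ :=
  ∑ K, ∑ b ∈ D.mesh.bfaces K, massFlux (d.ρ α) (d.M α) (D.mesh.barea b) (D.mesh.bdst b)
    (inner ℝ d.g (D.mesh.bnormal b)) (p K) (s K) 0 (boundarySat α) *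
    (invDensityPrimitive (d.ρ α) (p K) - invDensityPrimitive (d.ρ α) 0)

/-- Summation by parts: antisymmetry of the fluxes produces the jump, and the factor `1/2` because
each interface occurs in both orientations. Since the primitive vanishes at zero pressure, the
boundary term is also a jump, to the Dirichlet value. -/
lemma sum_outFlux_mul (α : Phase) (p s : Fin D.mesh.card → ℝ) :
    ∑ K, D.outFlux d α p s K * invDensityPrimitive (d.ρ α) (p K) =
      D.interiorWork d α p s / 2 + D.boundaryWork d α p s := by
  unfold interiorWork boundaryWork
  rw [← sum_flux_mul D.mesh (F := fun K L => massFlux (d.ρ α) (d.M α) (D.mesh.area K L)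
    (D.mesh.dst K L) (inner ℝ d.g (D.mesh.normal K L)) (p K) (s K) (p L) (s L))
    (u := fun K => invDensityPrimitive (d.ρ α) (p K)), ← Finset.sum_add_distrib]
  · refine Finset.sum_congr rfl fun K _ => ?_
    rw [outFlux, add_mul, Finset.sum_mul, Finset.sum_mul, invDensityPrimitive_zero, sub_zero]
  · intro K L _
    rw [D.mesh.normal_comm K L, inner_neg_right, D.mesh.area_comm L K, D.mesh.dst_comm L K,
      Data.massFlux_antisymm]

/-- Coercivity of the fluxes. -/
lemma sum_outFlux_ge (hd : d.Assumptions) (hB : d.Bounds φ₀ φ₁ m₀ Mx ρm ρM)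
    (hadm : D.mesh.Admissible d.Ω d.Γ ξ) (hξ : 0 < ξ) (hsol : D.IsSolution d p s) {n : ℕ}
    (hn : n ≤ D.N) :
    D.dissipation d p s (n + 1) / 4 -
        8 * Data.mobConst m₀ Mx * (ρM * ‖d.g‖) ^ 2 * ((ξ + 2 ^ ℓ) * (volume d.Ω).toReal) ≤
      ∑ K, D.outFlux d Phase.liquid (p Phase.liquid (n + 1)) (s Phase.liquid (n + 1)) K *
          invDensityPrimitive (d.ρ Phase.liquid) (p Phase.liquid (n + 1) K) +
        ∑ K, D.outFlux d Phase.gas (p Phase.gas (n + 1)) (s Phase.gas (n + 1)) K *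
          invDensityPrimitive (d.ρ Phase.gas) (p Phase.gas (n + 1) K) := by
  rw [sum_outFlux_mul, sum_outFlux_mul]
  obtain ⟨hEint, hEb⟩ := dissipation_terms_nonneg hd hadm hsol hn
  unfold dissipation
  set Eint := ∑ K, ∑ L ∈ D.mesh.nbrs K, D.mesh.area K L / D.mesh.dst K L *
      d.edgeEnergy (fun α => p α (n + 1) K) (fun α => s α (n + 1) K)
        (fun α => p α (n + 1) L) (fun α => s α (n + 1) L) with hEint'
  set Eb := ∑ K, ∑ b ∈ D.mesh.bfaces K, D.mesh.barea b / D.mesh.bdst b *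
      d.edgeEnergy (fun α => p α (n + 1) K) (fun α => s α (n + 1) K) (fun _ => 0) boundarySat
    with hEb'
  set C := 8 * Data.mobConst m₀ Mx * (ρM * ‖d.g‖) ^ 2
  have hC : 0 ≤ C := by
    have := Data.mobConst_pos hd hB
    positivity
  have hvol := hadm.sum_vol_le hd.Ω_bounded
  have hAd : ∑ K, ∑ L ∈ D.mesh.nbrs K, D.mesh.area K L * D.mesh.dst K L ≤
      ξ * (volume d.Ω).toReal := by
    refine (Finset.sum_le_sum fun K _ => hadm.regular K).trans ?_
    rw [← Finset.mul_sum]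
    gcongr
  have hbAd : ∑ K, ∑ b ∈ D.mesh.bfaces K, D.mesh.barea b * D.mesh.bdst b ≤
      2 ^ ℓ * (volume d.Ω).toReal := by
    refine (Finset.sum_le_sum fun K _ => hadm.sum_barea_mul_bdst_le hd.Ω_bounded K).trans ?_
    rw [← Finset.mul_sum]
    gcongr
  -- Half of this bound enters `sum_outFlux_mul`, hence the `1/4` in front of the dissipation. The
  -- gravity error is summable by the mesh regularity here, and by the cone estimate on the
  -- Dirichlet faces.
  have hint : Eint / 2 - C * ∑ K, ∑ L ∈ D.mesh.nbrs K, D.mesh.area K L * D.mesh.dst K L ≤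
      D.interiorWork d Phase.liquid (p Phase.liquid (n + 1)) (s Phase.liquid (n + 1)) +
        D.interiorWork d Phase.gas (p Phase.gas (n + 1)) (s Phase.gas (n + 1)) := by
    unfold interiorWork
    rw [hEint', Finset.mul_sum, Finset.sum_div, ← Finset.sum_sub_distrib]
    refine (Finset.sum_le_sum fun K _ => ?_).trans_eq Finset.sum_add_distrib
    rw [Finset.mul_sum, Finset.sum_div, ← Finset.sum_sub_distrib]
    refine (Finset.sum_le_sum fun L hL => ?_).trans_eq Finset.sum_add_distrib
    have hKL := ((D.mesh.mem_nbrs K L).1 hL).1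
    have := Data.sum_massFlux_mul_ge hd hB (isState hd hadm hsol hn K) (isState hd hadm hsol hn L)
      (D.mesh.area_nonneg K L) (hadm.dst_pos hKL) (abs_inner_g_le (d := d) (hadm.norm_normal hKL))
    refine le_trans (le_of_eq ?_) this
    ring
  have hbd : Eb / 2 - C * ∑ K, ∑ b ∈ D.mesh.bfaces K, D.mesh.barea b * D.mesh.bdst b ≤
      D.boundaryWork d Phase.liquid (p Phase.liquid (n + 1)) (s Phase.liquid (n + 1)) +
        D.boundaryWork d Phase.gas (p Phase.gas (n + 1)) (s Phase.gas (n + 1)) := by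
    unfold boundaryWork
    rw [hEb', Finset.mul_sum, Finset.sum_div, ← Finset.sum_sub_distrib]
    refine (Finset.sum_le_sum fun K _ => ?_).trans_eq Finset.sum_add_distrib
    rw [Finset.mul_sum, Finset.sum_div, ← Finset.sum_sub_distrib]
    refine (Finset.sum_le_sum fun b _ => ?_).trans_eq Finset.sum_add_distrib
    have := Data.sum_massFlux_mul_ge hd hB (isState hd hadm hsol hn K) (Data.isState_boundary hd)
      (D.mesh.barea_nonneg b) (hadm.bdst_pos b) (abs_inner_g_le (d := d) (hadm.bnormal_unit b))
    refine le_trans (le_of_eq ?_) this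
    ring
  have h1 := mul_le_mul_of_nonneg_left hAd hC
  have h2 := mul_le_mul_of_nonneg_left hbAd hC
  have h3 : 0 ≤ C * (ξ * (volume d.Ω).toReal) := by positivity
  have h4 : C * ((ξ + 2 ^ ℓ) * (volume d.Ω).toReal) = C * (ξ * (volume d.Ω).toReal) +
    C * (2 ^ ℓ * (volume d.Ω).toReal) := by ring
  rw [h4]
  linarith

lemma source_mul_le (hB : d.Bounds φ₀ φ₁ m₀ Mx ρm ρM) (hd : d.Assumptions) (α : Phase)
    {q σ σI fP fI : ℝ} (hσ : σ ∈ Icc (0 : ℝ) 1) (hσI : σI ∈ Icc (0 : ℝ) 1) (hfP : 0 ≤ fP)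
    (hfI : 0 ≤ fI) :
    d.ρ α q * (σI * fI - σ * fP) * invDensityPrimitive (d.ρ α) q ≤
      ρM / ρm * (fI + fP) * |q| := by
  have hρ := hB.ρ_bounds α q
  have hρ0 := Data.ρ_pos hd α q
  have h1 := abs_invDensityPrimitive_le (hd.ρ_smooth α).continuous hB.ρm_pos
    (fun q => (hB.ρ_bounds α q).1) q
  have h2 : |σI * fI - σ * fP| ≤ fI + fP := by
    have := mul_le_of_le_one_left hfI hσI.2
    have := mul_le_of_le_one_left hfP hσ.2
    have := mul_nonneg hσI.1 hfI
    have := mul_nonneg hσ.1 hfP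
    rw [abs_le]
    constructor <;> linarith
  calc _ ≤ |d.ρ α q * (σI * fI - σ * fP) * invDensityPrimitive (d.ρ α) q| := le_abs_self _
    _ = d.ρ α q * |σI * fI - σ * fP| * |invDensityPrimitive (d.ρ α) q| := by
        rw [abs_mul, abs_mul, abs_of_pos hρ0]
    _ ≤ ρM * (fI + fP) * (|q| / ρm) := by
        have : 0 ≤ ρM := hρ0.le.trans hρ.2
        gcongr
        exact hρ.2
    _ = _ := by ring

/-- The `L²` norm of the global pressure is controlled by the dissipation. -/
lemma exists_sum_sq_gp_le (hd : d.Assumptions) (hξ : 0 < ξ) :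
    ∃ C : ℝ, 0 < C ∧ ∀ D : Discretization ℓ, D.mesh.Admissible d.Ω d.Γ ξ →
      ∀ p s : Phase → ℕ → Fin D.mesh.card → ℝ, D.IsSolution d p s → ∀ n ≤ D.N,
        ∑ K, D.mesh.vol K * D.gp d p s (n + 1) K ^ 2 ≤ C * D.dissipation d p s (n + 1) := by
  obtain ⟨φ₀, φ₁, m₀, Mx, ρm, ρM, hB⟩ := hd.exists_bounds
  obtain ⟨CP, hCP, hpoinc⟩ := discrete_poincare hd.Ω_open hd.Ω_bounded hd.Ω_connected hd.Γ_meas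
    hd.Γ_subset hd.Γ_pos hξ
  have hm₀ := hB.m₀_pos
  have hmob := Data.mobConst_pos hd hB
  refine ⟨CP * (4 * Data.mobConst m₀ Mx / m₀ ^ 2), by positivity, fun D hadm p s hsol n hn => ?_⟩
  refine (hpoinc D.mesh hadm (D.gp d p s (n + 1))).trans ?_
  rw [mul_assoc]
  refine mul_le_mul_of_nonneg_left ?_ hCP.le
  unfold dissipation
  rw [mul_add, Finset.mul_sum, Finset.mul_sum]
  refine add_le_add (Finset.sum_le_sum fun K _ => ?_) (Finset.sum_le_sum fun K _ => ?_)
  · rw [Finset.mul_sum]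
    refine Finset.sum_le_sum fun L _ => ?_
    rw [mul_left_comm]
    exact mul_le_mul_of_nonneg_left (Data.sq_globalPressure_jump_le hd hB
      (isState hd hadm hsol hn K) (isState hd hadm hsol hn L))
      (div_nonneg (D.mesh.area_nonneg K L) dist_nonneg)
  · rw [Finset.mul_sum]
    refine Finset.sum_le_sum fun b _ => ?_
    rw [mul_left_comm]
    refine mul_le_mul_of_nonneg_left ?_ (div_nonneg (D.mesh.barea_nonneg b) (hadm.bdst_pos b).le)
    -- The global pressure of the Dirichlet state is zero by its normalisation, so the boundary term
    -- in the Poincaré inequality is itself a squared jump.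
    refine le_trans (le_of_eq ?_) (Data.sq_globalPressure_jump_le hd hB
      (isState hd hadm hsol hn K) (Data.isState_boundary hd))
    simp only [boundarySat, Data.globalPressure, gp]
    ring

set_option maxHeartbeats 800000 in
/-- Energy balance over one time step. -/
lemma exists_energy_step (hd : d.Assumptions) (hξ : 0 < ξ) :
    ∃ c₁ c₂ : ℝ, 0 ≤ c₁ ∧ 0 ≤ c₂ ∧ ∀ D : Discretization ℓ, D.mesh.Admissible d.Ω d.Γ ξ →
      ∀ p s : Phase → ℕ → Fin D.mesh.card → ℝ, D.IsSolution d p s → ∀ n ≤ D.N,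
        D.entropy d p s (n + 1) - D.entropy d p s n +
            D.dt d * D.dissipation d p s (n + 1) / 8 ≤
          D.dt d * (c₁ + c₂ * (∑ K, D.mesh.vol K * D.cylMean d d.fI n K ^ 2 +
            ∑ K, D.mesh.vol K * D.cylMean d d.fP n K ^ 2)) := by
  obtain ⟨φ₀, φ₁, m₀, Mx, ρm, ρM, hB⟩ := hd.exists_bounds
  obtain ⟨C', hC', hpg⟩ := Data.exists_abs_le_globalPressure hd
  obtain ⟨CP, hCP, hgp⟩ := exists_sum_sq_gp_le hd hξ
  -- With this Young parameter the L² norm of the global pressure costs one eighth of the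
  -- dissipation, out of the quarter given by coercivity.
  set lam : ℝ := 1 / (8 * CP) with hlam
  have hlam0 : 0 < lam := by positivity
  set R := ρM / ρm with hR
  have hR0 : 0 ≤ R := by
    have h1 := hB.ρ_bounds Phase.liquid 0
    exact div_nonneg (hB.ρm_pos.le.trans (h1.1.trans h1.2)) hB.ρm_pos.le
  set V := (volume d.Ω).toReal
  set Cg := 8 * Data.mobConst m₀ Mx * (ρM * ‖d.g‖) ^ 2 * ((ξ + 2 ^ ℓ) * V)
  have hCg : 0 ≤ Cg := by
    have := Data.mobConst_pos hd hB
    positivity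
  refine ⟨Cg + C' ^ 2 * V, (1 / lam + 1) * (2 * R ^ 2), by positivity, by positivity, ?_⟩
  intro D hadm p s hsol n hn
  have hdt := D.dt_pos hd
  set gl := fun K => invDensityPrimitive (d.ρ Phase.liquid) (p Phase.liquid (n + 1) K)
  set gg := fun K => invDensityPrimitive (d.ρ Phase.gas) (p Phase.gas (n + 1) K)
  set fI := fun K => D.cylMean d d.fI n K
  set fP := fun K => D.cylMean d d.fP n K
  have hcoer := sum_outFlux_ge hd hB hadm hξ hsol hn
  -- The two balances in `K` are tested with the primitives of the inverse densities and solved for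
  -- the fluxes. Young's inequality handles the sources, and the accumulation terms become an
  -- entropy increment.
  have hcell : ∀ K, D.outFlux d Phase.liquid (p Phase.liquid (n + 1)) (s Phase.liquid (n + 1)) K *
        gl K + D.outFlux d Phase.gas (p Phase.gas (n + 1)) (s Phase.gas (n + 1)) K * gg K ≤
      lam * (D.mesh.vol K * D.gp d p s (n + 1) K ^ 2) +
        (1 / lam + 1) * (2 * R ^ 2) * (D.mesh.vol K * fI K ^ 2 + D.mesh.vol K * fP K ^ 2) +
        C' ^ 2 * D.mesh.vol K -
        (D.mesh.vol K * D.cellMean d.φ K *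
            d.stateEntropy (fun α => p α (n + 1) K) (fun α => s α (n + 1) K) -
          D.mesh.vol K * D.cellMean d.φ K *
            d.stateEntropy (fun α => p α n K) (fun α => s α n K)) / D.dt d := by
    intro K
    have hst := isState hd hadm hsol hn K
    have hfI : 0 ≤ fI K := cylMean_nonneg hd hadm hd.fI_nonneg hn K
    have hfP : 0 ≤ fP K := cylMean_nonneg hd hadm hd.fP_nonneg hn K
    have hv := D.mesh.vol_nonneg K
    have hφ : 0 ≤ D.cellMean d.φ K := hB.φ₀_pos.le.trans (cellMean_φ_mem hd hB hadm K).1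
    have hsrc : ∀ α, d.ρ α (p α (n + 1) K) *
        (D.cylMean d (d.sI α) n K * fI K - s α (n + 1) K * fP K) *
        invDensityPrimitive (d.ρ α) (p α (n + 1) K) ≤ R * (fI K + fP K) * |p α (n + 1) K| :=
      fun α => source_mul_le hB hd α (hst.mem_Icc α) (cylMean_sI_mem hd hadm α hn K) hfP hfI
    have hent := Data.stateEntropy_sub_le hd hst
      (p' := fun α => p α n K) (s' := fun α => s α n K)
      (fun α => saturation_nonneg hd hadm hsol n (by omega) α K)
      (saturation_sum hd hadm hsol (by omega) K)
    have hbl := hsol.balance Phase.liquid n hn K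
    have hbg := hsol.balance Phase.gas n hn K
    have hp := hpg _ _ hst
    set Wl := d.ρ Phase.liquid (p Phase.liquid (n + 1) K) * s Phase.liquid (n + 1) K -
      d.ρ Phase.liquid (p Phase.liquid n K) * s Phase.liquid n K
    set Wg := d.ρ Phase.gas (p Phase.gas (n + 1) K) * s Phase.gas (n + 1) K -
      d.ρ Phase.gas (p Phase.gas n K) * s Phase.gas n K
    set F := R * (fI K + fP K) with hF
    set π := D.gp d p s (n + 1) K
    have hF0 : 0 ≤ F := by positivity
    have hyoung : F * (|p Phase.liquid (n + 1) K| + |p Phase.gas (n + 1) K|) ≤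
        lam * π ^ 2 + (1 / lam + 1) * (2 * R ^ 2) * (fI K ^ 2 + fP K ^ 2) + C' ^ 2 := by
      have h1 : F * (|p Phase.liquid (n + 1) K| + |p Phase.gas (n + 1) K|) ≤
          F * (2 * |π| + C') := mul_le_mul_of_nonneg_left hp hF0
      have h2 : F ^ 2 ≤ 2 * R ^ 2 * (fI K ^ 2 + fP K ^ 2) := by
        rw [hF]
        nlinarith [mul_nonneg (sq_nonneg R) (sq_nonneg (fI K - fP K))]
      have h3 : F * (2 * |π|) ≤ lam * π ^ 2 + 1 / lam * F ^ 2 := by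
        rw [← sq_abs π]
        have : lam * |π| ^ 2 + 1 / lam * F ^ 2 - F * (2 * |π|) = (lam * |π| - F) ^ 2 / lam := by
          field_simp; ring
        have h : 0 ≤ (lam * |π| - F) ^ 2 / lam := by positivity
        linarith
      have h4 : F * C' ≤ F ^ 2 + C' ^ 2 := by nlinarith [sq_nonneg (F - C'), sq_nonneg F]
      have h5 : (1 / lam + 1) * F ^ 2 ≤ (1 / lam + 1) * (2 * R ^ 2 * (fI K ^ 2 + fP K ^ 2)) := by
        gcongr
      linarith
    have hS : D.outFlux d Phase.liquid (p Phase.liquid (n + 1)) (s Phase.liquid (n + 1)) K * gl K +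
        D.outFlux d Phase.gas (p Phase.gas (n + 1)) (s Phase.gas (n + 1)) K * gg K =
        D.mesh.vol K * (d.ρ Phase.liquid (p Phase.liquid (n + 1) K) *
          (D.cylMean d (d.sI Phase.liquid) n K * fI K - s Phase.liquid (n + 1) K * fP K) * gl K +
          d.ρ Phase.gas (p Phase.gas (n + 1) K) *
          (D.cylMean d (d.sI Phase.gas) n K * fI K - s Phase.gas (n + 1) K * fP K) * gg K) -
        D.mesh.vol K * D.cellMean d.φ K * (Wl * gl K + Wg * gg K) / D.dt d := by
      have e1 := eq_sub_of_add_eq' (eq_sub_of_add_eq hbl)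
      have e2 := eq_sub_of_add_eq' (eq_sub_of_add_eq hbg)
      rw [e1, e2]
      simp only [fI, fP]
      ring
    rw [hS]
    have k1 := mul_le_mul_of_nonneg_left (add_le_add (hsrc Phase.liquid) (hsrc Phase.gas)) hv
    have k2 := mul_le_mul_of_nonneg_left hyoung hv
    have k3 := div_le_div_of_nonneg_right
      (mul_le_mul_of_nonneg_left hent (mul_nonneg hv hφ)) hdt.le
    have k4 : D.mesh.vol K * (R * (fI K + fP K) * |p Phase.liquid (n + 1) K| +
        R * (fI K + fP K) * |p Phase.gas (n + 1) K|) =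
        D.mesh.vol K * (F * (|p Phase.liquid (n + 1) K| + |p Phase.gas (n + 1) K|)) := by
      rw [hF]; ring
    rw [k4] at k1
    rw [mul_sub] at k3
    linarith
  have hsum := hcoer.trans ((Finset.sum_add_distrib (s := Finset.univ)).symm.trans_le
    (Finset.sum_le_sum fun K _ => hcell K))
  rw [Finset.sum_sub_distrib, Finset.sum_add_distrib, Finset.sum_add_distrib, ← Finset.mul_sum,
    ← Finset.mul_sum, ← Finset.mul_sum, Finset.sum_add_distrib, ← Finset.sum_div,
    Finset.sum_sub_distrib] at hsum
  have hpi := mul_le_mul_of_nonneg_left (hgp D hadm p s hsol n hn) hlam0.le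
  have hlamCP : lam * (CP * D.dissipation d p s (n + 1)) = D.dissipation d p s (n + 1) / 8 := by
    rw [hlam]; field_simp
  rw [hlamCP] at hpi
  have hvolC : C' ^ 2 * ∑ K, D.mesh.vol K ≤ C' ^ 2 * V :=
    mul_le_mul_of_nonneg_left (hadm.sum_vol_le hd.Ω_bounded) (sq_nonneg _)
  have hfin : (D.entropy d p s (n + 1) - D.entropy d p s n) / D.dt d +
      D.dissipation d p s (n + 1) / 8 ≤ Cg + C' ^ 2 * V + (1 / lam + 1) * (2 * R ^ 2) *
        (∑ K, D.mesh.vol K * fI K ^ 2 + ∑ K, D.mesh.vol K * fP K ^ 2) := by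
    unfold entropy
    linarith
  have := mul_le_mul_of_nonneg_left hfin hdt.le
  refine le_trans (le_of_eq ?_) this
  field_simp

/-- Energy estimate. -/
lemma exists_energy_estimate (hd : d.Assumptions) (hξ : 0 < ξ) :
    ∃ C : ℝ, ∀ D : Discretization ℓ, D.mesh.Admissible d.Ω d.Γ ξ →
      ∀ p s : Phase → ℕ → Fin D.mesh.card → ℝ, D.IsSolution d p s →
        ∑ n ∈ Finset.range (D.N + 1), D.dt d * D.dissipation d p s (n + 1) ≤ C := by
  obtain ⟨φ₀, φ₁, m₀, Mx, ρm, ρM, hB⟩ := hd.exists_bounds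
  obtain ⟨c₁, c₂, hc₁, hc₂, hstep⟩ := exists_energy_step hd hξ
  have hρ := hB.ρ_bounds Phase.liquid 0
  have hρm := hB.ρm_pos
  have hρM : 0 ≤ ρM := hρm.le.trans (hρ.1.trans hρ.2)
  set V := (volume d.Ω).toReal
  set P0 := (∫ x in d.Ω, |d.p0 Phase.liquid x|) + ∫ x in d.Ω, |d.p0 Phase.gas x|
  set FF := (∫ z in d.QT, Function.uncurry d.fI z ^ 2) + ∫ z in d.QT, Function.uncurry d.fP z ^ 2
  refine ⟨8 * (|φ₁| * (ρM / ρm + 1) * P0 + |φ₁| * d.pc 0 * V + (c₁ * d.T + c₂ * FF)),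
    fun D hadm p s hsol => ?_⟩
  have hφ : ∀ K, 0 ≤ D.cellMean d.φ K ∧ D.cellMean d.φ K ≤ |φ₁| := fun K =>
    ⟨hB.φ₀_pos.le.trans (cellMean_φ_mem hd hB hadm K).1,
      (cellMean_φ_mem hd hB hadm K).2.trans (le_abs_self _)⟩
  have hpc0 : 0 ≤ d.pc 0 := hd.pc_nonneg 0 ⟨le_rfl, zero_le_one⟩
  have hE0 : D.entropy d p s 0 ≤ |φ₁| * (ρM / ρm + 1) * P0 := by
    have h1 : ∀ α, ∑ K, D.mesh.vol K * |p α 0 K| ≤ ∫ x in d.Ω, |d.p0 α x| := by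
      intro α
      simp_rw [hsol.init_p]
      refine sum_vol_mul_abs_cellMean_le hadm ?_
      have : IsFiniteMeasure (volume.restrict d.Ω) :=
        ⟨by simpa using hd.Ω_bounded.measure_lt_top⟩
      exact (hd.p0_memLp α).integrable one_le_two
    have h2 := add_le_add (h1 Phase.liquid) (h1 Phase.gas)
    rw [← Finset.sum_add_distrib] at h2
    refine le_trans ?_ (mul_le_mul_of_nonneg_left h2 (by positivity))
    rw [Finset.mul_sum]
    refine Finset.sum_le_sum fun K _ => ?_
    have h3 := Data.stateEntropy_le hd hB (p := fun α => p α 0 K) (s := fun α => s α 0 K)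
      fun α => saturation_mem hd hadm hsol (by omega) α K
    have hv := D.mesh.vol_nonneg K
    have h4 : 0 ≤ (ρM / ρm + 1) * (|p Phase.liquid 0 K| + |p Phase.gas 0 K|) := by positivity
    calc _ ≤ D.mesh.vol K * D.cellMean d.φ K *
          ((ρM / ρm + 1) * (|p Phase.liquid 0 K| + |p Phase.gas 0 K|)) :=
          mul_le_mul_of_nonneg_left h3 (mul_nonneg hv (hφ K).1)
      _ ≤ D.mesh.vol K * |φ₁| *
          ((ρM / ρm + 1) * (|p Phase.liquid 0 K| + |p Phase.gas 0 K|)) :=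
          mul_le_mul_of_nonneg_right (mul_le_mul_of_nonneg_left (hφ K).2 hv) h4
      _ = _ := by ring
  have hEN : -(|φ₁| * d.pc 0 * V) ≤ D.entropy d p s (D.N + 1) := by
    have h1 : -(|φ₁| * d.pc 0 * V) ≤ ∑ K, -(|φ₁| * d.pc 0 * D.mesh.vol K) := by
      rw [Finset.sum_neg_distrib, ← Finset.mul_sum]
      have := mul_le_mul_of_nonneg_left (hadm.sum_vol_le hd.Ω_bounded)
        (mul_nonneg (abs_nonneg φ₁) hpc0)
      linarith
    refine h1.trans (Finset.sum_le_sum fun K _ => ?_)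
    have h3 := Data.le_stateEntropy hd (p := fun α => p α (D.N + 1) K)
      (s := fun α => s α (D.N + 1) K)
      fun α => saturation_mem hd hadm hsol le_rfl α K
    have hv := D.mesh.vol_nonneg K
    have h4 := mul_le_mul_of_nonneg_left h3 (mul_nonneg hv (hφ K).1)
    have h5 : D.mesh.vol K * D.cellMean d.φ K * d.pc 0 ≤ D.mesh.vol K * |φ₁| * d.pc 0 :=
      mul_le_mul_of_nonneg_right (mul_le_mul_of_nonneg_left (hφ K).2 hv) hpc0
    linarith
  -- Summing over time telescopes the entropy: its initial value is bounded by the L¹ norms of the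
  -- initial pressures, its final value from below by the capillary energy.
  have hsum := Finset.sum_le_sum fun n (hn : n ∈ Finset.range (D.N + 1)) =>
    hstep D hadm p s hsol n (Nat.lt_succ_iff.1 (Finset.mem_range.1 hn))
  rw [Finset.sum_add_distrib, Finset.sum_range_sub (fun n => D.entropy d p s n)] at hsum
  have hI := sum_sq_cylMean_le hd hadm hd.fI_memLp
  have hP := sum_sq_cylMean_le hd hadm hd.fP_memLp
  have hrhs : ∑ n ∈ Finset.range (D.N + 1), D.dt d * (c₁ + c₂ *
      (∑ K, D.mesh.vol K * D.cylMean d d.fI n K ^ 2 +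
        ∑ K, D.mesh.vol K * D.cylMean d d.fP n K ^ 2)) =
      c₁ * d.T + c₂ * (∑ n ∈ Finset.range (D.N + 1), D.dt d *
        ∑ K, D.mesh.vol K * D.cylMean d d.fI n K ^ 2 +
        ∑ n ∈ Finset.range (D.N + 1), D.dt d *
        ∑ K, D.mesh.vol K * D.cylMean d d.fP n K ^ 2) := by
    rw [← D.sum_dt d, Finset.mul_sum, ← Finset.sum_add_distrib, Finset.mul_sum,
      ← Finset.sum_add_distrib]
    refine Finset.sum_congr rfl fun n _ => ?_
    ring
  rw [hrhs, ← Finset.sum_div] at hsum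
  have := mul_le_mul_of_nonneg_left (add_le_add hI hP) hc₂
  linarith

/-- The time-integrated total variations of the global pressure and of `𝓑(s_l)` are bounded. -/
lemma exists_tvInt_estimate (hd : d.Assumptions) (hξ : 0 < ξ) :
    ∃ C : ℝ, 0 ≤ C ∧ ∀ D : Discretization ℓ, D.mesh.Admissible d.Ω d.Γ ξ →
      ∀ p s : Phase → ℕ → Fin D.mesh.card → ℝ, D.IsSolution d p s →
        ∑ n ∈ Finset.range (D.N + 1), D.dt d * (D.mesh.tvInt (D.gp d p s (n + 1)) +
          D.mesh.tvInt fun K => d.B (s Phase.liquid (n + 1) K)) ≤ C := by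
  obtain ⟨φ₀, φ₁, m₀, Mx, ρm, ρM, hB⟩ := hd.exists_bounds
  obtain ⟨CE, hCE⟩ := exists_energy_estimate hd hξ
  have hmob := Data.mobConst_pos hd hB
  have hm₀ := hB.m₀_pos
  set V := (volume d.Ω).toReal
  set C₁ := 4 * Data.mobConst m₀ Mx / m₀ ^ 2 with hC₁
  set C₂ := 4 * Data.mobConst m₀ Mx with hC₂
  have hC₁0 : 0 ≤ C₁ := by positivity
  have hC₂0 : 0 ≤ C₂ := by positivity
  refine ⟨max 0 (ξ * V * d.T + (C₁ + C₂) * CE), le_max_left _ _, fun D hadm p s hsol => ?_⟩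
  refine le_trans ?_ (le_max_right _ _)
  have hdt := D.dt_pos hd
  have hAd : ∑ K, ∑ L ∈ D.mesh.nbrs K, D.mesh.area K L * D.mesh.dst K L ≤ ξ * V := by
    refine (Finset.sum_le_sum fun K _ => hadm.regular K).trans ?_
    rw [← Finset.mul_sum]
    exact mul_le_mul_of_nonneg_left (hadm.sum_vol_le hd.Ω_bounded) hξ.le
  -- Split `|jump| ≤ d/2 + jump²/(2d)` with `d` the distance between centers. Weighted by areas, the
  -- first part is bounded by mesh regularity and the second by the dissipation, with no square root
  -- to integrate in time.
  have htv : ∀ n ≤ D.N, ∀ (c : ℝ) (u : Fin D.mesh.card → ℝ), 0 ≤ c → (∀ K L, (u L - u K) ^ 2 ≤ c *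
      d.edgeEnergy (fun α => p α (n + 1) K) (fun α => s α (n + 1) K)
        (fun α => p α (n + 1) L) (fun α => s α (n + 1) L)) →
      D.mesh.tvInt u ≤ ξ * V / 2 + c * D.dissipation d p s (n + 1) / 2 := by
    intro n hn c u hc hu
    obtain ⟨hEint, hEb⟩ := dissipation_terms_nonneg hd hadm hsol hn
    have h1 : D.mesh.tvInt u ≤
        (∑ K, ∑ L ∈ D.mesh.nbrs K, D.mesh.area K L * D.mesh.dst K L) / 2 +
        c * (∑ K, ∑ L ∈ D.mesh.nbrs K, D.mesh.area K L / D.mesh.dst K L *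
          d.edgeEnergy (fun α => p α (n + 1) K) (fun α => s α (n + 1) K)
        (fun α => p α (n + 1) L) (fun α => s α (n + 1) L)) / 2 := by
      unfold Mesh.tvInt
      rw [Finset.mul_sum, Finset.sum_div, Finset.sum_div, ← Finset.sum_add_distrib]
      refine Finset.sum_le_sum fun K _ => ?_
      rw [Finset.mul_sum, Finset.sum_div, Finset.sum_div, ← Finset.sum_add_distrib]
      refine Finset.sum_le_sum fun L hL => ?_
      have hδ := hadm.dst_pos ((D.mesh.mem_nbrs K L).1 hL).1
      have hA := D.mesh.area_nonneg K L
      have hKL := hu K L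
      set E := d.edgeEnergy (fun α => p α (n + 1) K) (fun α => s α (n + 1) K)
        (fun α => p α (n + 1) L) (fun α => s α (n + 1) L)
      have h2 : |u K - u L| ≤ D.mesh.dst K L / 2 + c * E / D.mesh.dst K L / 2 := by
        have h3 : |u K - u L| ^ 2 ≤ c * E := by rw [sq_abs]; linarith [hKL, sq_nonneg (u L - u K)]
        have h4 : |u K - u L| ^ 2 / D.mesh.dst K L ≤ c * E / D.mesh.dst K L := by gcongr
        have h5 : D.mesh.dst K L / 2 + |u K - u L| ^ 2 / D.mesh.dst K L / 2 - |u K - u L| =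
            (D.mesh.dst K L - |u K - u L|) ^ 2 / (2 * D.mesh.dst K L) := by field_simp; ring
        have h6 : 0 ≤ (D.mesh.dst K L - |u K - u L|) ^ 2 / (2 * D.mesh.dst K L) := by positivity
        linarith
      calc D.mesh.area K L * |u K - u L| ≤ _ := mul_le_mul_of_nonneg_left h2 hA
        _ = _ := by ring
    have h2 : c * (∑ K, ∑ L ∈ D.mesh.nbrs K, D.mesh.area K L / D.mesh.dst K L *
          d.edgeEnergy (fun α => p α (n + 1) K) (fun α => s α (n + 1) K)
        (fun α => p α (n + 1) L) (fun α => s α (n + 1) L)) ≤ c * D.dissipation d p s (n + 1) := by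
      refine mul_le_mul_of_nonneg_left ?_ hc
      unfold dissipation
      linarith
    linarith
  have hstep : ∀ n ∈ Finset.range (D.N + 1), D.dt d * (D.mesh.tvInt (D.gp d p s (n + 1)) +
      D.mesh.tvInt fun K => d.B (s Phase.liquid (n + 1) K)) ≤
      ξ * V * D.dt d + (C₁ + C₂) / 2 * (D.dt d * D.dissipation d p s (n + 1)) := by
    intro n hn
    have hn' : n ≤ D.N := Nat.lt_succ_iff.1 (Finset.mem_range.1 hn)
    have h1 := htv n hn' C₁ (D.gp d p s (n + 1)) hC₁0 fun K L =>
      Data.sq_globalPressure_jump_le hd hB (isState hd hadm hsol hn' K) (isState hd hadm hsol hn' L)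
    have h2 := htv n hn' C₂ (fun K => d.B (s Phase.liquid (n + 1) K)) hC₂0 fun K L =>
      Data.sq_B_jump_le hd hB (isState hd hadm hsol hn' K) (isState hd hadm hsol hn' L)
    calc _ ≤ D.dt d * (ξ * V / 2 + C₁ * D.dissipation d p s (n + 1) / 2 +
          (ξ * V / 2 + C₂ * D.dissipation d p s (n + 1) / 2)) :=
          mul_le_mul_of_nonneg_left (add_le_add h1 h2) hdt.le
      _ = _ := by ring
  refine (Finset.sum_le_sum hstep).trans ?_
  rw [Finset.sum_add_distrib, ← Finset.mul_sum, ← Finset.mul_sum, D.sum_dt d]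
  have h1 := hCE D hadm p s hsol
  have h0 : 0 ≤ ∑ n ∈ Finset.range (D.N + 1), D.dt d * D.dissipation d p s (n + 1) := by
    refine Finset.sum_nonneg fun n hn => mul_nonneg hdt.le ?_
    obtain ⟨hEint, hEb⟩ := dissipation_terms_nonneg hd hadm hsol
      (Nat.lt_succ_iff.1 (Finset.mem_range.1 hn))
    exact add_nonneg hEint hEb
  have h2 : (C₁ + C₂) / 2 * ∑ n ∈ Finset.range (D.N + 1), D.dt d * D.dissipation d p s (n + 1) ≤
      (C₁ + C₂) * CE := by
    have : 0 ≤ C₁ + C₂ := by positivity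
    nlinarith
  linarith

end Discretization

end TwoPhaseFV

namespace TwoPhaseFV

/-! ### Translates of averages of integrable functions -/

section Average

variable {E : Type*} [MeasurableSpace E] {μ : Measure E} {S : Set E}

lemma enorm_setAverage_mul_le (f : E → ℝ) (h0 : μ S ≠ 0) (ht : μ S ≠ ∞) :
    ‖⨍ x in S, f x ∂μ‖ₑ * μ S ≤ ∫⁻ x in S, ‖f x‖ₑ ∂μ := by
  refine le_trans (le_of_eq ?_) (enorm_integral_le_lintegral_enorm f)
  have hpos : 0 < μ.real S := ENNReal.toReal_pos h0 ht
  rw [setAverage_eq, enorm_smul, ← ofReal_norm (μ.real S)⁻¹, Real.norm_eq_abs,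
    abs_of_pos (inv_pos.2 hpos), mul_right_comm, ENNReal.ofReal_inv_of_pos hpos,
    ofReal_measureReal ht, ENNReal.inv_mul_cancel h0 ht, one_mul]

end Average

namespace Mesh

variable {ℓ : ℕ}

/-- The `L¹` norm of `v(· + y) - v` on the points that can be translated by `y` within `Ω`, for the
piecewise constant function `v`. -/
noncomputable def transNorm (m : Mesh ℓ) (Ω : Set (EuclideanSpace ℝ (Fin ℓ)))
    (v : Fin m.card → ℝ) (y : EuclideanSpace ℝ (Fin ℓ)) : ℝ≥0∞ :=
  ∫⁻ x in transDom Ω y, ‖m.pw v (x + y) - m.pw v x‖ₑ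

lemma diam_cell_le_size (m : Mesh ℓ) (K : Fin m.card) : Metric.diam (m.cell K) ≤ m.size :=
  le_ciSup (f := fun K => Metric.diam (m.cell K)) (Set.finite_range _).bddAbove K

/-- Translations do not increase integrals over `Ω`. -/
lemma lintegral_transDom_le {Ω : Set (EuclideanSpace ℝ (Fin ℓ))} (hΩo : IsOpen Ω)
    (f : EuclideanSpace ℝ (Fin ℓ) → ℝ≥0∞) (y : EuclideanSpace ℝ (Fin ℓ)) :
    ∫⁻ x in transDom Ω y, f (x + y) ≤ ∫⁻ x in Ω, f x := by
  rw [← lintegral_indicator hΩo.measurableSet, ← lintegral_add_right_eq_self (μ := volume) _ y,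
    ← lintegral_indicator (isOpen_transDom hΩo y).measurableSet]
  refine lintegral_mono fun x => ?_
  by_cases hx : x ∈ transDom Ω y
  · rw [indicator_of_mem hx, indicator_of_mem (hx.2 (right_mem_segment ℝ _ _))]
  · rw [indicator_of_notMem hx]
    exact zero_le

namespace Admissible

variable {m : Mesh ℓ} {Ω Γ : Set (EuclideanSpace ℝ (Fin ℓ))} {ξ : ℝ}

/-- On a cell, the average of `f` minus `g x` is the average of `(f z - g z) + (g z - g x)`, and the
last difference is at most `η` because the cell has diameter less than `δ`. -/
lemma lintegral_average_sub_le (h : m.Admissible Ω Γ ξ) (hΩ : Bornology.IsBounded Ω)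
    {f g : EuclideanSpace ℝ (Fin ℓ) → ℝ} (hf : IntegrableOn f Ω)
    {η δ : ℝ} (hgδ : ∀ x z, dist x z < δ → |g x - g z| ≤ η) (hm : m.size < δ) :
    ∫⁻ x in Ω, ‖m.pw (fun K => ⨍ z in m.cell K, f z) x - g x‖ₑ ≤
      (∫⁻ x in Ω, ‖f x - g x‖ₑ) + ENNReal.ofReal η * volume Ω := by
  have hlhs : ∀ (c : ℝ≥0∞), ∫⁻ _ in Ω, c = c * volume Ω := fun c => setLIntegral_const _ _
  rw [← hlhs, h.lintegral_eq_sum_cells, h.lintegral_eq_sum_cells, h.lintegral_eq_sum_cells,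
    ← Finset.sum_add_distrib]
  refine Finset.sum_le_sum fun K _ => ?_
  have hvol0 : volume (m.cell K) ≠ 0 :=
    ((h.cell_open K).measure_pos volume (h.cell_nonempty K)).ne'
  have hvolt : volume (m.cell K) ≠ ∞ := (h.isBounded_cell hΩ K).measure_lt_top.ne
  have hfK : IntegrableOn f (m.cell K) := hf.mono_set (h.cell_subset K)
  have hclose : ∀ x ∈ m.cell K, ∀ z ∈ m.cell K, ‖g z - g x‖ₑ ≤ ENNReal.ofReal η := by
    intro x hx z hz
    rw [← ofReal_norm, Real.norm_eq_abs]
    exact ENNReal.ofReal_le_ofReal (hgδ _ _ (((Metric.dist_le_diam_of_mem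
      (h.isBounded_cell hΩ K) hz hx).trans (m.diam_cell_le_size K)).trans_lt hm))
  set A := ∫⁻ x in m.cell K, ‖f x - g x‖ₑ
  have hA : ∀ x ∈ m.cell K, ‖m.pw (fun K => ⨍ z in m.cell K, f z) x - g x‖ₑ ≤
      (A + ENNReal.ofReal η * volume (m.cell K)) / volume (m.cell K) := by
    intro x hx
    have e : m.pw (fun K => ⨍ z in m.cell K, f z) x - g x = ⨍ z in m.cell K, (f z - g x) := by
      rw [h.pw_of_mem _ hx, setAverage_eq, setAverage_eq, integral_sub hfK
        (integrableOn_const hvolt), setIntegral_const, smul_sub, ← mul_smul,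
        inv_mul_cancel₀ (measureReal_ne_zero_iff hvolt |>.2 hvol0), one_smul]
    rw [e, ENNReal.le_div_iff_mul_le (Or.inl hvol0) (Or.inl hvolt)]
    refine (enorm_setAverage_mul_le _ hvol0 hvolt).trans ?_
    calc ∫⁻ z in m.cell K, ‖f z - g x‖ₑ
        ≤ ∫⁻ z in m.cell K, (‖f z - g z‖ₑ + ENNReal.ofReal η) := by
          refine setLIntegral_mono' (h.cell_open K).measurableSet fun z hz => ?_
          rw [← sub_add_sub_cancel (f z) (g z) (g x)]
          exact (enorm_add_le _ _).trans (by gcongr; exact hclose x hx z hz)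
      _ = _ := by
          rw [lintegral_add_right _ measurable_const, setLIntegral_const]
  calc _ ≤ ∫⁻ _ in m.cell K, (A + ENNReal.ofReal η * volume (m.cell K)) / volume (m.cell K) :=
        setLIntegral_mono' (h.cell_open K).measurableSet hA
    _ = A + ∫⁻ _ in m.cell K, ENNReal.ofReal η := by
        rw [setLIntegral_const, setLIntegral_const, ENNReal.div_mul_cancel hvol0 hvolt]

/-- Triangle inequality through `g`: comparing at `x` and at `x + y` costs the L¹ distance twice,
and translating `g` costs `η`. -/
lemma transNorm_le (h : m.Admissible Ω Γ ξ) (hΩo : IsOpen Ω) (v : Fin m.card → ℝ)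
    {g : EuclideanSpace ℝ (Fin ℓ) → ℝ} (hg : Continuous g) {η : ℝ} {y : EuclideanSpace ℝ (Fin ℓ)}
    (hgy : ∀ x, |g (x + y) - g x| ≤ η) :
    m.transNorm Ω v y ≤
      2 * (∫⁻ x in Ω, ‖m.pw v x - g x‖ₑ) + ENNReal.ofReal η * volume Ω := by
  have hmeas := h.measurable_pw v
  have hsub : transDom Ω y ⊆ Ω := fun x hx => hx.1
  calc m.transNorm Ω v y
      ≤ ∫⁻ x in transDom Ω y, ((‖m.pw v (x + y) - g (x + y)‖ₑ + ‖m.pw v x - g x‖ₑ) +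
          ENNReal.ofReal η) := by
        refine lintegral_mono fun x => ?_
        have e : m.pw v (x + y) - m.pw v x = (m.pw v (x + y) - g (x + y)) - (m.pw v x - g x) +
            (g (x + y) - g x) := by ring
        rw [e]
        refine (enorm_add_le _ _).trans (add_le_add (enorm_sub_le) ?_)
        rw [← ofReal_norm, Real.norm_eq_abs]
        exact ENNReal.ofReal_le_ofReal (hgy x)
    _ = (∫⁻ x in transDom Ω y, ‖m.pw v (x + y) - g (x + y)‖ₑ) +
          (∫⁻ x in transDom Ω y, ‖m.pw v x - g x‖ₑ) +
          ENNReal.ofReal η * volume (transDom Ω y) := by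
        rw [lintegral_add_right _ measurable_const, setLIntegral_const,
          lintegral_add_right _ (by fun_prop)]
    _ ≤ (∫⁻ x in Ω, ‖m.pw v x - g x‖ₑ) + (∫⁻ x in Ω, ‖m.pw v x - g x‖ₑ) +
          ENNReal.ofReal η * volume Ω := by
        refine add_le_add (add_le_add ?_ (lintegral_mono_set hsub))
          (mul_le_mul' le_rfl (measure_mono hsub))
        exact lintegral_transDom_le hΩo (fun x => ‖m.pw v x - g x‖ₑ) y
    _ = _ := by rw [two_mul]

end Admissible

/-- The cell averages of an integrable function are equicontinuous in `L¹`, up to the mesh size. -/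
lemma exists_transNorm_average_le {Ω : Set (EuclideanSpace ℝ (Fin ℓ))} (hΩ : Bornology.IsBounded Ω)
    (hΩo : IsOpen Ω) {f : EuclideanSpace ℝ (Fin ℓ) → ℝ} (hf : IntegrableOn f Ω) {ε : ℝ}
    (hε : 0 < ε) :
    ∃ δ : ℝ, 0 < δ ∧ ∀ (m : Mesh ℓ) (Γ : Set (EuclideanSpace ℝ (Fin ℓ))) (ξ : ℝ),
      m.Admissible Ω Γ ξ → m.size < δ → ∀ y : EuclideanSpace ℝ (Fin ℓ), ‖y‖ < δ →
        m.transNorm Ω (fun K => ⨍ z in m.cell K, f z) y ≤ ENNReal.ofReal ε := by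
  set V := (volume Ω).toReal with hV
  have hVe : volume Ω = ENNReal.ofReal V := (ENNReal.ofReal_toReal hΩ.measure_lt_top.ne).symm
  have hV0 : 0 ≤ V := ENNReal.toReal_nonneg
  -- Continuous compactly supported functions are dense in L¹ and uniformly continuous, so one `δ`
  -- serves both the cell diameters and the translations.
  obtain ⟨g, hgs, hgf, hgc, -⟩ := (integrable_indicator_iff hΩo.measurableSet |>.2
    hf).exists_hasCompactSupport_lintegral_sub_le (ε := ENNReal.ofReal (ε / 4))
    (ENNReal.ofReal_pos.2 (by positivity)).ne'
  have hgΩ : ∫⁻ x in Ω, ‖f x - g x‖ₑ ≤ ENNReal.ofReal (ε / 4) := by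
    refine le_trans (le_trans (le_of_eq ?_) (setLIntegral_le_lintegral Ω _)) hgf
    refine setLIntegral_congr_fun hΩo.measurableSet fun x hx => ?_
    simp only [indicator_of_mem hx]
  -- Budget: the approximation error `ε/4` is used twice, and the oscillation, at most `ε/6` after
  -- integration, three times.
  obtain ⟨δ, hδ, hgδ⟩ := Metric.uniformContinuous_iff.1
    (hgs.uniformContinuous_of_continuous hgc) (ε / (6 * (V + 1))) (by positivity)
  refine ⟨δ, hδ, fun m Γ ξ h hm y hy => ?_⟩
  set η := ε / (6 * (V + 1)) with hη
  have hη0 : 0 ≤ η := by positivity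
  have hηV : η * V ≤ ε / 6 := by
    rw [hη, div_mul_eq_mul_div, div_le_div_iff₀ (by positivity) (by norm_num)]
    nlinarith
  refine (h.transNorm_le hΩo _ hgc (η := η) (y := y) fun x => ?_).trans ?_
  · have := hgδ (a := x + y) (b := x) (by simpa [dist_eq_norm] using hy)
    exact this.le
  have h1 := h.lintegral_average_sub_le hΩ hf (fun x z hxz => (hgδ hxz).le) hm
  calc _ ≤ 2 * (ENNReal.ofReal (ε / 4) + ENNReal.ofReal η * volume Ω) +
        ENNReal.ofReal η * volume Ω := by gcongr; exact h1.trans (by gcongr)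
    _ = ENNReal.ofReal (2 * (ε / 4 + η * V) + η * V) := by
        have hηV0 : 0 ≤ η * V := mul_nonneg hη0 hV0
        rw [hVe, ← ENNReal.ofReal_mul hη0, ENNReal.ofReal_add (by positivity) hηV0,
          ENNReal.ofReal_mul (p := 2) (by norm_num), ENNReal.ofReal_add (by positivity) hηV0,
          ENNReal.ofReal_ofNat]
    _ ≤ ENNReal.ofReal ε := ENNReal.ofReal_le_ofReal (by linarith)

end Mesh

/-! ### Dependence of the mass densities on the global pressure and the saturation -/

/-- A bounded monotone continuous function is uniformly continuous. -/
lemma exists_abs_sub_le_of_monotone {ρ : ℝ → ℝ} (hc : Continuous ρ) (hm : Monotone ρ) {a b : ℝ}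
    (hb : ∀ q, a ≤ ρ q ∧ ρ q ≤ b) {ε : ℝ} (hε : 0 < ε) :
    ∃ δ : ℝ, 0 < δ ∧ ∀ x z, |x - z| < δ → |ρ x - ρ z| ≤ ε := by
  have htop := tendsto_atTop_ciSup hm ⟨b, by rintro _ ⟨q, rfl⟩; exact (hb q).2⟩
  have hbot := tendsto_atBot_ciInf hm ⟨a, by rintro _ ⟨q, rfl⟩; exact (hb q).1⟩
  obtain ⟨R₁, hR₁⟩ := (Metric.tendsto_nhds.1 htop (ε / 2) (by positivity)).exists_forall_of_atTop
  obtain ⟨R₂, hR₂⟩ := (Metric.tendsto_nhds.1 hbot (ε / 2) (by positivity)).exists_forall_of_atBot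
  obtain ⟨δ, hδ, h⟩ := Metric.uniformContinuousOn_iff.1
    ((isCompact_Icc (a := R₂ - 1) (b := R₁ + 1)).uniformContinuousOn_of_continuous hc.continuousOn)
    ε hε
  -- Points closer than `1` are both beyond `R₁`, or both below `R₂`, as soon as one of them leaves
  -- the enlarged interval; there both values are near the same limit.
  refine ⟨min δ 1, by positivity, fun x z hxz => ?_⟩
  have h1 := abs_lt.1 (hxz.trans_le (min_le_right _ _))
  have far : ∀ {L : ℝ}, dist (ρ x) L < ε / 2 → dist (ρ z) L < ε / 2 → |ρ x - ρ z| ≤ ε := by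
    intro L hx hz
    rw [← Real.dist_eq]
    linarith [dist_triangle_right (ρ x) (ρ z) L]
  by_cases hx : x ∈ Icc (R₂ - 1) (R₁ + 1)
  · by_cases hz : z ∈ Icc (R₂ - 1) (R₁ + 1)
    · exact (h x hx z hz (hxz.trans_le (min_le_left _ _))).le
    · rw [mem_Icc, not_and_or, not_le, not_le] at hz
      rcases hz with hz | hz
      · exact far (hR₂ x (by linarith)) (hR₂ z (by linarith))
      · exact far (hR₁ x (by linarith)) (hR₁ z (by linarith))
  · rw [mem_Icc, not_and_or, not_le, not_le] at hx
    rcases hx with hx | hx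
    · exact far (hR₂ x (by linarith)) (hR₂ z (by linarith))
    · exact far (hR₁ x (by linarith)) (hR₁ z (by linarith))

namespace Data

variable {ℓ : ℕ} {d : Data ℓ}

/-- Since `γ > 0` inside `(0,1)`, the function `𝓑` is strictly increasing and `Binv` is its true
inverse; of the Hölder bound only uniform continuity is kept. -/
lemma exists_abs_sub_lt_of_B (hd : d.Assumptions) {ε : ℝ} (hε : 0 < ε) :
    ∃ δ : ℝ, 0 < δ ∧ ∀ x ∈ Icc (0 : ℝ) 1, ∀ z ∈ Icc (0 : ℝ) 1, |d.B x - d.B z| < δ →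
      |x - z| < ε := by
  obtain ⟨c, θ, hθ, -, hol⟩ := hd.Binv_holder
  have hγ : ContinuousOn d.γ (Icc 0 1) := hd.γ_smooth.continuousOn
  have hmono : StrictMonoOn d.B (Icc 0 1) := by
    refine strictMonoOn_of_deriv_pos (convex_Icc _ _) (continuousOn_primitive_Icc hγ) fun x hx => ?_
    rw [interior_Icc] at hx
    exact (hasDerivAt_primitive hγ hx).deriv ▸ hd.γ_pos x hx
  have hB0 : d.B 0 = 0 := by simp [B]
  have hmem : ∀ x ∈ Icc (0 : ℝ) 1, d.B x ∈ Icc 0 (d.B 1) := fun x hx =>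
    ⟨hB0 ▸ hmono.monotoneOn ⟨le_rfl, zero_le_one⟩ hx hx.1,
      hmono.monotoneOn hx ⟨zero_le_one, le_rfl⟩ hx.2⟩
  have hinv : ∀ x ∈ Icc (0 : ℝ) 1, d.Binv (d.B x) = x := fun x hx =>
    hmono.injOn.leftInvOn_invFunOn hx
  obtain ⟨δ, hδ, h⟩ := Metric.uniformContinuousOn_iff.1 (hol.uniformContinuousOn hθ) ε hε
  refine ⟨δ, hδ, fun x hx z hz hxz => ?_⟩
  have := h _ (hmem x hx) _ (hmem z hz) hxz
  rwa [hinv x hx, hinv z hz] at this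

/-- Closeness of `𝓑(s_l)` gives closeness of the saturations, hence of `p_c` and of the correction
in the global pressure, hence of both phase pressures. Uniform continuity of the densities on the
whole line finishes, as no pointwise bound on the pressures is available. -/
lemma exists_density_modulus (hd : d.Assumptions) {ε : ℝ} (hε : 0 < ε) :
    ∃ δ : ℝ, 0 < δ ∧ ∀ p s p' s' : Phase → ℝ, d.IsState p s → d.IsState p' s' →
      |d.globalPressure (p Phase.liquid) (s Phase.liquid) -
        d.globalPressure (p' Phase.liquid) (s' Phase.liquid)| < δ →
      |d.B (s Phase.liquid) - d.B (s' Phase.liquid)| < δ →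
      ∀ α, |d.ρ α (p α) * s α - d.ρ α (p' α) * s' α| ≤ ε := by
  obtain ⟨ρm, ρM, hρm, hρ⟩ := hd.ρ_bounds
  have hρM : 0 < ρM := hρm.trans_le ((hρ Phase.liquid 0).1.trans (hρ Phase.liquid 0).2)
  have hρu : ∀ α, ∃ δ : ℝ, 0 < δ ∧ ∀ x z, |x - z| < δ → |d.ρ α x - d.ρ α z| ≤ ε / 2 := fun α =>
    exists_abs_sub_le_of_monotone (hd.ρ_smooth α).continuous (hd.ρ_mono α) (hρ α) (by positivity)
  choose δρ hδρ hρu using hρu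
  set δ₁ := min (δρ Phase.liquid) (δρ Phase.gas) with hδ₁
  have hδ₁0 : 0 < δ₁ := lt_min (hδρ _) (hδρ _)
  have hδ₁α : ∀ α, δ₁ ≤ δρ α := by
    intro α; cases α
    · exact min_le_left _ _
    · exact min_le_right _ _
  have hPc : ContinuousOn d.pcGasPrimitive (Icc 0 1) :=
    continuousOn_primitive_Icc ((continuousOn_gasFraction hd).mul (continuousOn_derivWithin_pc hd))
  obtain ⟨δ₂, hδ₂, hP⟩ := Metric.uniformContinuousOn_iff.1
    (isCompact_Icc.uniformContinuousOn_of_continuous hPc) (δ₁ / 3) (by positivity)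
  obtain ⟨δ₃, hδ₃, hpc⟩ := Metric.uniformContinuousOn_iff.1
    (isCompact_Icc.uniformContinuousOn_of_continuous hd.pc_smooth.continuousOn) (δ₁ / 3)
    (by positivity)
  obtain ⟨δ₄, hδ₄, hB⟩ := exists_abs_sub_lt_of_B hd
    (ε := min (min δ₂ δ₃) (ε / (2 * ρM))) (by positivity)
  refine ⟨min (δ₁ / 3) δ₄, by positivity, fun p s p' s' h h' hπ hBs α => ?_⟩
  have hs := h.mem_Icc Phase.liquid
  have hs' := h'.mem_Icc Phase.liquid
  have hds := hB _ hs _ hs' (hBs.trans_le (min_le_right _ _))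
  have h2 := hP _ hs _ hs' (hds.trans_le ((min_le_left _ _).trans (min_le_left _ _)))
  have h3 := hpc _ hs _ hs' (hds.trans_le ((min_le_left _ _).trans (min_le_right _ _)))
  have h4 := hds.trans_le (min_le_right _ _)
  have h5 := hπ.trans_le (min_le_left _ _)
  rw [Real.dist_eq, abs_lt] at h2 h3
  unfold globalPressure at h5
  rw [abs_lt] at h5
  have hp : |p α - p' α| < δρ α := by
    refine lt_of_lt_of_le ?_ (hδ₁α α)
    have e := h.capillary
    have e' := h'.capillary
    rw [abs_lt]
    cases α
    · constructor <;> linarith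
    · constructor <;> linarith
  have hsα : |s α - s' α| < ε / (2 * ρM) := by
    cases α
    · exact h4
    · rw [h.gas_eq, h'.gas_eq, sub_sub_sub_cancel_left, abs_sub_comm]
      exact h4
  have hsI := h'.mem_Icc α
  have hρb := hρ α (p α)
  have e : d.ρ α (p α) * s α - d.ρ α (p' α) * s' α =
    d.ρ α (p α) * (s α - s' α) + (d.ρ α (p α) - d.ρ α (p' α)) * s' α := by ring
  rw [e]
  refine (abs_add_le _ _).trans ?_
  rw [abs_mul, abs_mul, abs_of_pos (hρm.trans_le hρb.1), abs_of_nonneg hsI.1]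
  have h6 : d.ρ α (p α) * |s α - s' α| ≤ ρM * (ε / (2 * ρM)) :=
    mul_le_mul hρb.2 hsα.le (abs_nonneg _) hρM.le
  have h7 : |d.ρ α (p α) - d.ρ α (p' α)| * s' α ≤ ε / 2 * 1 :=
    mul_le_mul (hρu α _ _ hp) hsI.2 hsI.1 (by positivity)
  have h8 : ρM * (ε / (2 * ρM)) = ε / 2 := by field_simp
  linarith

/-- Where one of the two arguments jumps by at least `δ`, the bound `ρM` on the density difference
is charged to that jump. The resulting affine bound, unlike a general modulus, can be integrated
against total variations. -/
lemma exists_density_sub_le (hd : d.Assumptions) {ε : ℝ} (hε : 0 < ε) :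
    ∃ C : ℝ, 0 ≤ C ∧ ∀ p s p' s' : Phase → ℝ, d.IsState p s → d.IsState p' s' →
      ∀ α, |d.ρ α (p α) * s α - d.ρ α (p' α) * s' α| ≤
        ε + C * (|d.globalPressure (p Phase.liquid) (s Phase.liquid) -
          d.globalPressure (p' Phase.liquid) (s' Phase.liquid)| +
          |d.B (s Phase.liquid) - d.B (s' Phase.liquid)|) := by
  obtain ⟨ρm, ρM, hρm, hρ⟩ := hd.ρ_bounds
  have hρM : 0 < ρM := hρm.trans_le ((hρ Phase.liquid 0).1.trans (hρ Phase.liquid 0).2)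
  obtain ⟨δ, hδ, h⟩ := exists_density_modulus hd hε
  refine ⟨ρM / δ, by positivity, fun p s p' s' hst hst' α => ?_⟩
  set a := |d.globalPressure (p Phase.liquid) (s Phase.liquid) -
    d.globalPressure (p' Phase.liquid) (s' Phase.liquid)| with ha
  set b := |d.B (s Phase.liquid) - d.B (s' Phase.liquid)| with hb
  have ha0 : 0 ≤ a := abs_nonneg _
  have hb0 : 0 ≤ b := abs_nonneg _
  by_cases hab : a < δ ∧ b < δ
  · exact (h p s p' s' hst hst' hab.1 hab.2 α).trans (le_add_of_nonneg_right (by positivity))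
  have hδab : δ ≤ a + b := by
    by_contra hc
    exact hab ⟨by linarith, by linarith⟩
  have h1 : ρM ≤ ρM / δ * (a + b) := by
    rw [div_mul_eq_mul_div, le_div_iff₀ hδ]
    exact mul_le_mul_of_nonneg_left hδab hρM.le
  have hbd : ∀ q, ∀ t ∈ Icc (0 : ℝ) 1, 0 ≤ d.ρ α q * t ∧ d.ρ α q * t ≤ ρM := fun q t ht =>
    ⟨mul_nonneg (hρm.le.trans (hρ α q).1) ht.1,
      (mul_le_mul (hρ α q).2 ht.2 ht.1 hρM.le).trans_eq (mul_one _)⟩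
  have h2 := hbd (p α) (s α) (hst.mem_Icc α)
  have h3 := hbd (p' α) (s' α) (hst'.mem_Icc α)
  have h4 : |d.ρ α (p α) * s α - d.ρ α (p' α) * s' α| ≤ ρM :=
    abs_le.2 ⟨by linarith, by linarith⟩
  linarith

end Data

end TwoPhaseFV

namespace TwoPhaseFV

/-! ### Translates of the approximate solutions -/

namespace Mesh.Admissible

variable {ℓ : ℕ} {m : Mesh ℓ} {Ω Γ : Set (EuclideanSpace ℝ (Fin ℓ))} {ξ : ℝ}

/-- Almost every `x` and `x + y` lie in cells, so a bound for arbitrary pairs of cells, not only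
neighbours, holds pointwise and can be integrated. -/
lemma transNorm_le_of_jump (h : m.Admissible Ω Γ ξ) (hΩo : IsOpen Ω)
    {v a u w : Fin m.card → ℝ} {c₀ c₁ c₂ : ℝ} (h0 : 0 ≤ c₀) (h1 : 0 ≤ c₁) (h2 : 0 ≤ c₂)
    (hv : ∀ K L, |v K - v L| ≤ c₀ + c₁ * |a K - a L| + c₂ * (|u K - u L| + |w K - w L|))
    (y : EuclideanSpace ℝ (Fin ℓ)) :
    m.transNorm Ω v y ≤ ENNReal.ofReal c₀ * volume Ω + ENNReal.ofReal c₁ * m.transNorm Ω a y +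
      ENNReal.ofReal c₂ * (m.transNorm Ω u y + m.transNorm Ω w y) := by
  have ha := h.measurable_pw a
  have hu := h.measurable_pw u
  have hw := h.measurable_pw w
  calc m.transNorm Ω v y
      ≤ ∫⁻ x in transDom Ω y, (ENNReal.ofReal c₀ +
          ENNReal.ofReal c₁ * ‖m.pw a (x + y) - m.pw a x‖ₑ +
          ENNReal.ofReal c₂ * (‖m.pw u (x + y) - m.pw u x‖ₑ + ‖m.pw w (x + y) - m.pw w x‖ₑ)) := by
        refine lintegral_mono_ae ?_
        rw [ae_restrict_iff' (isOpen_transDom hΩo y).measurableSet]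
        filter_upwards [h.ae_mem_cell, (measurePreserving_add_right volume
          y).quasiMeasurePreserving.ae h.ae_mem_cell] with x hx1 hx2 hx
        obtain ⟨K, hK⟩ := hx1 hx.1
        obtain ⟨L, hL⟩ := hx2 (hx.2 (right_mem_segment ℝ _ _))
        simp only [h.pw_of_mem _ hK, h.pw_of_mem _ hL, ← ofReal_norm, Real.norm_eq_abs]
        rw [← ENNReal.ofReal_mul h1, ← ENNReal.ofReal_add (abs_nonneg _) (abs_nonneg _),
          ← ENNReal.ofReal_mul h2, ← ENNReal.ofReal_add h0 (by positivity),
          ← ENNReal.ofReal_add (by positivity) (by positivity)]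
        exact ENNReal.ofReal_le_ofReal (hv L K)
    _ = ENNReal.ofReal c₀ * volume (transDom Ω y) + ENNReal.ofReal c₁ * m.transNorm Ω a y +
          ENNReal.ofReal c₂ * (m.transNorm Ω u y + m.transNorm Ω w y) := by
        rw [lintegral_add_left (by fun_prop), lintegral_add_left (by fun_prop), setLIntegral_const,
          lintegral_const_mul _ (by fun_prop), lintegral_const_mul _ (by fun_prop),
          lintegral_add_left (by fun_prop)]
        rfl
    _ ≤ _ := by
        gcongr
        exact fun x hx => hx.1

lemma transNorm_le_of_bounded (h : m.Admissible Ω Γ ξ) (hΩ : Bornology.IsBounded Ω)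
    (hΩo : IsOpen Ω) {v : Fin m.card → ℝ} {c : ℝ} (hc : 0 ≤ c) (hv : ∀ K, |v K| ≤ c)
    (y : EuclideanSpace ℝ (Fin ℓ)) :
    m.transNorm Ω v y ≤ ENNReal.ofReal (2 * c * (volume Ω).toReal) := by
  have := h.transNorm_le_of_jump hΩo (v := v) (a := v) (u := v) (w := v) (c₀ := 2 * c) (c₁ := 0)
    (c₂ := 0) (by positivity) le_rfl le_rfl
    (fun K L => by
      have h1 := abs_sub (v K) (v L)
      linarith [hv K, hv L]) y
  simp only [ENNReal.ofReal_zero, zero_mul, add_zero] at this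
  rwa [ENNReal.ofReal_mul (by positivity), ENNReal.ofReal_toReal hΩ.measure_lt_top.ne]

lemma transNorm_le_tvInt (h : m.Admissible Ω Γ ξ) (hΩ : Bornology.IsBounded Ω)
    (hΩo : IsOpen Ω) (v : Fin m.card → ℝ) (y : EuclideanSpace ℝ (Fin ℓ)) :
    m.transNorm Ω v y ≤ ENNReal.ofReal (‖y‖ * m.tvInt v) :=
  h.lintegral_translate_le hΩ hΩo v y

end Mesh.Admissible

namespace Discretization

variable {ℓ : ℕ} {D : Discretization ℓ} {d : Data ℓ} {ξ : ℝ}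
  {φ₀ φ₁ m₀ Mx ρm ρM : ℝ} {p s : Phase → ℕ → Fin D.mesh.card → ℝ}

/-- The time interval `(tⁿ, tⁿ⁺¹)`. -/
def step (D : Discretization ℓ) (d : Data ℓ) (n : ℕ) : Set ℝ :=
  Ioo ((n : ℝ) * D.dt d) (((n : ℝ) + 1) * D.dt d)

lemma Ubar_eq (α : Phase) (t : ℝ) (x : EuclideanSpace ℝ (Fin ℓ)) :
    D.Ubar d p s α t x = ∑ n ∈ Finset.range (D.N + 1), (D.step d n).indicator (fun t =>
      (t - (n : ℝ) * D.dt d) / D.dt d * D.mesh.pw (D.U d p s α (n + 1)) x +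
      (((n : ℝ) + 1) * D.dt d - t) / D.dt d * D.mesh.pw (D.U d p s α n) x) t := by
  unfold Ubar
  refine Finset.sum_congr rfl fun n _ => ?_
  by_cases ht : t ∈ D.step d n
  · rw [indicator_of_mem ht]
    unfold Mesh.pw
    rw [Finset.mul_sum, Finset.mul_sum, ← Finset.sum_add_distrib]
    refine Finset.sum_congr rfl fun K _ => ?_
    by_cases hx : x ∈ D.mesh.cell K
    · rw [if_pos ⟨ht, hx⟩, indicator_of_mem hx, indicator_of_mem hx]
      ring
    · rw [if_neg fun h => hx h.2, indicator_of_notMem hx, indicator_of_notMem hx]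
      ring
  · rw [indicator_of_notMem ht]
    exact Finset.sum_eq_zero fun K _ => if_neg fun h => ht h.1

/-- The weights of the affine interpolation in time lie in `[0,1]`. -/
lemma enorm_Ubar_sub_le (hd : d.Assumptions) (α : Phase) (t : ℝ)
    (x x' : EuclideanSpace ℝ (Fin ℓ)) :
    ‖D.Ubar d p s α t x' - D.Ubar d p s α t x‖ₑ ≤ ∑ n ∈ Finset.range (D.N + 1),
      (D.step d n).indicator (fun _ => (1 : ℝ≥0∞)) t *
        (‖D.mesh.pw (D.U d p s α (n + 1)) x' - D.mesh.pw (D.U d p s α (n + 1)) x‖ₑ +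
          ‖D.mesh.pw (D.U d p s α n) x' - D.mesh.pw (D.U d p s α n) x‖ₑ) := by
  have hdt := D.dt_pos hd
  rw [Ubar_eq, Ubar_eq, ← Finset.sum_sub_distrib]
  refine (enorm_sum_le _ _).trans (Finset.sum_le_sum fun n _ => ?_)
  by_cases ht : t ∈ D.step d n
  · simp only [indicator_of_mem ht, one_mul]
    have hweight : ∀ θ a : ℝ, 0 ≤ θ → θ ≤ 1 → ‖θ * a‖ₑ ≤ ‖a‖ₑ := by
      intro θ a h0 h1
      rw [← ofReal_norm, ← ofReal_norm, Real.norm_eq_abs, Real.norm_eq_abs, abs_mul,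
        abs_of_nonneg h0]
      exact ENNReal.ofReal_le_ofReal (mul_le_of_le_one_left (abs_nonneg _) h1)
    rw [add_sub_add_comm, ← mul_sub, ← mul_sub]
    obtain ⟨ht0, ht1⟩ := ht
    refine (enorm_add_le _ _).trans (add_le_add (hweight _ _ ?_ ?_) (hweight _ _ ?_ ?_))
    · exact div_nonneg (by linarith) hdt.le
    · rw [div_le_one hdt]; linarith
    · exact div_nonneg (by linarith) hdt.le
    · rw [div_le_one hdt]; linarith
  · simp only [indicator_of_notMem ht, sub_self, enorm_zero, zero_mul, le_refl]

lemma translateL1_le_sum (hd : d.Assumptions) (hadm : D.mesh.Admissible d.Ω d.Γ ξ) (α : Phase)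
    (y : EuclideanSpace ℝ (Fin ℓ)) :
    D.translateL1 d p s α y ≤ ∑ n ∈ Finset.range (D.N + 1), ENNReal.ofReal (D.dt d) *
      (D.mesh.transNorm d.Ω (D.U d p s α (n + 1)) y + D.mesh.transNorm d.Ω (D.U d p s α n) y) := by
  have hmeas : ∀ n, Measurable (D.mesh.pw (D.U d p s α n)) := fun n => hadm.measurable_pw _
  have hstep : ∀ n, MeasurableSet (D.step d n) := fun n => measurableSet_Ioo
  calc D.translateL1 d p s α y
      = ∫⁻ z, ‖D.Ubar d p s α z.1 (z.2 + y) - D.Ubar d p s α z.1 z.2‖ₑ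
          ∂((volume.restrict (Ioo 0 d.T)).prod (volume.restrict (transDom d.Ω y))) := by
        rw [Measure.prod_restrict, ← Measure.volume_eq_prod]
        rfl
    _ ≤ ∫⁻ z, ∑ n ∈ Finset.range (D.N + 1),
          (D.step d n).indicator (fun _ => (1 : ℝ≥0∞)) z.1 *
            (‖D.mesh.pw (D.U d p s α (n + 1)) (z.2 + y) - D.mesh.pw (D.U d p s α (n + 1)) z.2‖ₑ +
              ‖D.mesh.pw (D.U d p s α n) (z.2 + y) - D.mesh.pw (D.U d p s α n) z.2‖ₑ)
          ∂((volume.restrict (Ioo 0 d.T)).prod (volume.restrict (transDom d.Ω y))) :=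
        lintegral_mono fun z => enorm_Ubar_sub_le hd α z.1 z.2 (z.2 + y)
    _ ≤ _ := by
        have hind : ∀ n, Measurable ((D.step d n).indicator (fun _ => (1 : ℝ≥0∞))) := fun n =>
          measurable_const.indicator (hstep n)
        have hfun : ∀ n, Measurable fun x =>
            (‖D.mesh.pw (D.U d p s α (n + 1)) (x + y) - D.mesh.pw (D.U d p s α (n + 1)) x‖ₑ +
              ‖D.mesh.pw (D.U d p s α n) (x + y) - D.mesh.pw (D.U d p s α n) x‖ₑ) := fun n => by
          have h1 := hmeas n
          have h2 := hmeas (n + 1)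
          fun_prop
        refine (lintegral_finsetSum _ fun n _ =>
          ((hind n).comp measurable_fst).mul ((hfun n).comp measurable_snd)).trans_le ?_
        refine Finset.sum_le_sum fun n _ => ?_
        simp only [Pi.mul_apply, Function.comp_apply]
        rw [lintegral_prod_mul (hind n).aemeasurable (hfun n).aemeasurable]
        refine mul_le_mul' ?_ (le_of_eq ?_)
        · refine (setLIntegral_le_lintegral _ _).trans (le_of_eq ?_)
          rw [lintegral_indicator (hstep n), setLIntegral_const, one_mul, step, Real.volume_Ioo]
          congr 1
          ring
        · have h2 := hmeas (n + 1)
          rw [lintegral_add_left (by fun_prop)]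
          rfl

/-- A time level enters at most two time intervals, and level `0` only one. Level `0` is kept apart
with its weight `δt`, because the energy estimate gives no spatial regularity there. -/
lemma translateL1_le_of_transNorm_le (hd : d.Assumptions) (hadm : D.mesh.Admissible d.Ω d.Γ ξ)
    {α : Phase} {y : EuclideanSpace ℝ (Fin ℓ)} {r : ℕ → ℝ} (hr : ∀ n, 0 ≤ r n)
    (h : ∀ n ≤ D.N + 1, D.mesh.transNorm d.Ω (D.U d p s α n) y ≤ ENNReal.ofReal (r n)) :
    D.translateL1 d p s α y ≤ ENNReal.ofReal
      (2 * (∑ n ∈ Finset.range (D.N + 1), D.dt d * r (n + 1)) + D.dt d * r 0) := by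
  have hdt := D.dt_pos hd
  refine (translateL1_le_sum hd hadm α y).trans ?_
  calc _ ≤ ∑ n ∈ Finset.range (D.N + 1), ENNReal.ofReal (D.dt d * (r (n + 1) + r n)) := by
        refine Finset.sum_le_sum fun n hn => ?_
        have hn' := Finset.mem_range.1 hn
        rw [ENNReal.ofReal_mul hdt.le, ENNReal.ofReal_add (hr _) (hr _)]
        gcongr
        · exact h _ (by omega)
        · exact h _ (by omega)
    _ = ENNReal.ofReal (∑ n ∈ Finset.range (D.N + 1), D.dt d * (r (n + 1) + r n)) :=
        (ENNReal.ofReal_sum_of_nonneg fun n _ =>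
          mul_nonneg hdt.le (add_nonneg (hr _) (hr _))).symm
    _ ≤ _ := by
        refine ENNReal.ofReal_le_ofReal ?_
        simp only [mul_add, Finset.sum_add_distrib]
        have h1 : ∑ n ∈ Finset.range (D.N + 1), D.dt d * r n ≤
            (∑ n ∈ Finset.range (D.N + 1), D.dt d * r (n + 1)) + D.dt d * r 0 := by
          rw [Finset.sum_range_succ', Finset.sum_range_succ _ D.N]
          have := mul_nonneg hdt.le (hr (D.N + 1))
          linarith
        linarith

lemma dt_le (hd : d.Assumptions) : D.dt d ≤ d.T := by
  unfold dt
  exact div_le_self hd.T_pos.le (by linarith [Nat.cast_nonneg (α := ℝ) D.N])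

lemma density_mem (hd : d.Assumptions) (hB : d.Bounds φ₀ φ₁ m₀ Mx ρm ρM)
    (hadm : D.mesh.Admissible d.Ω d.Γ ξ) (hsol : D.IsSolution d p s) {n : ℕ} (hn : n ≤ D.N + 1)
    (α : Phase) (K : Fin D.mesh.card) :
    0 ≤ d.ρ α (p α n K) * s α n K ∧ d.ρ α (p α n K) * s α n K ≤ ρM := by
  have hs := saturation_mem hd hadm hsol hn α K
  have hρ := Data.ρ_pos hd α (p α n K)
  have hρM := (hB.ρ_bounds α (p α n K)).2
  exact ⟨mul_nonneg hρ.le hs.1,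
    (mul_le_mul hρM hs.2 hs.1 (hρ.le.trans hρM)).trans_eq (mul_one _)⟩

lemma abs_U_le (hd : d.Assumptions) (hB : d.Bounds φ₀ φ₁ m₀ Mx ρm ρM)
    (hadm : D.mesh.Admissible d.Ω d.Γ ξ) (hsol : D.IsSolution d p s) {n : ℕ} (hn : n ≤ D.N + 1)
    (α : Phase) (K : Fin D.mesh.card) : |D.U d p s α n K| ≤ |φ₁| * ρM := by
  have hφ := cellMean_φ_mem hd hB hadm K
  have h0 := hB.φ₀_pos.le.trans hφ.1
  have hW := density_mem hd hB hadm hsol hn α K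
  unfold U
  rw [mul_assoc, abs_of_nonneg (mul_nonneg h0 hW.1)]
  exact mul_le_mul (hφ.2.trans (le_abs_self _)) hW.2 hW.1 (abs_nonneg _)

lemma abs_U_sub_le (hd : d.Assumptions) (hB : d.Bounds φ₀ φ₁ m₀ Mx ρm ρM)
    (hadm : D.mesh.Admissible d.Ω d.Γ ξ) (hsol : D.IsSolution d p s) {n : ℕ} (hn : n ≤ D.N + 1)
    (α : Phase) (K L : Fin D.mesh.card) :
    |D.U d p s α n K - D.U d p s α n L| ≤ ρM * |D.cellMean d.φ K - D.cellMean d.φ L| +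
      |φ₁| * |d.ρ α (p α n K) * s α n K - d.ρ α (p α n L) * s α n L| := by
  have hφ := cellMean_φ_mem hd hB hadm L
  have h0 := hB.φ₀_pos.le.trans hφ.1
  have hW := density_mem hd hB hadm hsol hn α K
  have e : D.U d p s α n K - D.U d p s α n L =
      (d.ρ α (p α n K) * s α n K) * (D.cellMean d.φ K - D.cellMean d.φ L) +
      D.cellMean d.φ L * (d.ρ α (p α n K) * s α n K - d.ρ α (p α n L) * s α n L) := by
    unfold U; ring
  rw [e]
  refine (abs_add_le _ _).trans (add_le_add ?_ ?_)
  · rw [abs_mul, abs_of_nonneg hW.1]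
    exact mul_le_mul_of_nonneg_right hW.2 (abs_nonneg _)
  · rw [abs_mul, abs_of_nonneg h0]
    exact mul_le_mul_of_nonneg_right (hφ.2.trans (le_abs_self _)) (abs_nonneg _)

/-- The uniform bound keeps the moduli finite at arguments where no smallness is available. -/
lemma exists_translateL1_bound (hd : d.Assumptions) (ξ : ℝ) :
    ∃ C : ℝ, ∀ D : Discretization ℓ, D.mesh.Admissible d.Ω d.Γ ξ →
      ∀ p s : Phase → ℕ → Fin D.mesh.card → ℝ, D.IsSolution d p s →
        ∀ α y, D.translateL1 d p s α y ≤ ENNReal.ofReal C := by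
  obtain ⟨φ₀, φ₁, m₀, Mx, ρm, ρM, hB⟩ := hd.exists_bounds
  have hρM : 0 ≤ ρM :=
    hB.ρm_pos.le.trans ((hB.ρ_bounds Phase.liquid 0).1.trans (hB.ρ_bounds Phase.liquid 0).2)
  set r := 2 * (|φ₁| * ρM) * (volume d.Ω).toReal with hr
  have hr0 : 0 ≤ r := by positivity
  refine ⟨2 * (d.T * r) + d.T * r, fun D hadm p s hsol α y => ?_⟩
  refine (translateL1_le_of_transNorm_le hd hadm (r := fun _ => r) (fun _ => hr0) fun n hn =>
    hadm.transNorm_le_of_bounded hd.Ω_bounded hd.Ω_open (by positivity)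
      (fun K => abs_U_le hd hB hadm hsol hn α K) y).trans (ENNReal.ofReal_le_ofReal ?_)
  rw [← Finset.sum_mul, D.sum_dt d]
  gcongr
  exact dt_le hd

/-- For a single discrete solution, the translates are controlled by the translation vector. -/
lemma exists_translateL1_le_norm_mul (hd : d.Assumptions) (hadm : D.mesh.Admissible d.Ω d.Γ ξ)
    (p s : Phase → ℕ → Fin D.mesh.card → ℝ) :
    ∃ C : ℝ, 0 ≤ C ∧ ∀ α y, D.translateL1 d p s α y ≤ ENNReal.ofReal (C * ‖y‖) := by
  have hdt := D.dt_pos hd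
  set c : Phase → ℝ := fun α =>
    2 * (∑ n ∈ Finset.range (D.N + 1), D.dt d * D.mesh.tvInt (D.U d p s α (n + 1))) +
      D.dt d * D.mesh.tvInt (D.U d p s α 0)
  have hc : ∀ α, 0 ≤ c α := fun α => by
    have h1 := fun n => mul_nonneg hdt.le (D.mesh.tvInt_nonneg (D.U d p s α n))
    exact add_nonneg (mul_nonneg zero_le_two (Finset.sum_nonneg fun n _ => h1 (n + 1))) (h1 0)
  refine ⟨c Phase.liquid + c Phase.gas, add_nonneg (hc _) (hc _), fun α y => ?_⟩
  refine (translateL1_le_of_transNorm_le hd hadm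
    (r := fun n => ‖y‖ * D.mesh.tvInt (D.U d p s α n))
    (fun n => mul_nonneg (norm_nonneg _) (D.mesh.tvInt_nonneg _)) fun n _ =>
      hadm.transNorm_le_tvInt hd.Ω_bounded hd.Ω_open _ y).trans (ENNReal.ofReal_le_ofReal ?_)
  have e : 2 * (∑ n ∈ Finset.range (D.N + 1),
      D.dt d * (‖y‖ * D.mesh.tvInt (D.U d p s α (n + 1)))) +
      D.dt d * (‖y‖ * D.mesh.tvInt (D.U d p s α 0)) = c α * ‖y‖ := by
    simp only [c, add_mul, Finset.mul_sum, Finset.sum_mul]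
    refine congrArg₂ _ (Finset.sum_congr rfl fun n _ => by ring) (by ring)
  rw [e]
  refine mul_le_mul_of_nonneg_right ?_ (norm_nonneg _)
  cases α
  · exact le_add_of_nonneg_right (hc _)
  · exact le_add_of_nonneg_left (hc _)

/-- Uniform equicontinuity in `L¹` of the approximate densities, up to the mesh size. -/
lemma exists_translateL1_le (hd : d.Assumptions) (hξ : 0 < ξ) {ε : ℝ} (hε : 0 < ε) :
    ∃ δ : ℝ, 0 < δ ∧ ∀ D : Discretization ℓ, D.mesh.Admissible d.Ω d.Γ ξ →
      ∀ p s : Phase → ℕ → Fin D.mesh.card → ℝ, D.IsSolution d p s → D.size d < δ →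
        ∀ α y, ‖y‖ < δ → D.translateL1 d p s α y ≤ ENNReal.ofReal ε := by
  obtain ⟨φ₀, φ₁, m₀, Mx, ρm, ρM, hB⟩ := hd.exists_bounds
  have hρM : 0 < ρM :=
    hB.ρm_pos.trans_le ((hB.ρ_bounds Phase.liquid 0).1.trans (hB.ρ_bounds Phase.liquid 0).2)
  have hT := hd.T_pos
  obtain ⟨CE, hCE0, hCE⟩ := exists_tvInt_estimate hd hξ
  set V := (volume d.Ω).toReal with hV
  have hV0 : 0 ≤ V := ENNReal.toReal_nonneg
  have hVe : volume d.Ω = ENNReal.ofReal V :=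
    (ENNReal.ofReal_toReal hd.Ω_bounded.measure_lt_top.ne).symm
  set a := |φ₁| with ha
  have ha0 : 0 ≤ a := abs_nonneg _
  -- The order of choices matters: `ε₁` determines `C`, and only then is `δ₁` chosen small against
  -- `C * CE`; `δ₂` handles the initial time level. The denominators contain `+ 1` because the
  -- constants may vanish.
  set ε₁ := ε / (8 * (d.T * a * V + 1)) with hε₁
  have hε₁0 : 0 < ε₁ := by positivity
  have hφint : IntegrableOn d.φ d.Ω := by
    have : IsFiniteMeasure (volume.restrict d.Ω) := ⟨by simpa using hd.Ω_bounded.measure_lt_top⟩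
    refine Integrable.of_bound hd.φ_meas.aestronglyMeasurable a ?_
    filter_upwards [hB.φ_bounds] with x hx
    rw [Real.norm_eq_abs, abs_of_nonneg (hB.φ₀_pos.le.trans hx.1)]
    exact hx.2.trans (le_abs_self _)
  obtain ⟨C, hC0, hC⟩ := Data.exists_density_sub_le hd hε₁0
  obtain ⟨δφ, hδφ, hφ⟩ := Mesh.exists_transNorm_average_le hd.Ω_bounded hd.Ω_open hφint
    (ε := ε / (8 * (d.T * ρM))) (by positivity)
  set εφ := ε / (8 * (d.T * ρM)) with hεφ
  have hεφ0 : 0 < εφ := by positivity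
  set δ₁ := ε / (8 * (a * C * CE + 1)) with hδ₁
  set δ₂ := ε / (8 * (a * ρM * V + 1)) with hδ₂
  refine ⟨min δφ (min δ₁ δ₂), by positivity, fun D hadm p s hsol hsize α y hy => ?_⟩
  have hdt := D.dt_pos hd
  have hms : D.mesh.size < δφ := (le_max_left _ _).trans_lt (hsize.trans_le (min_le_left _ _))
  have hdtδ : D.dt d < δ₂ := (le_max_right _ _).trans_lt
    (hsize.trans_le ((min_le_right _ _).trans (min_le_right _ _)))
  have hyφ : ‖y‖ < δφ := hy.trans_le (min_le_left _ _)
  have hy1 : ‖y‖ < δ₁ := hy.trans_le ((min_le_right _ _).trans (min_le_left _ _))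
  have hJφ := hφ D.mesh d.Γ ξ hadm hms y hyφ
  set τ : ℕ → ℝ := fun n => D.mesh.tvInt (D.gp d p s n) +
    D.mesh.tvInt fun K => d.B (s Phase.liquid n K) with hτ
  have hτ0 : ∀ n, 0 ≤ τ n := fun n => add_nonneg (D.mesh.tvInt_nonneg _) (D.mesh.tvInt_nonneg _)
  -- Level `0` is merely bounded. Later levels have three contributions: the uniform error `ε₁`, the
  -- translates of the averaged porosity, and `‖y‖` times the total variations.
  set r : ℕ → ℝ := fun n =>
    if n = 0 then 2 * (a * ρM) * V else a * ε₁ * V + ρM * εφ + a * C * (‖y‖ * τ n) with hr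
  have hr0 : ∀ n, 0 ≤ r n := by
    intro n
    have := hτ0 n
    simp only [hr]
    split_ifs <;> positivity
  have hJ : ∀ n ≤ D.N + 1, D.mesh.transNorm d.Ω (D.U d p s α n) y ≤ ENNReal.ofReal (r n) := by
    intro n hn
    rcases n with _ | n
    · simp only [hr, if_pos]
      exact hadm.transNorm_le_of_bounded hd.Ω_bounded hd.Ω_open (by positivity)
        (fun K => abs_U_le hd hB hadm hsol hn α K) y
    · simp only [hr, if_neg (Nat.succ_ne_zero n)]
      have hn' : n ≤ D.N := by omega
      refine (hadm.transNorm_le_of_jump hd.Ω_open (a := D.cellMean d.φ)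
        (u := D.gp d p s (n + 1)) (w := fun K => d.B (s Phase.liquid (n + 1) K))
        (c₀ := a * ε₁) (c₁ := ρM) (c₂ := a * C) (by positivity) hρM.le (by positivity)
        (fun K L => ?_) y).trans ?_
      · have h1 := abs_U_sub_le hd hB hadm hsol hn α K L
        have h2 := mul_le_mul_of_nonneg_left (hC _ _ _ _ (isState hd hadm hsol hn' K)
          (isState hd hadm hsol hn' L) α) ha0
        refine h1.trans ((add_le_add_right h2 _).trans (le_of_eq ?_))
        unfold gp
        ring
      · have h1 := hadm.transNorm_le_tvInt hd.Ω_bounded hd.Ω_open (D.gp d p s (n + 1)) y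
        have h2 := hadm.transNorm_le_tvInt hd.Ω_bounded hd.Ω_open
          (fun K => d.B (s Phase.liquid (n + 1) K)) y
        have h3 := add_le_add h1 h2
        rw [← ENNReal.ofReal_add (mul_nonneg (norm_nonneg _) (D.mesh.tvInt_nonneg _))
          (mul_nonneg (norm_nonneg _) (D.mesh.tvInt_nonneg _)), ← mul_add] at h3
        have hτ' := hτ0 (n + 1)
        rw [ENNReal.ofReal_add (by positivity) (by positivity),
          ENNReal.ofReal_add (by positivity) (by positivity), ENNReal.ofReal_mul (q := V)
          (by positivity), ENNReal.ofReal_mul (p := ρM) hρM.le,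
          ENNReal.ofReal_mul (p := a * C) (by positivity), hVe]
        gcongr
        exact hJφ
  refine (translateL1_le_of_transNorm_le hd hadm hr0 hJ).trans (ENNReal.ofReal_le_ofReal ?_)
  have hsum : ∑ n ∈ Finset.range (D.N + 1), D.dt d * r (n + 1) =
      d.T * (a * ε₁ * V + ρM * εφ) +
        a * C * ‖y‖ * ∑ n ∈ Finset.range (D.N + 1), D.dt d * τ (n + 1) := by
    rw [← D.sum_dt d, Finset.sum_mul, Finset.mul_sum, ← Finset.sum_add_distrib]
    refine Finset.sum_congr rfl fun n _ => ?_
    simp only [hr, if_neg (Nat.succ_ne_zero n)]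
    ring
  have hr00 : r 0 = 2 * (a * ρM) * V := if_pos rfl
  have hest := hCE D hadm p s hsol
  -- Three terms of size `ε/8`, each counted twice, and `ε/4` from the initial level add up to `ε`.
  have e1 : d.T * (a * ε₁ * V) ≤ ε / 8 := by
    have : ε₁ * (8 * (d.T * a * V + 1)) = ε := div_mul_cancel₀ _ (by positivity)
    nlinarith
  have e2 : d.T * (ρM * εφ) = ε / 8 := by rw [hεφ]; field_simp
  have e3 : a * C * ‖y‖ * ∑ n ∈ Finset.range (D.N + 1), D.dt d * τ (n + 1) ≤ ε / 8 := by
    have h1 : δ₁ * (8 * (a * C * CE + 1)) = ε := div_mul_cancel₀ _ (by positivity)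
    have h2 : a * C * ‖y‖ * ∑ n ∈ Finset.range (D.N + 1), D.dt d * τ (n + 1) ≤ a * C * δ₁ * CE :=
      mul_le_mul (mul_le_mul_of_nonneg_left hy1.le (by positivity)) hest
        (Finset.sum_nonneg fun n _ => mul_nonneg hdt.le (hτ0 _)) (by positivity)
    have h3 : 0 ≤ δ₁ := by positivity
    linarith
  have e4 : D.dt d * (2 * (a * ρM) * V) ≤ ε / 4 := by
    have h1 : δ₂ * (8 * (a * ρM * V + 1)) = ε := div_mul_cancel₀ _ (by positivity)
    have h2 : D.dt d * (2 * (a * ρM) * V) ≤ δ₂ * (2 * (a * ρM) * V) :=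
      mul_le_mul_of_nonneg_right hdtδ.le (by positivity)
    have h3 : 0 ≤ δ₂ := by positivity
    linarith
  rw [hsum, hr00]
  linarith

end Discretization

/-- A bounded family which is uniformly small for small values of a parameter has a modulus of
continuity with respect to that parameter. -/
lemma exists_modulus {ι : Type*} (I : ι → ℝ≥0∞) (r : ι → ℝ) {C : ℝ}
    (hC : ∀ i, I i ≤ ENNReal.ofReal C)
    (h : ∀ ε : ℝ, 0 < ε → ∃ δ : ℝ, 0 < δ ∧ ∀ i, r i < δ → I i ≤ ENNReal.ofReal ε) :
    ∃ ω : ℝ → ℝ, (∀ x, 0 ≤ ω x) ∧ Tendsto ω (𝓝[≥] 0) (𝓝 0) ∧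
      ∀ i, I i ≤ ENNReal.ofReal (ω (r i)) := by
  -- The supremum over all indices with parameter at most `x` is the smallest monotone candidate;
  -- the uniform bound makes it finite.
  set F : ℝ → ℝ≥0∞ := fun x => ⨆ i, ⨆ _ : r i ≤ x, I i
  have hF : ∀ x, F x ≠ ∞ := fun x =>
    ((iSup₂_le fun i _ => hC i).trans_lt ENNReal.ofReal_lt_top).ne
  refine ⟨fun x => (F x).toReal, fun x => ENNReal.toReal_nonneg, ?_, fun i => ?_⟩
  · rw [Metric.tendsto_nhds]
    intro ε hε
    obtain ⟨δ, hδ, hI⟩ := h (ε / 2) (by positivity)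
    filter_upwards [mem_nhdsWithin_of_mem_nhds (Iio_mem_nhds hδ)] with x hx
    rw [Real.dist_eq, sub_zero, abs_of_nonneg ENNReal.toReal_nonneg]
    refine lt_of_le_of_lt (ENNReal.toReal_le_of_le_ofReal (by positivity) ?_) (half_lt_self hε)
    exact iSup₂_le fun i hi => hI i (hi.trans_lt hx)
  · rw [ENNReal.ofReal_toReal (hF _)]
    exact le_iSup₂ (f := fun j (_ : r j ≤ r i) => I j) i le_rfl

end TwoPhaseFV

/-! ### From the ε–δ estimate to moduli of continuity -/

theorem lemma7p1 {ℓ : ℕ} (hℓ : 1 ≤ ℓ) (d : TwoPhaseFV.Data ℓ) (hd : d.Assumptions)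
    (ξ : ℝ) (hξ : 0 < ξ) :
    (∃ ω : ℝ → ℝ, Tendsto ω (𝓝[≥] 0) (𝓝 0) ∧
      ∀ D : TwoPhaseFV.Discretization ℓ, D.mesh.Admissible d.Ω d.Γ ξ →
        ∀ p s : TwoPhaseFV.Phase → ℕ → Fin D.mesh.card → ℝ, D.IsSolution d p s →
          ∀ (α : TwoPhaseFV.Phase) (y : EuclideanSpace ℝ (Fin ℓ)),
            D.translateL1 d p s α y ≤ ENNReal.ofReal (ω ‖y‖ + ω (D.size d))) ∧
    (∀ D : ℕ → TwoPhaseFV.Discretization ℓ, (∀ m, (D m).mesh.Admissible d.Ω d.Γ ξ) →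
      Tendsto (fun m => (D m).size d) atTop (𝓝 0) →
        ∀ p s : ∀ m, TwoPhaseFV.Phase → ℕ → Fin (D m).mesh.card → ℝ,
          (∀ m, (D m).IsSolution d (p m) (s m)) →
            ∃ ω : ℝ → ℝ, Tendsto ω (𝓝[≥] 0) (𝓝 0) ∧
              ∀ (m : ℕ) (α : TwoPhaseFV.Phase) (y : EuclideanSpace ℝ (Fin ℓ)),
                (D m).translateL1 d (p m) (s m) α y ≤ ENNReal.ofReal (ω ‖y‖)) := by
  obtain ⟨C, hC⟩ := TwoPhaseFV.Discretization.exists_translateL1_bound hd ξ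
  constructor
  -- All discretizations, solutions, phases and translations form one family with parameter `max ‖y‖
  -- size`. As `ω ≥ 0`, its value at the maximum is at most the sum of its values at `‖y‖` and at
  -- the size.
  · obtain ⟨ω, hω0, hω, h⟩ := TwoPhaseFV.exists_modulus
      (ι := {q : Σ D : TwoPhaseFV.Discretization ℓ,
        ((TwoPhaseFV.Phase → ℕ → Fin D.mesh.card → ℝ) ×
          (TwoPhaseFV.Phase → ℕ → Fin D.mesh.card → ℝ)) ×
          TwoPhaseFV.Phase × EuclideanSpace ℝ (Fin ℓ) //
        q.1.mesh.Admissible d.Ω d.Γ ξ ∧ q.1.IsSolution d q.2.1.1 q.2.1.2})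
      (fun q => q.1.1.translateL1 d q.1.2.1.1 q.1.2.1.2 q.1.2.2.1 q.1.2.2.2)
      (fun q => max ‖q.1.2.2.2‖ (q.1.1.size d)) (fun q => hC _ q.2.1 _ _ q.2.2 _ _)
      (fun ε hε => by
        obtain ⟨δ, hδ, h⟩ := TwoPhaseFV.Discretization.exists_translateL1_le hd hξ hε
        exact ⟨δ, hδ, fun q hq => h _ q.2.1 _ _ q.2.2 ((le_max_right _ _).trans_lt hq) _ _
          ((le_max_left _ _).trans_lt hq)⟩)
    refine ⟨ω, hω, fun D hadm p s hsol α y => ?_⟩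
    refine (h ⟨⟨D, (p, s), α, y⟩, hadm, hsol⟩).trans (ENNReal.ofReal_le_ofReal ?_)
    rcases max_choice ‖y‖ (D.size d) with h1 | h1
    · simp only [h1]
      exact le_add_of_nonneg_right (hω0 _)
    · simp only [h1]
      exact le_add_of_nonneg_left (hω0 _)
  · intro D hadm hsize p s hsol
    choose c hc0 hc using fun m =>
      TwoPhaseFV.Discretization.exists_translateL1_le_norm_mul hd (hadm m) (p m) (s m)
    obtain ⟨ω, -, hω, h⟩ := TwoPhaseFV.exists_modulus
      (ι := ℕ × TwoPhaseFV.Phase × EuclideanSpace ℝ (Fin ℓ))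
      (fun q => (D q.1).translateL1 d (p q.1) (s q.1) q.2.1 q.2.2) (fun q => ‖q.2.2‖)
      (fun q => hC _ (hadm _) _ _ (hsol _) _ _) (fun ε hε => by
        obtain ⟨δ, hδ, h⟩ := TwoPhaseFV.Discretization.exists_translateL1_le hd hξ hε
        -- From index `M` on the discretizations are fine enough for the uniform estimate. The
        -- finitely many earlier ones are Lipschitz in `y` with constants at most `S`, so `‖y‖ < ε /
        -- (S + 1)` suffices for them.
        obtain ⟨M, hM⟩ := eventually_atTop.1 (hsize.eventually (Iio_mem_nhds hδ))
        set S := ∑ m ∈ Finset.range M, c m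
        have hS0 : 0 ≤ S := Finset.sum_nonneg fun m _ => hc0 m
        refine ⟨min δ (ε / (S + 1)), by positivity, fun q hq => ?_⟩
        rcases le_or_gt M q.1 with hm | hm
        · exact h _ (hadm _) _ _ (hsol _) (hM _ hm) _ _ (hq.trans_le (min_le_left _ _))
        · refine (hc q.1 q.2.1 q.2.2).trans (ENNReal.ofReal_le_ofReal ?_)
          have h1 : c q.1 ≤ S := Finset.single_le_sum (f := c) (fun m _ => hc0 m)
            (Finset.mem_range.2 hm)
          have h2 := (hq.trans_le (min_le_right _ _)).le
          rw [le_div_iff₀ (by positivity)] at h2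
          nlinarith [norm_nonneg q.2.2])
    exact ⟨ω, hω, fun m α y => h (m, α, y)⟩
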